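/- Let $M$ be the manifold of unoriented lines tangent to the unit sphere $\mathbb S^2\subset\mathbb R^3$; a point of $M$ is a pair $(x,\pm\xi)$ with $x\in\mathbb S^2$ and $\xi$ a unit vector tangent to $\mathbb S^2$ at $x$. Let $d_{uv}$ be the Euclidean distance between the lines $u,v\in M$ and, on the manifold $M^6$ of six-tuples $\mathbf m=(u_1,\dots,u_6)$ of such lines, let $D(\mathbf m)=\min_{i<j}d_{u_iu_j}$. The group $SO(3)$ acts on $M^6$ and preserves $D$. Denote by $[(\varphi,\varkappa),\uparrow_\delta]$ the line touching the sphere at the point of latitude $\varphi$ and longitude $\varkappa$ whose direction is the northern direction turned by the angle $\delta$ counterclockwise, as viewed from outside the sphere. Let $C_{\mathfrak m}=C_6(\varphi_{\mathfrak m},\delta_{\mathfrak m},\varkappa_{\mathfrak m})$, where $C_6(\varphi,\delta,\varkappa)$ consists of the lines $$A=[(\varphi,\tfrac{\pi}{6}+\varkappa),\uparrow_\delta],\quad B=[(\varphi,\tfrac{5\pi}{6}+\varkappa),\uparrow_\delta],\quad C=[(\varphi,\tfrac{3\pi}{2}+\varkappa),\uparrow_\delta],$$ $$D=[(-\varphi,\tfrac{\pi}{2}-\varkappa),\uparrow_\delta],\quad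 E=[(-\varphi,\tfrac{7\pi}{6}-\varkappa),\uparrow_\delta],\quad F=[(-\varphi,\tfrac{11\pi}{6}-\varkappa),\uparrow_\delta],$$ and $\varphi_{\mathfrak m}=\arcsin\sqrt{3/11}$, $\delta_{\mathfrak m}=\arctan\sqrt{5/11}$, $\varkappa_{\mathfrak m}=-\arctan(1/\sqrt{15})$. Then the following holds. 1. $D(C_{\mathfrak m})=\sqrt{12/11}$, and $C_{\mathfrak m}$ is a sharp local maximum of $D$ modulo rotations: there is a neighbourhood of $C_{\mathfrak m}$ in $M^6$ such that $D(\mathbf m)<\sqrt{12/11}$ for every $\mathbf m$ in it that is not of the form $R\,C_{\mathfrak m}$, $R\in SO(3)$. 2. Let $r_{\mathfrak m}=\frac{1}{8}(3+\sqrt{33})$, and consider the six open solid cylinders of radius $r_{\mathfrak m}$ that touch the unit ball from outside and have the lines of $C_{\mathfrak m}$ as generators. They are pairwise disjoint and some two of them are at distance zero. Call a *continuous deformation* of a collection $(\Lambda_j)$ of pairwise disjoint open bodies touching the unit ball a family $\Lambda_j(t)=g_j(t)\Lambda_j$, $t\ge 0$, where each $g_j$ is a continuous curve of Euclidean motions with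 $g_j(0)=\mathrm{Id}$ and where, for every $t$, the bodies $\Lambda_j(t)$ are pairwise disjoint and touch the unit ball. The collection of the six cylinders is rigid: for every continuous deformation there is a continuous curve $R(t)$ in $SO(3)$ with $R(0)=\mathrm{Id}$ and $\Lambda_j(t)=R(t)\Lambda_j$ for all $j$ and $t$. It cannot be unlocked: there is no continuous deformation for which some two of the bodies, at distance zero at $t=0$, are at a positive distance for all $t>0$. 3. Write $\exp$ for the exponential map of $M^6$ at $C_{\mathfrak m}$; $M$ carries the standard (Sasaki) metric of the unit tangent bundle, so that a tangent vector $l$ is a six-tuple $(\omega_1,\dots,\omega_6)$ of angular velocities in $\mathbb R^3$, with $\|l\|^2=\sum_i\|\omega_i\|^2$, and $\exp(tl)$ is obtained by rotating the $i$-th line about the axis $\omega_i$ by the angle $t\|\omega_i\|$. Let $\mathfrak r=\{(\omega,\dots,\omega)\}$ be the directions of the $SO(3)$-orbit. In the $15$-dimensional tangent space $T_{C_{\mathfrak m}}M^6/\mathfrak r$ of the configurations modulo rotations there is a $4$-dimensional subspace $L$ such that: - for every linear subspace $S$ of $T_{C_{\mathfrak m}}M^6$ complementary to $\mathfrak r$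 (for instance the vectors that keep the line $A$ fixed) there are constants $0<c_d\le c_u$ such that for every $l\in S$ whose class lies in $L$ $$-c_u\|l\|^2t^2\le D(\exp(tl))-D(C_{\mathfrak m})\le -c_d\|l\|^2t^2\quad\text{for all sufficiently small } |t|;$$ - for every tangent vector $l$ whose class does not lie in $L$ there are $0<c'_d(l)\le c'_u(l)$ such that $$-c'_u(l)\,t\le D(\exp(tl))-D(C_{\mathfrak m})\le -c'_d(l)\,t\quad\text{for all sufficiently small } t>0.$$ -/

import Mathlib

open Set Filter Topology
open scoped NNReal Matrix

namespace SixLines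

/-- Euclidean three-space. -/
abbrev E3 : Type := EuclideanSpace ℝ (Fin 3)

/-! ### Rotations of space -/

/-- The rotation group `SO(3)` (with its topology as a set of matrices). -/
abbrev SO3 : Type := ↥(Matrix.specialOrthogonalGroup (Fin 3) ℝ)

/-- The rotation `R` applied to a vector. -/
def rotateVec (R : SO3) (v : E3) : E3 := WithLp.toLp 2 (R.1 *ᵥ v.ofLp)

theorem inner_rotateVec (R : SO3) (v w : E3) :
    inner ℝ (rotateVec R v) (rotateVec R w) = inner ℝ v w := by
  have h : R.1ᵀ * R.1 = 1 := by
    have := ((Matrix.mem_specialOrthogonalGroup_iff).1 R.2).1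
    exact (Matrix.mem_orthogonalGroup_iff' (Fin 3) ℝ).1 this
  simp only [rotateVec, EuclideanSpace.inner_eq_star_dotProduct, star_trivial]
  rw [Matrix.dotProduct_mulVec, ← Matrix.mulVec_transpose, Matrix.mulVec_mulVec, h,
    Matrix.one_mulVec]

theorem norm_rotateVec (R : SO3) (v : E3) : ‖rotateVec R v‖ = ‖v‖ := by
  have h := inner_rotateVec R v v
  rw [real_inner_self_eq_norm_sq, real_inner_self_eq_norm_sq] at h
  exact (sq_eq_sq₀ (norm_nonneg _) (norm_nonneg _)).1 h

theorem rotateVec_neg (R : SO3) (v : E3) : rotateVec R (-v) = -rotateVec R v := by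
  simp [rotateVec, Matrix.mulVec_neg]

/-- The skew-symmetric matrix of `v ↦ ω × v`. -/
def crossMatrix (ω : E3) : Matrix (Fin 3) (Fin 3) ℝ :=
  !![0, -ω 2, ω 1; ω 2, 0, -ω 0; -ω 1, ω 0, 0]

theorem exp_crossMatrix_mem (ω : E3) :
    NormedSpace.exp (crossMatrix ω) ∈ Matrix.specialOrthogonalGroup (Fin 3) ℝ := by
  have orth : ∀ η : E3, (NormedSpace.exp (crossMatrix η))ᵀ * NormedSpace.exp (crossMatrix η) = 1 := by
    intro η
    have ht : (crossMatrix η)ᵀ = -crossMatrix η := by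
      ext i j
      fin_cases i <;> fin_cases j <;> simp [crossMatrix]
    rw [← Matrix.exp_transpose, ht,
      ← Matrix.exp_add_of_commute _ _ (Commute.neg_left (Commute.refl (crossMatrix η)))]
    simp
  refine (Matrix.mem_specialOrthogonalGroup_iff).2
    ⟨(Matrix.mem_orthogonalGroup_iff' (Fin 3) ℝ).2 (orth ω), ?_⟩
  have hhalf : crossMatrix ω = crossMatrix ((1 / 2 : ℝ) • ω) + crossMatrix ((1 / 2 : ℝ) • ω) := by
    ext i j
    fin_cases i <;> fin_cases j <;> simp [crossMatrix] <;> ring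
  rw [hhalf, Matrix.exp_add_of_commute _ _ (Commute.refl _), Matrix.det_mul]
  have hd := congrArg Matrix.det (orth ((1 / 2 : ℝ) • ω))
  rwa [Matrix.det_mul, Matrix.det_transpose, Matrix.det_one] at hd

/-- The rotation about the axis `ω` by the angle `‖ω‖`, counterclockwise if viewed from the tip
of `ω`; `t ↦ rot (t • ω)` is the one-parameter group of rotations with angular velocity `ω`. -/
noncomputable def rot (ω : E3) : SO3 := ⟨NormedSpace.exp (crossMatrix ω), exp_crossMatrix_mem ω⟩

/-! ### The manifold of lines tangent to the unit sphere -/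

/-- Pairs `(x, ξ)`: a point `x` of the unit sphere and a unit vector `ξ` tangent to it at `x`. -/
abbrev UnitTangent : Type :=
  {p : E3 × E3 // ‖p.1‖ = 1 ∧ ‖p.2‖ = 1 ∧ inner ℝ p.1 p.2 = (0 : ℝ)}

/-- `(x, ξ)` and `(x, -ξ)` represent the same (unoriented) tangent line. -/
instance lineSetoid : Setoid UnitTangent where
  r p q := p.1.1 = q.1.1 ∧ (p.1.2 = q.1.2 ∨ p.1.2 = -q.1.2)
  iseqv := by
    refine ⟨fun p => ⟨rfl, Or.inl rfl⟩, ?_, ?_⟩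
    · rintro p q ⟨h, h1 | h1⟩
      · exact ⟨h.symm, Or.inl h1.symm⟩
      · exact ⟨h.symm, Or.inr (by rw [h1, neg_neg])⟩
    · rintro p q s ⟨h, h1 | h1⟩ ⟨k, k1 | k1⟩
      · exact ⟨h.trans k, Or.inl (h1.trans k1)⟩
      · exact ⟨h.trans k, Or.inr (h1.trans k1)⟩
      · exact ⟨h.trans k, Or.inr (by rw [h1, k1])⟩
      · exact ⟨h.trans k, Or.inl (by rw [h1, k1, neg_neg])⟩

/-- The manifold `M` of unoriented tangent lines to the unit sphere, with the quotient topology. -/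
abbrev M : Type := Quotient lineSetoid

/-- For the tangent line `u = (x, ξ)`, the parallel line `{ρ x + s ξ}`. -/
def parallelLine (ρ : ℝ) (u : M) : Set E3 :=
  Quotient.lift (fun p : UnitTangent => Set.range fun s : ℝ => ρ • p.1.1 + s • p.1.2)
    (by
      rintro ⟨⟨x, ξ⟩, hp⟩ ⟨⟨y, η⟩, hq⟩ ⟨h, h1 | h1⟩ <;> simp only at h h1 <;> subst h h1
      · rfl
      · ext z
        constructor
        · rintro ⟨s, rfl⟩
          exact ⟨-s, by simp⟩
        · rintro ⟨s, rfl⟩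
          exact ⟨-s, by simp⟩) u

/-- The tangent line itself, `{x + s ξ}`, as a set of points. -/
def lineSet (u : M) : Set E3 := parallelLine 1 u

/-- The distance between two sets: the infimum of the distances between their points. -/
noncomputable def setDist (A B : Set E3) : ℝ := sInf (Set.image2 dist A B)

/-- The distance `d_{uv}` between two tangent lines. -/
noncomputable def lineDist (u v : M) : ℝ := setDist (lineSet u) (lineSet v)

/-- Six-tuples of tangent lines. -/
abbrev M6 : Type := Fin 6 → M

/-- The function `D`, the least of the fifteen pairwise distances. -/
noncomputable def minDist (m : M6) : ℝ :=
  ⨅ p : {p : Fin 6 × Fin 6 // p.1 < p.2}, lineDist (m p.1.1) (m p.1.2)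

/-- The action of rotations on tangent lines. -/
def rotateLine (R : SO3) : M → M :=
  Quotient.map
    (fun p : UnitTangent =>
      (⟨(rotateVec R p.1.1, rotateVec R p.1.2), by
        simpa only [norm_rotateVec, inner_rotateVec] using p.2⟩ : UnitTangent))
    (by
      rintro p q ⟨h, h1 | h1⟩
      · exact ⟨congrArg (rotateVec R) h, Or.inl (congrArg (rotateVec R) h1)⟩
      · exact ⟨congrArg (rotateVec R) h,
          Or.inr ((congrArg (rotateVec R) h1).trans (rotateVec_neg R _))⟩)

/-! ### Tangent vectors and the exponential map of `M⁶` -/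

/-- Tangent vectors to `M⁶`. A tangent vector to `M` at `(x, ξ)` is written uniquely as the
infinitesimal rotation `(ω × x, ω × ξ)`, and `‖ω‖` is its length in the standard (Sasaki) metric
of the unit tangent bundle. -/
abbrev TM6 : Type := PiLp 2 (fun _ : Fin 6 => E3)

/-- The exponential map of `M⁶`: the geodesics of `M` are the curves `rot (t • ω) (x, ξ)`. -/
noncomputable def expMap (m : M6) (l : TM6) : M6 := fun i => rotateLine (rot (l i)) (m i)

/-- The directions tangent to the orbits of `SO(3)`: the same infinitesimal rotation for all
the six lines. -/
def rotDirections : Submodule ℝ TM6 where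
  carrier := {l | ∀ i j, l i = l j}
  add_mem' := by
    intro a b ha hb i j
    simp [ha i j, hb i j]
  zero_mem' := by
    intro i j
    simp
  smul_mem' := by
    intro c a ha i j
    simp [ha i j]

/-! ### The configurations -/

/-- The line touching the sphere at the point with latitude `φ` and longitude `ϰ`, whose direction
is the direction to the North turned by `δ` counterclockwise (viewed from outside), i.e. towards
the West: `ξ = cos δ • north - sin δ • east`. -/
noncomputable def tangentLine (φ ϰ δ : ℝ) : M :=
  Quotient.mk lineSetoid
    ⟨(!₂[Real.cos φ * Real.cos ϰ, Real.cos φ * Real.sin ϰ, Real.sin φ],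
      !₂[-(Real.cos δ * Real.sin φ * Real.cos ϰ) + Real.sin δ * Real.sin ϰ,
        -(Real.cos δ * Real.sin φ * Real.sin ϰ) - Real.sin δ * Real.cos ϰ,
        Real.cos δ * Real.cos φ]), by
      have h1 := Real.sin_sq_add_cos_sq φ
      have h2 := Real.sin_sq_add_cos_sq ϰ
      have h3 := Real.sin_sq_add_cos_sq δ
      generalize Real.sin φ = a at *
      generalize Real.cos φ = b at *
      generalize Real.sin ϰ = c at *
      generalize Real.cos ϰ = d at *
      generalize Real.sin δ = e at *
      generalize Real.cos δ = f at *
      refine ⟨?_, ?_, ?_⟩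
      · rw [EuclideanSpace.norm_eq, Real.sqrt_eq_one]
        simp [Fin.sum_univ_three]
        linear_combination h1 + b ^ 2 * h2
      · rw [EuclideanSpace.norm_eq, Real.sqrt_eq_one]
        simp [Fin.sum_univ_three]
        linear_combination h3 + f ^ 2 * h1 + (f ^ 2 * a ^ 2 + e ^ 2) * h2
      · simp [PiLp.inner_apply, Fin.sum_univ_three]
        linear_combination (-(a * b * f)) * h2⟩

/-- The configuration `C₆(φ, δ, ϰ)`; the lines with the indices `0, …, 5` are, in this order,
`A = [(φ, π/6 + ϰ), δ]`, `D = [(-φ, π/2 - ϰ), δ]`, `B = [(φ, 5π/6 + ϰ), δ]`,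
`E = [(-φ, 7π/6 - ϰ), δ]`, `C = [(φ, 3π/2 + ϰ), δ]`, `F = [(-φ, 11π/6 - ϰ), δ]`. -/
noncomputable def C6 (φ δ ϰ : ℝ) : M6 :=
  ![tangentLine φ (Real.pi / 6 + ϰ) δ, tangentLine (-φ) (Real.pi / 2 - ϰ) δ,
    tangentLine φ (5 * Real.pi / 6 + ϰ) δ, tangentLine (-φ) (7 * Real.pi / 6 - ϰ) δ,
    tangentLine φ (3 * Real.pi / 2 + ϰ) δ, tangentLine (-φ) (11 * Real.pi / 6 - ϰ) δ]

/-- The record configuration `C_𝔪`. -/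
noncomputable def Cm : M6 :=
  C6 (Real.arcsin √(3 / 11)) (Real.arctan √(5 / 11)) (-Real.arctan (1 / √15))

/-! ### Bodies touching the unit ball, their deformations, unlocking and rigidity -/

/-- The open solid cylinder of radius `r` touching the unit sphere from outside, having the
tangent line `u` as a generator; its axis is the line parallel to `u` through `(1 + r) x`. -/
def cylinder (r : ℝ) (u : M) : Set E3 := {p | Metric.infDist p (parallelLine (1 + r) u) < r}

/-- Non-intersecting open bodies, each of which touches the unit central ball. -/
def IsCollection {ι : Type} (Λ : ι → Set E3) : Prop :=
  (∀ j, IsOpen (Λ j)) ∧ (∀ i j, i ≠ j → Disjoint (Λ i) (Λ j)) ∧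
    ∀ j, Disjoint (Λ j) (Metric.ball 0 1) ∧ (closure (Λ j) ∩ Metric.closedBall 0 1).Nonempty

/-- `t ↦ (g_j(t) Λ_j)_j`, `t ≥ 0`, is a continuous deformation of the collection `Λ`: the `g_j` are
continuous curves of Euclidean motions that start at the identity, and at each time `t` one has
non-intersecting bodies touching the unit central ball. -/
def IsDeformation {ι : Type} (Λ : ι → Set E3) (g : ι → ℝ≥0 → (E3 ≃ᵃⁱ[ℝ] E3)) : Prop :=
  (∀ j, Continuous fun p : ℝ≥0 × E3 => g j p.1 p.2) ∧
    (∀ j, g j 0 = AffineIsometryEquiv.refl ℝ E3) ∧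
    ∀ t, IsCollection fun j => g j t '' Λ j

/-- Some of the zero distances between the bodies become positive for all `t > 0` under a suitable
continuous deformation. -/
def CanBeUnlocked {ι : Type} (Λ : ι → Set E3) : Prop :=
  ∃ g, IsDeformation Λ g ∧ ∃ i j, i ≠ j ∧ setDist (Λ i) (Λ j) = 0 ∧
    ∀ t : ℝ≥0, 0 < t → 0 < setDist (g i t '' Λ i) (g j t '' Λ j)

/-- The only continuous deformations are global rotations. -/
def IsRigid {ι : Type} (Λ : ι → Set E3) : Prop :=
  ∀ g, IsDeformation Λ g → ∃ R : ℝ≥0 → SO3, Continuous R ∧ R 0 = 1 ∧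
    ∀ t j, g j t '' Λ j = rotateVec (R t) '' Λ j

/-- The radius `r_𝔪` of the cylinders of the record configuration. -/
noncomputable def rm : ℝ := (3 + √33) / 8

/-- The six cylinders of the record configuration. -/
noncomputable def cylindersCm : Fin 6 → Set E3 := fun i => cylinder rm (Cm i)

end SixLines

open SixLines

/-!
A tangent line is described by a frame `X = (x, ξ, x × ξ)` in `SO(3)`, unique up to the sign of `ξ`,
and the position of two lines modulo rotations by the matrix `W = Xᵀ Y`. If `θ` is the angle and `d`
the distance of the lines, then `(d² - 12 / 11) sin² θ` is a polynomial `gap W` in the entries of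
`W`, so that questions on the distance near `√(12 / 11)` become questions on the sign of `gap`.

The record configuration is an orbit of a dihedral group of order six: its frames are `g X₀`, with
`g` in this group. Hence its fifteen pairs of lines show only four relative positions `relMat k`,
one for each orbit of the group on the pairs. Three orbits, with twelve pairs, have `gap = 0`; these
are the contacts. The fourth has `gap > 0`, which gives the value of `D`.

Turn the lines by infinitesimal rotations `a`, in the coordinates of their frames. The gap of each
contact has a second order expansion with the terms `edgeLin a` and `edgeQuad a`. There are positive
multipliers `mult` with `∑ mult * edgeLin a = 0` for all `a` (`sum_mult_edgeLin`), so outside of the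
common kernel of the `edgeLin` some gap decreases to first order. This kernel has dimension seven,
and contains the three-dimensional space of global rotations. On it, the Lagrangian
`∑ mult * edgeQuad a` is minus a sum of squares that vanishes only on the rotations
(`lagrangian_kernelVec`, `eq_const_of_lagrangian_eq_zero`), so some gap decreases to second order.
This gives the two kinds of decay along geodesics, with the image of the kernel as the space `L`.

For the strict local maximum, configurations are considered that approach the record one, differ
from its rotated copies, and have nonnegative gaps at all contacts. Normalized by rotations and
rescaled, they have a limit direction `s`. Its `edgeLin` are nonnegative, hence zero; dividing the
weighted sum of the gaps by the square of the scale shows that the Lagrangian of `s` is nonnegative,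
a contradiction (`local_rigidity`).

A solid cylinder of radius `r` touching the unit ball has its axis at the distance `1 + r` from the
origin, and the axes of two cylinders are the `(1 + r)`-fold enlargements of the generators. As
`(1 + r) √(12 / 11) = 2 r` for `r = rm`, two such cylinders are disjoint exactly if the distance of
the generators is at least `√(12 / 11)`. A continuous deformation of the six cylinders is therefore
a curve of configurations of lines on which `D ≥ √(12 / 11)`. The set of times at which such a curve
is at a rotated copy of the record configuration is closed, and open by the strict local maximality,
so it is everything; this is rigidity, which preserves all the distances and forbids unlocking.
-/

namespace SixLines

/-! ### Second order expansion of the gap of two lines -/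

/-- Real `3 × 3` matrices. -/
abbrev Mat3 : Type := Matrix (Fin 3) (Fin 3) ℝ

/-- The first order term, in the infinitesimal rotations `A`, `B`, of `exp(A)ᵀ W exp(B)`. -/
def relLin (W A B : Mat3) : Mat3 := W * B - A * W

/-- The second order term, in the infinitesimal rotations `A`, `B`, of `exp(A)ᵀ W exp(B)`. -/
noncomputable def relQuad (W A B : Mat3) : Mat3 :=
  (1 / 2 : ℝ) • (W * (B * B)) + (1 / 2 : ℝ) • (A * A * W) - A * W * B

/-- For `W = Xᵀ Y`, the relative position of the frames `X`, `Y` of two tangent lines, this is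
`(d² - 12 / 11) sin² θ`, where `d` is the distance of the lines and `θ` their angle: the scalar
`W 1 2 + W 2 1` is, up to sign, the mixed product of the two directions and the difference of the
two points of tangency, and `W 1 1 = cos θ`. Unlike `d` it is a polynomial in `W`. -/
noncomputable def gap (W : Mat3) : ℝ := (W 1 2 + W 2 1) ^ 2 - 12 / 11 * (1 - W 1 1 ^ 2)

/-- The first order term of `gap` at `W` when the two frames are turned infinitesimally by `a` and
`b` (in body coordinates). -/
noncomputable def gapLin (W : Mat3) (a b : E3) : ℝ :=
  2 * (W 1 2 + W 2 1) *
      (relLin W (crossMatrix a) (crossMatrix b) 1 2 +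
        relLin W (crossMatrix a) (crossMatrix b) 2 1) +
    24 / 11 * W 1 1 * relLin W (crossMatrix a) (crossMatrix b) 1 1

/-- The second order term of `gap` at `W` when the two frames are turned infinitesimally by `a` and
`b` (in body coordinates). -/
noncomputable def gapQuad (W : Mat3) (a b : E3) : ℝ :=
  (relLin W (crossMatrix a) (crossMatrix b) 1 2 +
      relLin W (crossMatrix a) (crossMatrix b) 2 1) ^ 2 +
    2 * (W 1 2 + W 2 1) *
      (relQuad W (crossMatrix a) (crossMatrix b) 1 2 +
        relQuad W (crossMatrix a) (crossMatrix b) 2 1) +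
    12 / 11 * (relLin W (crossMatrix a) (crossMatrix b) 1 1 ^ 2 +
      2 * W 1 1 * relQuad W (crossMatrix a) (crossMatrix b) 1 1)

theorem crossMatrix_transpose (a : E3) : (crossMatrix a)ᵀ = -crossMatrix a := by
  ext i j
  fin_cases i <;> fin_cases j <;> simp [crossMatrix]

theorem crossMatrix_smul (t : ℝ) (a : E3) : crossMatrix (t • a) = t • crossMatrix a := by
  ext i j
  fin_cases i <;> fin_cases j <;> simp [crossMatrix]

theorem gapLin_smul (W : Mat3) (t : ℝ) (a b : E3) :
    gapLin W (t • a) (t • b) = t * gapLin W a b := by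
  simp only [gapLin, relLin, crossMatrix_smul, Matrix.mul_smul, Matrix.smul_mul, Matrix.sub_apply,
    Matrix.smul_apply, smul_eq_mul]
  ring

theorem gapQuad_smul (W : Mat3) (t : ℝ) (a b : E3) :
    gapQuad W (t • a) (t • b) = t ^ 2 * gapQuad W a b := by
  simp only [gapQuad, relLin, relQuad, crossMatrix_smul, Matrix.mul_smul, Matrix.smul_mul,
    Matrix.sub_apply, Matrix.add_apply, Matrix.smul_apply, smul_eq_mul]
  ring

theorem relative_expansion_identity (W X Y A B : Mat3) :
    (X - 1 + A - (1 / 2 : ℝ) • (A * A)) * W * Y +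
      (1 - A + (1 / 2 : ℝ) • (A * A)) * W * (Y - 1 - B - (1 / 2 : ℝ) • (B * B)) -
      (1 / 2 : ℝ) • (A * W * (B * B)) + (1 / 2 : ℝ) • (A * A * W * B) +
      (1 / 4 : ℝ) • (A * A * W * (B * B)) = X * W * Y - W - relLin W A B - relQuad W A B := by
  simp only [relLin, relQuad, add_mul, mul_sub, sub_mul, one_mul, mul_one, smul_mul_assoc,
    mul_smul_comm, mul_assoc]
  module

section Expansion

attribute [local instance] Matrix.linftyOpNormedRing Matrix.linftyOpNormedAlgebra

open Asymptotics

theorem norm_entry_le (X : Mat3) (i j : Fin 3) : ‖X i j‖ ≤ ‖X‖ := by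
  have h1 : ‖X i j‖₊ ≤ ‖X‖₊ := by
    rw [Matrix.linfty_opNNNorm_def]
    exact (Finset.single_le_sum (f := fun j => ‖X i j‖₊) (fun _ _ => zero_le)
      (Finset.mem_univ j)).trans
      (Finset.le_sup (f := fun i => ∑ j, ‖X i j‖₊) (Finset.mem_univ i))
  exact_mod_cast h1

variable {α : Type*} {l : Filter α}

theorem isBigO_entry {X : α → Mat3} {g : α → ℝ} (h : X =O[l] g) (i j : Fin 3) :
    (fun x => X x i j) =O[l] g :=
  (IsBigO.of_bound 1 (Eventually.of_forall fun x => by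
    simpa using norm_entry_le (X x) i j)).trans h

theorem isBigO_of_entries {X : α → Mat3} {g : α → ℝ} (h : ∀ i j, (fun x => X x i j) =O[l] g) :
    X =O[l] g := by
  have : (fun x => ∑ i, ∑ j, ‖X x i j‖) =O[l] g :=
    IsBigO.fun_sum fun i _ => IsBigO.fun_sum fun j _ => (h i j).norm_left
  refine IsBigO.trans (IsBigO.of_bound 1 (Eventually.of_forall fun x => ?_)) this
  rw [one_mul, Matrix.linfty_opNorm_def]
  refine (?_ : _ ≤ ∑ i, ∑ j, ‖X x i j‖).trans (le_abs_self _)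
  have : (Finset.univ.sup fun i => ∑ j, ‖X x i j‖₊) ≤ ∑ i, ∑ j, ‖X x i j‖₊ :=
    Finset.sup_le fun i _ => Finset.single_le_sum (f := fun i => ∑ j, ‖X x i j‖₊)
      (fun _ _ => zero_le) (Finset.mem_univ i)
  exact_mod_cast this

theorem isBigO_transpose {X : α → Mat3} {g : α → ℝ} (h : X =O[l] g) :
    (fun x => (X x)ᵀ) =O[l] g :=
  isBigO_of_entries fun i j => isBigO_entry h j i

theorem isBigO_crossMatrix {a : α → E3} {r : α → ℝ} (h : a =O[l] r) :
    (fun x => crossMatrix (a x)) =O[l] r := by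
  have hk : ∀ k, (fun x => a x k) =O[l] r := fun k =>
    (IsBigO.of_bound 1 (Eventually.of_forall fun x => by
      simpa using PiLp.norm_apply_le (a x) k)).trans h
  refine isBigO_of_entries fun i j => ?_
  fin_cases i <;> fin_cases j <;> simp [crossMatrix, isBigO_zero, isBigO_neg_left, hk]

/-- If `P` and `Q` agree with `exp (a×)` and `exp (b×)` up to third order, then `Pᵀ W Q` has the
expansion with the terms `relLin` and `relQuad`. -/
theorem relative_expansion {P Q : α → Mat3} {a b : α → E3} {r : α → ℝ} (W : Mat3)
    (hr : Tendsto r l (𝓝 0)) (ha : a =O[l] r) (hb : b =O[l] r)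
    (hP : (fun x => P x - 1 - crossMatrix (a x) -
      (1 / 2 : ℝ) • (crossMatrix (a x) * crossMatrix (a x))) =O[l] fun x => r x ^ 3)
    (hQ : (fun x => Q x - 1 - crossMatrix (b x) -
      (1 / 2 : ℝ) • (crossMatrix (b x) * crossMatrix (b x))) =O[l] fun x => r x ^ 3) :
    (fun x => (P x)ᵀ * W * Q x - W - relLin W (crossMatrix (a x)) (crossMatrix (b x)) -
      relQuad W (crossMatrix (a x)) (crossMatrix (b x))) =O[l] fun x => r x ^ 3 := by
  have hr1 : r =O[l] fun _ => (1 : ℝ) := hr.isBigO_one ℝ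
  have hA := isBigO_crossMatrix ha
  have hB := isBigO_crossMatrix hb
  have hW : (fun _ : α => W) =O[l] fun _ => (1 : ℝ) := isBigO_const_const _ one_ne_zero _
  have hI : (fun _ : α => (1 : Mat3)) =O[l] fun _ => (1 : ℝ) := isBigO_const_const _ one_ne_zero _
  have hA1 := hA.trans hr1
  have hB1 := hB.trans hr1
  have hBB : (fun x => (1 / 2 : ℝ) • (crossMatrix (b x) * crossMatrix (b x))) =O[l]
      fun _ => (1 : ℝ) := by simpa using (hB1.mul hB1).const_smul_left (1 / 2 : ℝ)
  have hAA : (fun x => (1 / 2 : ℝ) • (crossMatrix (a x) * crossMatrix (a x))) =O[l]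
      fun _ => (1 : ℝ) := by simpa using (hA1.mul hA1).const_smul_left (1 / 2 : ℝ)
  have hr3 : (fun x => r x ^ 3) =O[l] fun _ => (1 : ℝ) := by simpa using hr1.pow 3
  have hQ1 : Q =O[l] fun _ => (1 : ℝ) := by
    have := ((hQ.trans hr3).add hI).add (hB1.add hBB)
    refine this.congr_left fun x => ?_
    abel
  have hPt := isBigO_transpose hP
  have e1 := (hPt.mul hW).mul hQ1
  have e2 := (((hI.sub hA1).add hAA).mul hW).mul hQ
  have e3 := ((hA.mul hW).mul (hB.mul hB)).const_smul_left (1 / 2 : ℝ)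
  have e4 := (((hA.mul hA).mul hW).mul hB).const_smul_left (1 / 2 : ℝ)
  have e5 := (((hA.mul hA).mul hW).mul (hB.mul hB1)).const_smul_left (1 / 4 : ℝ)
  simp only [mul_one, one_mul] at e1 e2 e3 e4 e5
  have p3 : ∀ x, r x * (r x * r x) = r x ^ 3 := fun x => by ring
  have p3' : ∀ x, r x * r x * r x = r x ^ 3 := fun x => by ring
  simp only [p3, p3'] at e3 e4 e5
  refine ((((e1.add e2).sub e3).add e4).add e5).congr_left fun x => ?_
  have ht : (P x - 1 - crossMatrix (a x) - (1 / 2 : ℝ) • (crossMatrix (a x) * crossMatrix (a x)))ᵀ =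
      (P x)ᵀ - 1 + crossMatrix (a x) - (1 / 2 : ℝ) • (crossMatrix (a x) * crossMatrix (a x)) := by
    simp only [Matrix.transpose_sub, Matrix.transpose_smul, Matrix.transpose_mul,
      crossMatrix_transpose, Matrix.transpose_one]
    simp
  have := relative_expansion_identity W (P x)ᵀ (Q x) (crossMatrix (a x)) (crossMatrix (b x))
  rw [← this, ← ht]
  rfl

theorem gap_expansion {P Q : α → Mat3} {a b : α → E3} {r : α → ℝ} (W : Mat3)
    (hr : Tendsto r l (𝓝 0)) (ha : a =O[l] r) (hb : b =O[l] r)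
    (hP : (fun x => P x - 1 - crossMatrix (a x) -
      (1 / 2 : ℝ) • (crossMatrix (a x) * crossMatrix (a x))) =O[l] fun x => r x ^ 3)
    (hQ : (fun x => Q x - 1 - crossMatrix (b x) -
      (1 / 2 : ℝ) • (crossMatrix (b x) * crossMatrix (b x))) =O[l] fun x => r x ^ 3) :
    (fun x => gap ((P x)ᵀ * W * Q x) - gap W - gapLin W (a x) (b x) - gapQuad W (a x) (b x))
      =O[l] fun x => r x ^ 3 := by
  have hE := relative_expansion W hr ha hb hP hQ
  have hr1 : r =O[l] fun _ => (1 : ℝ) := hr.isBigO_one ℝ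
  have hr2 : (fun x => r x ^ 2) =O[l] fun _ => (1 : ℝ) := by simpa using hr1.pow 2
  have hr3 : (fun x => r x ^ 3) =O[l] fun _ => (1 : ℝ) := by simpa using hr1.pow 3
  have hA := isBigO_crossMatrix ha
  have hB := isBigO_crossMatrix hb
  have hW : (fun _ : α => W) =O[l] fun _ => (1 : ℝ) := isBigO_const_const _ one_ne_zero _
  have h1 : (fun x => relLin W (crossMatrix (a x)) (crossMatrix (b x))) =O[l] r := by
    simpa [relLin] using ((hW.mul hB).congr_right fun x => one_mul (r x)).sub
      ((hA.mul hW).congr_right fun x => mul_one (r x))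
  have h2 : (fun x => relQuad W (crossMatrix (a x)) (crossMatrix (b x))) =O[l]
      fun x => r x ^ 2 := by
    have := (((hW.mul (hB.mul hB)).const_smul_left (1 / 2 : ℝ)).add
      (((hA.mul hA).mul hW).const_smul_left (1 / 2 : ℝ) |>.congr_right fun x => by ring)).sub
      (((hA.mul hW).mul hB).congr_right fun x => by ring)
    refine this.congr_right fun x => by ring
  set U : α → Mat3 := fun x => relLin W (crossMatrix (a x)) (crossMatrix (b x)) with hU
  set V : α → Mat3 := fun x => relQuad W (crossMatrix (a x)) (crossMatrix (b x)) with hV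
  set Z : α → Mat3 := fun x => (P x)ᵀ * W * Q x - W - U x - V x with hZ
  have key : ∀ (d0 : ℝ) (d1 d2 d3 : α → ℝ), d1 =O[l] r → d2 =O[l] (fun x => r x ^ 2) →
      d3 =O[l] (fun x => r x ^ 3) →
      (fun x => (d0 + d1 x + d2 x + d3 x) ^ 2 - d0 ^ 2 - 2 * d0 * d1 x - d1 x ^ 2 - 2 * d0 * d2 x)
        =O[l] fun x => r x ^ 3 := by
    intro d0 d1 d2 d3 k1 k2 k3
    have c0 : (fun _ : α => 2 * d0) =O[l] fun _ => (1 : ℝ) := isBigO_const_const _ one_ne_zero _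
    have e1 := ((k1.mul k2).const_mul_left 2).congr_right (g₂ := fun x => r x ^ 3) fun x => by ring
    have e2' : (fun x => d2 x * d2 x) =O[l] fun x => r x ^ 3 := by
      have := ((k2.mul k2).congr_right (g₂ := fun x => r x ^ 3 * r x) fun x => by ring)
      exact this.trans (((isBigO_refl (fun x => r x ^ 3) l).mul hr1).congr_right fun x => by ring)
    have e3 := (k3.mul ((((c0.add ((k1.trans hr1).const_mul_left 2)).add
      ((k2.trans hr2).const_mul_left 2))).add (k3.trans hr3))).congr_right
      (g₂ := fun x => r x ^ 3) fun x => by ring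
    exact ((e1.add e2').add e3).congr_left fun x => by ring
  have kD := key (W 1 2 + W 2 1) (fun x => U x 1 2 + U x 2 1) (fun x => V x 1 2 + V x 2 1)
    (fun x => Z x 1 2 + Z x 2 1) ((isBigO_entry h1 1 2).add (isBigO_entry h1 2 1))
    ((isBigO_entry h2 1 2).add (isBigO_entry h2 2 1))
    ((isBigO_entry hE 1 2).add (isBigO_entry hE 2 1))
  have kc := key (W 1 1) (fun x => U x 1 1) (fun x => V x 1 1) (fun x => Z x 1 1)
    (isBigO_entry h1 1 1) (isBigO_entry h2 1 1) (isBigO_entry hE 1 1)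
  refine (kD.add (kc.const_mul_left (12 / 11))).congr_left fun x => ?_
  have hz : ∀ i j, ((P x)ᵀ * W * Q x) i j = W i j + U x i j + V x i j + Z x i j := by
    intro i j
    simp only [hZ, Matrix.sub_apply]
    ring
  simp only [gap, gapLin, gapQuad, hz]
  ring

/-- The geodesic case of the hypotheses of `gap_expansion`. -/
theorem exp_expansion (A : Mat3) :
    (fun t : ℝ => NormedSpace.exp (t • A) - 1 - t • A - (1 / 2 : ℝ) • ((t • A) * (t • A)))
      =O[𝓝 0] fun t => t ^ 3 := by
  have h := (NormedSpace.exp_hasFPowerSeriesAt_zero (𝕂 := ℝ) (𝔸 := Mat3))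
    |>.isBigO_sub_partialSum_pow 3
  have ht : Tendsto (fun t : ℝ => t • A) (𝓝 0) (𝓝 0) := by
    have : Continuous fun t : ℝ => t • A := by fun_prop
    simpa using this.tendsto 0
  have h2 := h.comp_tendsto ht
  have h3 : (fun t : ℝ => ‖t • A‖ ^ 3) =O[𝓝 0] fun t : ℝ => t ^ 3 := by
    refine IsBigO.of_bound (‖A‖ ^ 3) (Eventually.of_forall fun t => ?_)
    simp only [norm_smul, norm_pow, norm_mul, norm_norm]
    rw [mul_pow, mul_comm]
  refine (h2.trans h3).congr_left fun t => ?_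
  have e : (NormedSpace.expSeries ℝ Mat3).partialSum 3 (t • A) =
      1 + t • A + (1 / 2 : ℝ) • ((t • A) * (t • A)) := by
    simp only [FormalMultilinearSeries.partialSum, Finset.sum_range_succ, Finset.sum_range_zero,
      NormedSpace.expSeries_apply_eq, zero_add, pow_zero, pow_one, pow_two, Nat.factorial]
    norm_num
  simp only [Function.comp_apply, zero_add, sub_sub]
  exact congrArg (NormedSpace.exp (t • A) - ·) e

/-- The axial vector of the skew-symmetric part `(R - Rᵀ) / 2`. On rotations near the identity it
is a coordinate that differs from the logarithm by a term of third order. -/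
noncomputable def skewPart (R : Mat3) : E3 :=
  !₂[(R 2 1 - R 1 2) / 2, (R 0 2 - R 2 0) / 2, (R 1 0 - R 0 1) / 2]

theorem crossMatrix_skewPart (R : Mat3) : crossMatrix (skewPart R) = (1 / 2 : ℝ) • (R - Rᵀ) := by
  ext i j
  fin_cases i <;> fin_cases j <;> simp [crossMatrix, skewPart] <;> ring

theorem continuous_skewPart : Continuous skewPart := by
  unfold skewPart
  fun_prop

/-- A rotation near the identity is determined by its skew-symmetric part `A` up to third order:
its symmetric part `1 + T` satisfies `2 T + T² = A²`, by orthogonality. -/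
theorem orthogonal_expansion {R : α → Mat3} (h1 : Tendsto R l (𝓝 1))
    (hR : ∀ x, (R x)ᵀ * R x = 1) :
    (fun x => R x - 1 - crossMatrix (skewPart (R x)) - (1 / 2 : ℝ) •
      (crossMatrix (skewPart (R x)) * crossMatrix (skewPart (R x)))) =O[l]
      fun x => ‖skewPart (R x)‖ ^ 3 := by
  have hA : (fun x => crossMatrix (skewPart (R x))) =O[l] fun x => ‖skewPart (R x)‖ :=
    isBigO_crossMatrix ((isBigO_refl _ l).norm_right)
  have hT0 : Tendsto (fun x => (1 / 2 : ℝ) • (R x + (R x)ᵀ) - 1) l (𝓝 0) := by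
    have hc : Continuous fun X : Mat3 => (1 / 2 : ℝ) • (X + Xᵀ) - 1 := by fun_prop
    have := (hc.tendsto 1).comp h1
    have e : (1 / 2 : ℝ) • ((1 : Mat3) + (1 : Mat3)ᵀ) - 1 = 0 := by
      rw [Matrix.transpose_one]; module
    rwa [e] at this
  set A : α → Mat3 := fun x => crossMatrix (skewPart (R x)) with hAdef
  set T : α → Mat3 := fun x => (1 / 2 : ℝ) • (R x + (R x)ᵀ) - 1 with hT
  have hRT : ∀ x, R x = 1 + T x + A x := by
    intro x
    simp only [hT, hAdef, crossMatrix_skewPart]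
    module
  have heq : ∀ x, (2 : ℝ) • T x + T x * T x = A x * A x := by
    intro x
    have k1 := hR x
    have k2 : R x * (R x)ᵀ = 1 := mul_eq_one_comm.1 k1
    simp only [hT, hAdef, crossMatrix_skewPart]
    simp only [mul_add, add_mul, mul_sub, sub_mul, one_mul, mul_one, smul_mul_assoc, mul_smul_comm,
      smul_add, smul_sub, smul_smul, k1, k2]
    module
  have hTA : T =O[l] fun x => ‖skewPart (R x)‖ ^ 2 := by
    refine IsBigO.trans (IsBigO.of_bound 1 ?_)
      ((hA.mul hA).congr_right (g₂ := fun x => ‖skewPart (R x)‖ ^ 2) fun x => by ring)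
    have hb : ∀ᶠ x in l, ‖T x‖ < 1 := by
      have := hT0.norm
      rw [norm_zero] at this
      exact this.eventually_lt_const one_pos
    filter_upwards [hb] with x hx
    have e : (2 : ℝ) • T x = A x * A x - T x * T x := by rw [← heq x]; abel
    have n1 : ‖(2 : ℝ) • T x‖ ≤ ‖A x * A x‖ + ‖T x * T x‖ := by
      rw [e]; exact norm_sub_le _ _
    rw [norm_smul, Real.norm_ofNat] at n1
    have n2 := norm_mul_le (T x) (T x)
    nlinarith [norm_nonneg (T x)]
  have ha1 : (fun x => ‖skewPart (R x)‖) =O[l] fun _ => (1 : ℝ) := by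
    have := ((continuous_skewPart.tendsto 1).comp h1).norm
    exact this.isBigO_one ℝ
  have hTT : (fun x => (-(1 / 2) : ℝ) • (T x * T x)) =O[l] fun x => ‖skewPart (R x)‖ ^ 3 := by
    have := ((hTA.mul hTA).const_smul_left (-(1 / 2) : ℝ)).congr_right
      (g₂ := fun x => ‖skewPart (R x)‖ ^ 3 * ‖skewPart (R x)‖) fun x => by ring
    exact this.trans (((isBigO_refl (fun x => ‖skewPart (R x)‖ ^ 3) l).mul ha1).congr_right
      fun x => by ring)
  refine hTT.congr_left fun x => ?_
  change _ = R x - 1 - A x - (1 / 2 : ℝ) • (A x * A x)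
  rw [← heq x, hRT x]
  module

end Expansion

/-! ### The gap at the relative positions of the record configuration -/

/-- Relative position of two lines, the second of which is the image of the first under the
rotation `turn` by `2π/3`. -/
noncomputable def relMat₀ : Mat3 :=
  !![-1 / 11, √2 * √3 * √11 * ((3 + √5) / 44), √2 * √3 * ((11 - 3 * √5) / 44);
    √2 * √3 * √11 * ((3 - √5) / 44), 1 / 4, √11 * ((-6 - 3 * √5) / 44);
    √2 * √3 * ((-11 - 3 * √5) / 44), √11 * ((6 - 3 * √5) / 44), -7 / 44]

/-- Relative position of the lines with the indices `0` and `1`, exchanged by a half-turn. -/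
noncomputable def relMat₁ : Mat3 :=
  !![(1 - 3 * √5) / 22, √2 * √3 * √11 * ((-7 - √5) / 88), √2 * √3 * ((-23 + 3 * √5) / 88);
    √2 * √3 * √11 * ((-7 - √5) / 88), (-7 + 3 * √5) / 16, √11 * ((21 + 3 * √5) / 176);
    √2 * √3 * ((-23 + 3 * √5) / 88), √11 * ((21 + 3 * √5) / 176), (-107 - 9 * √5) / 176]

/-- Relative position of the lines with the indices `0` and `5`, exchanged by a half-turn. -/
noncomputable def relMat₂ : Mat3 :=
  !![(1 + 3 * √5) / 22, √2 * √3 * √11 * ((-7 + √5) / 88), √2 * √3 * ((23 + 3 * √5) / 88);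
    √2 * √3 * √11 * ((-7 + √5) / 88), (-7 - 3 * √5) / 16, √11 * ((-21 + 3 * √5) / 176);
    √2 * √3 * ((23 + 3 * √5) / 88), √11 * ((-21 + 3 * √5) / 176), (-107 + 9 * √5) / 176]

/-- Relative position of the lines with the indices `0` and `3`, exchanged by a half-turn. -/
noncomputable def relMat₃ : Mat3 :=
  !![-10 / 11, √2 * √3 * √11 * (1 / 44), √2 * √3 * (3 * √5 / 44);
    √2 * √3 * √11 * (1 / 44), -5 / 8, √11 * (9 * √5 / 88);
    √2 * √3 * (3 * √5 / 44), √11 * (9 * √5 / 88), 47 / 88]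

/-- Coordinates in which the first and second order terms of the gaps at the relative positions of
the record configuration have coefficients in `ℚ(√5)`. -/
noncomputable def scaledVec (x y z : ℝ) : E3 := !₂[√11 * x, √2 * √3 * y, √2 * √3 * √11 * z]

theorem relLin_relMat₀_skew (x y z x' y' z' : ℝ) :
    relLin relMat₀ (crossMatrix (scaledVec x y z)) (crossMatrix (scaledVec x' y' z')) 1 2 +
      relLin relMat₀ (crossMatrix (scaledVec x y z)) (crossMatrix (scaledVec x' y' z')) 2 1 =
    √11 * ((-9) / 22 * x + (9 + 3 * √5) / 22 * y + (-33 + 9 * √5) / 22 * z + (-9) / 22 * x' + (9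
    - 3 * √5) / 22 * y' + (33 + 9 * √5) / 22 * z') := by
  have h2 : √2 ^ 2 = 2 := Real.sq_sqrt (by norm_num)
  have h3 : √3 ^ 2 = 3 := Real.sq_sqrt (by norm_num)
  have h5 : √5 ^ 2 = 5 := Real.sq_sqrt (by norm_num)
  have h11 : √11 ^ 2 = 11 := Real.sq_sqrt (by norm_num)
  simp [relLin, relMat₀, crossMatrix, scaledVec]
  grind

theorem relLin_relMat₀_diag (x y z x' y' z' : ℝ) :
    relLin relMat₀ (crossMatrix (scaledVec x y z)) (crossMatrix (scaledVec x' y' z')) 1 1 =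
    (6 - 3 * √5) / 4 * x + (-9 - 3 * √5) / 2 * z + (-6 - 3 * √5) / 4 * x' + (-9 + 3 * √5) / 2 *
    z' := by
  have h2 : √2 ^ 2 = 2 := Real.sq_sqrt (by norm_num)
  have h3 : √3 ^ 2 = 3 := Real.sq_sqrt (by norm_num)
  have h5 : √5 ^ 2 = 5 := Real.sq_sqrt (by norm_num)
  have h11 : √11 ^ 2 = 11 := Real.sq_sqrt (by norm_num)
  simp [relLin, relMat₀, crossMatrix, scaledVec]
  grind

theorem relQuad_relMat₀_skew (x y z x' y' z' : ℝ) :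
    relQuad relMat₀ (crossMatrix (scaledVec x y z)) (crossMatrix (scaledVec x' y' z')) 1 2 +
      relQuad relMat₀ (crossMatrix (scaledVec x y z)) (crossMatrix (scaledVec x' y' z')) 2 1 =
    √11 * ((3 * √5) / 4 * x * x + (33 - 9 * √5) / 44 * x * y + (9 + 3 * √5) / 4 * x * z + (3 *
    √5) / 2 * x * x' + (-33 - 9 * √5) / 22 * x * y' + (9 - 3 * √5) / 2 * x * z' + (-18 + 9 * √5)
    / 44 * y * y + (3) / 11 * y * z + (33 - 9 * √5) / 22 * y * x' + (6) / 11 * y * z' + (18 + 9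
    * √5) / 4 * z * z + (9 + 3 * √5) / 2 * z * x' + (6) / 11 * z * y' + (3 * √5) / 4 * x' * x' +
    (-33 - 9 * √5) / 44 * x' * y' + (9 - 3 * √5) / 4 * x' * z' + (18 + 9 * √5) / 44 * y' * y' +
    (3) / 11 * y' * z' + (-18 + 9 * √5) / 4 * z' * z') := by
  have h2 : √2 ^ 2 = 2 := Real.sq_sqrt (by norm_num)
  have h3 : √3 ^ 2 = 3 := Real.sq_sqrt (by norm_num)
  have h5 : √5 ^ 2 = 5 := Real.sq_sqrt (by norm_num)
  have h11 : √11 ^ 2 = 11 := Real.sq_sqrt (by norm_num)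
  simp [relQuad, relMat₀, crossMatrix, scaledVec]
  grind

theorem relQuad_relMat₀_diag (x y z x' y' z' : ℝ) :
    relQuad relMat₀ (crossMatrix (scaledVec x y z)) (crossMatrix (scaledVec x' y' z')) 1 1 =
    (-11) / 8 * x * x + (9 + 3 * √5) / 4 * x * y + (-7) / 4 * x * x' + (33 + 9 * √5) / 2 * x *
    z' + (18 - 9 * √5) / 4 * y * z + (-33) / 4 * z * z + (-33 + 9 * √5) / 2 * z * x' + (-6) * z
    * z' + (-11) / 8 * x' * x' + (9 - 3 * √5) / 4 * x' * y' + (-18 - 9 * √5) / 4 * y' * z' +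
    (-33) / 4 * z' * z' := by
  have h2 : √2 ^ 2 = 2 := Real.sq_sqrt (by norm_num)
  have h3 : √3 ^ 2 = 3 := Real.sq_sqrt (by norm_num)
  have h5 : √5 ^ 2 = 5 := Real.sq_sqrt (by norm_num)
  have h11 : √11 ^ 2 = 11 := Real.sq_sqrt (by norm_num)
  simp [relQuad, relMat₀, crossMatrix, scaledVec]
  grind

theorem gapLin_relMat₀ (x y z x' y' z' : ℝ) :
    gapLin relMat₀ (scaledVec x y z) (scaledVec x' y' z') =
    (9 + 9 * √5) / 11 * x + (-45 - 27 * √5) / 22 * y + (-189 + 81 * √5) / 22 * z + (-9 + 9 * √5)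
    / 11 * x' + (45 - 27 * √5) / 22 * y' + (-189 - 81 * √5) / 22 * z' := by
  have h5 : √5 ^ 2 = 5 := Real.sq_sqrt (by norm_num)
  have h11 : √11 ^ 2 = 11 := Real.sq_sqrt (by norm_num)
  rw [gapLin, relLin_relMat₀_skew, relLin_relMat₀_diag]
  simp only [relMat₀, Matrix.of_apply, Matrix.cons_val]
  linear_combination
      ((-9/242) * √5 ^ 2 * y + 9/242 * √5 ^ 2 * y' + (-27/242) * √5 ^ 2 * z + (-27/242) * √5 ^ 2
      * z' + 27/242 * √5 * x + 27/242 * √5 * x' + (-27/242) * √5 * y + (-27/242) * √5 * y' +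
      9/22 * √5 * z + (-9/22) * √5 * z') * h11 +
    ((-9/22) * y + 9/22 * y' + (-27/22) * z + (-27/22) * z') * h5

theorem gapQuad_relMat₀ (x y z x' y' z' : ℝ) :
    gapQuad relMat₀ (scaledVec x y z) (scaledVec x' y' z') =
    (-51 - 27 * √5) / 11 * x * x + (27 - 135 * √5) / 44 * x * y + (-9 - 351 * √5) / 44 * x * z +
    (-204) / 11 * x * x' + (27 + 63 * √5) / 11 * x * y' + (-99 - 27 * √5) / 11 * x * z' + (-9 +
    108 * √5) / 44 * y * y + (-108 - 63 * √5) / 22 * y * z + (27 - 63 * √5) / 11 * y * x' + (18)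
    / 11 * y * y' + (216 + 72 * √5) / 11 * y * z' + (1323 - 540 * √5) / 44 * z * z + (99 - 27 *
    √5) / 11 * z * x' + (-216 + 72 * √5) / 11 * z * y' + (-162) / 11 * z * z' + (-51 + 27 * √5)
    / 11 * x' * x' + (27 + 135 * √5) / 44 * x' * y' + (9 - 351 * √5) / 44 * x' * z' + (-9 - 108
    * √5) / 44 * y' * y' + (108 - 63 * √5) / 22 * y' * z' + (1323 + 540 * √5) / 44 * z' * z' := by
  have h5 : √5 ^ 2 = 5 := Real.sq_sqrt (by norm_num)
  have h11 : √11 ^ 2 = 11 := Real.sq_sqrt (by norm_num)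
  rw [gapQuad, relLin_relMat₀_skew, relLin_relMat₀_diag, relQuad_relMat₀_skew, relQuad_relMat₀_diag]
  simp only [relMat₀, Matrix.of_apply, Matrix.cons_val]
  linear_combination
      ((-9/44) * √5 ^ 2 * x ^ 2 + (-9/22) * √5 ^ 2 * x * x' + 27/484 * √5 ^ 2 * x * y + 27/242 *
      √5 ^ 2 * x * y' + (-9/44) * √5 ^ 2 * x * z + 9/22 * √5 ^ 2 * x * z' + (-9/44) * √5 ^ 2 *
      x' ^ 2 + 27/242 * √5 ^ 2 * x' * y + 27/484 * √5 ^ 2 * x' * y' + (-9/22) * √5 ^ 2 * x' * z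
      + 9/44 * √5 ^ 2 * x' * z' + (-9/242) * √5 ^ 2 * y ^ 2 + (-9/242) * √5 ^ 2 * y * y' +
      27/242 * √5 ^ 2 * y * z + 27/242 * √5 ^ 2 * y * z' + (-9/242) * √5 ^ 2 * y' ^ 2 +
      (-27/242) * √5 ^ 2 * y' * z + (-27/242) * √5 ^ 2 * y' * z' + (-54/121) * √5 ^ 2 * z ^ 2 +
      81/242 * √5 ^ 2 * z * z' + (-54/121) * √5 ^ 2 * z' ^ 2 + (-153/484) * √5 * x * y + 63/121
      * √5 * x * y' + (-459/484) * √5 * x * z + (-189/121) * √5 * x * z' + (-63/121) * √5 * x' *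
      y + 153/484 * √5 * x' * y' + (-189/121) * √5 * x' * z + (-459/484) * √5 * x' * z' + 27/121
      * √5 * y ^ 2 + (-18/121) * √5 * y * z + 72/121 * √5 * y * z' + (-27/121) * √5 * y' ^ 2 +
      72/121 * √5 * y' * z + (-18/121) * √5 * y' * z' + (-27/11) * √5 * z ^ 2 + 27/11 * √5 * z'
      ^ 2 + 81/484 * x ^ 2 + 81/242 * x * x' + (-81/242) * x * y + (-81/242) * x * y' + 27/22 *
      x * z + (-27/22) * x * z' + 81/484 * x' ^ 2 + (-81/242) * x' * y + (-81/242) * x' * y' +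
      27/22 * x' * z + (-27/22) * x' * z' + 81/484 * y ^ 2 + 81/242 * y * y' + (-27/22) * y * z
      + 27/22 * y * z' + 81/484 * y' ^ 2 + (-27/22) * y' * z + 27/22 * y' * z' + 9/4 * z ^ 2 +
      (-9/2) * z * z' + 9/4 * z' ^ 2) * h11 +
    ((-18/11) * x ^ 2 + (-36/11) * x * x' + 27/44 * x * y + 27/22 * x * y' + 9/44 * x * z +
      45/22 * x * z' + (-18/11) * x' ^ 2 + 27/22 * x' * y + 27/44 * x' * y' + (-45/22) * x' * z
      + (-9/44) * x' * z' + (-9/22) * y ^ 2 + (-9/22) * y * y' + 27/22 * y * z + 27/22 * y * z'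
      + (-9/22) * y' ^ 2 + (-27/22) * y' * z + (-27/22) * y' * z' + (-27/11) * z ^ 2 + (-27/22)
      * z * z' + (-27/11) * z' ^ 2) * h5

theorem relLin_relMat₁_skew (x y z x' y' z' : ℝ) :
    relLin relMat₁ (crossMatrix (scaledVec x y z)) (crossMatrix (scaledVec x' y' z')) 1 2 +
      relLin relMat₁ (crossMatrix (scaledVec x y z)) (crossMatrix (scaledVec x' y' z')) 2 1 =
    √11 * ((-15 - 21 * √5) / 88 * x + (-21 - 3 * √5) / 44 * y + (69 - 9 * √5) / 44 * z + (-15 -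
    21 * √5) / 88 * x' + (-21 - 3 * √5) / 44 * y' + (69 - 9 * √5) / 44 * z') := by
  have h2 : √2 ^ 2 = 2 := Real.sq_sqrt (by norm_num)
  have h3 : √3 ^ 2 = 3 := Real.sq_sqrt (by norm_num)
  have h5 : √5 ^ 2 = 5 := Real.sq_sqrt (by norm_num)
  have h11 : √11 ^ 2 = 11 := Real.sq_sqrt (by norm_num)
  simp [relLin, relMat₁, crossMatrix, scaledVec]
  grind

theorem relLin_relMat₁_diag (x y z x' y' z' : ℝ) :
    relLin relMat₁ (crossMatrix (scaledVec x y z)) (crossMatrix (scaledVec x' y' z')) 1 1 =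
    (21 + 3 * √5) / 16 * x + (21 + 3 * √5) / 4 * z + (21 + 3 * √5) / 16 * x' + (21 + 3 * √5) / 4
    * z' := by
  have h2 : √2 ^ 2 = 2 := Real.sq_sqrt (by norm_num)
  have h3 : √3 ^ 2 = 3 := Real.sq_sqrt (by norm_num)
  have h5 : √5 ^ 2 = 5 := Real.sq_sqrt (by norm_num)
  have h11 : √11 ^ 2 = 11 := Real.sq_sqrt (by norm_num)
  simp [relLin, relMat₁, crossMatrix, scaledVec]
  grind

theorem relQuad_relMat₁_skew (x y z x' y' z' : ℝ) :
    relQuad relMat₁ (crossMatrix (scaledVec x y z)) (crossMatrix (scaledVec x' y' z')) 1 2 +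
      relQuad relMat₁ (crossMatrix (scaledVec x y z)) (crossMatrix (scaledVec x' y' z')) 2 1 =
    √11 * ((-21 - 3 * √5) / 16 * x * x + (-69 + 9 * √5) / 88 * x * y + (-21 - 3 * √5) / 8 * x *
    z + (-21 - 3 * √5) / 8 * x * x' + (-69 + 9 * √5) / 44 * x * y' + (-21 - 3 * √5) / 4 * x * z'
    + (-63 - 9 * √5) / 176 * y * y + (-69 + 9 * √5) / 22 * y * z + (-69 + 9 * √5) / 44 * y * x'
    + (-3 + 9 * √5) / 11 * y * z' + (-63 - 9 * √5) / 16 * z * z + (-21 - 3 * √5) / 4 * z * x' +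
    (-3 + 9 * √5) / 11 * z * y' + (-21 - 3 * √5) / 16 * x' * x' + (-69 + 9 * √5) / 88 * x' * y'
    + (-21 - 3 * √5) / 8 * x' * z' + (-63 - 9 * √5) / 176 * y' * y' + (-69 + 9 * √5) / 22 * y' *
    z' + (-63 - 9 * √5) / 16 * z' * z') := by
  have h2 : √2 ^ 2 = 2 := Real.sq_sqrt (by norm_num)
  have h3 : √3 ^ 2 = 3 := Real.sq_sqrt (by norm_num)
  have h5 : √5 ^ 2 = 5 := Real.sq_sqrt (by norm_num)
  have h11 : √11 ^ 2 = 11 := Real.sq_sqrt (by norm_num)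
  simp [relQuad, relMat₁, crossMatrix, scaledVec]
  grind

theorem relQuad_relMat₁_diag (x y z x' y' z' : ℝ) :
    relQuad relMat₁ (crossMatrix (scaledVec x y z)) (crossMatrix (scaledVec x' y' z')) 1 1 =
    (77 - 33 * √5) / 32 * x * x + (-21 - 3 * √5) / 8 * x * y + (-107 - 9 * √5) / 16 * x * x' +
    (69 - 9 * √5) / 4 * x * z' + (63 + 9 * √5) / 16 * y * z + (231 - 99 * √5) / 16 * z * z + (69
    - 9 * √5) / 4 * z * x' + (3 - 9 * √5) * z * z' + (77 - 33 * √5) / 32 * x' * x' + (-21 - 3 *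
    √5) / 8 * x' * y' + (63 + 9 * √5) / 16 * y' * z' + (231 - 99 * √5) / 16 * z' * z' := by
  have h2 : √2 ^ 2 = 2 := Real.sq_sqrt (by norm_num)
  have h3 : √3 ^ 2 = 3 := Real.sq_sqrt (by norm_num)
  have h5 : √5 ^ 2 = 5 := Real.sq_sqrt (by norm_num)
  have h11 : √11 ^ 2 = 11 := Real.sq_sqrt (by norm_num)
  simp [relQuad, relMat₁, crossMatrix, scaledVec]
  grind

theorem gapLin_relMat₁ (x y z x' y' z' : ℝ) :
    gapLin relMat₁ (scaledVec x y z) (scaledVec x' y' z') =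
    (-117 - 45 * √5) / 44 * x + (-243 - 63 * √5) / 88 * y + (351 + 135 * √5) / 88 * z + (-117 -
    45 * √5) / 44 * x' + (-243 - 63 * √5) / 88 * y' + (351 + 135 * √5) / 88 * z' := by
  have h5 : √5 ^ 2 = 5 := Real.sq_sqrt (by norm_num)
  have h11 : √11 ^ 2 = 11 := Real.sq_sqrt (by norm_num)
  rw [gapLin, relLin_relMat₁_skew, relLin_relMat₁_diag]
  simp only [relMat₁, Matrix.of_apply, Matrix.cons_val]
  linear_combination
      ((-63/3872) * √5 ^ 2 * x + (-63/3872) * √5 ^ 2 * x' + (-9/1936) * √5 ^ 2 * y + (-9/1936) *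
      √5 ^ 2 * y' + (-27/1936) * √5 ^ 2 * z + (-27/1936) * √5 ^ 2 * z' + (-243/1936) * √5 * x +
      (-243/1936) * √5 * x' + (-63/968) * √5 * y + (-63/968) * √5 * y' + 9/968 * √5 * z + 9/968
      * √5 * z' + (-315/3872) * x + (-315/3872) * x' + (-441/1936) * y + (-441/1936) * y' +
      1449/1936 * z + 1449/1936 * z') * h11 +
    ((-9/88) * x + (-9/88) * x' + (-9/176) * y + (-9/176) * y' + 27/176 * z + 27/176 * z') * h5

theorem gapQuad_relMat₁ (x y z x' y' z' : ℝ) :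
    gapQuad relMat₁ (scaledVec x y z) (scaledVec x' y' z') =
    (-285 + 63 * √5) / 44 * x * x + (279 + 351 * √5) / 176 * x * y + (153 - 1251 * √5) / 176 * x
    * z + (12 - 36 * √5) / 11 * x * x' + (-171 + 117 * √5) / 44 * x * y' + (-1557 - 81 * √5) /
    44 * x * z' + (243 + 63 * √5) / 352 * y * y + (-5715 + 117 * √5) / 176 * y * z + (-171 + 117
    * √5) / 44 * y * x' + (243 + 63 * √5) / 44 * y * y' + (-585 + 171 * √5) / 44 * y * z' +
    (4671 + 2619 * √5) / 352 * z * z + (-1557 - 81 * √5) / 44 * z * x' + (-585 + 171 * √5) / 44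
    * z * y' + (4563 + 567 * √5) / 44 * z * z' + (-285 + 63 * √5) / 44 * x' * x' + (279 + 351 *
    √5) / 176 * x' * y' + (153 - 1251 * √5) / 176 * x' * z' + (243 + 63 * √5) / 352 * y' * y' +
    (-5715 + 117 * √5) / 176 * y' * z' + (4671 + 2619 * √5) / 352 * z' * z' := by
  have h5 : √5 ^ 2 = 5 := Real.sq_sqrt (by norm_num)
  have h11 : √11 ^ 2 = 11 := Real.sq_sqrt (by norm_num)
  rw [gapQuad, relLin_relMat₁_skew, relLin_relMat₁_diag, relQuad_relMat₁_skew, relQuad_relMat₁_diag]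
  simp only [relMat₁, Matrix.of_apply, Matrix.cons_val]
  linear_combination
      (171/3872 * √5 ^ 2 * x ^ 2 + 171/1936 * √5 ^ 2 * x * x' + 153/3872 * √5 ^ 2 * x * y +
      45/968 * √5 ^ 2 * x * y' + 279/3872 * √5 ^ 2 * x * z + 45/968 * √5 ^ 2 * x * z' + 171/3872
      * √5 ^ 2 * x' ^ 2 + 45/968 * √5 ^ 2 * x' * y + 153/3872 * √5 ^ 2 * x' * y' + 45/968 * √5 ^
      2 * x' * z + 279/3872 * √5 ^ 2 * x' * z' + 9/7744 * √5 ^ 2 * y ^ 2 + 9/968 * √5 ^ 2 * y *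
      y' + 27/484 * √5 ^ 2 * y * z + 81/968 * √5 ^ 2 * y * z' + 9/7744 * √5 ^ 2 * y' ^ 2 +
      81/968 * √5 ^ 2 * y' * z + 27/484 * √5 ^ 2 * y' * z' + 27/7744 * √5 ^ 2 * z ^ 2 + 81/968 *
      √5 ^ 2 * z * z' + 27/7744 * √5 ^ 2 * z' ^ 2 + (-189/1936) * √5 * x ^ 2 + (-189/968) * √5 *
      x * x' + 477/1936 * √5 * x * y + 117/484 * √5 * x * y' + (-2007/1936) * √5 * x * z +
      (-675/484) * √5 * x * z' + (-189/1936) * √5 * x' ^ 2 + 117/484 * √5 * x' * y + 477/1936 *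
      √5 * x' * y' + (-675/484) * √5 * x' * z + (-2007/1936) * √5 * x' * z' + 63/3872 * √5 * y ^
      2 + 63/484 * √5 * y * y' + (-9/242) * √5 * y * z + 171/484 * √5 * y * z' + 63/3872 * √5 *
      y' ^ 2 + 171/484 * √5 * y' * z + (-9/242) * √5 * y' * z' + (-4563/3872) * √5 * z ^ 2 +
      (-621/484) * √5 * z * z' + (-4563/3872) * √5 * z' ^ 2 + (-2313/3872) * x ^ 2 +
      (-2313/1936) * x * x' + (-819/3872) * x * y + (-567/968) * x * y' + (-6921/3872) * x * z +
      (-2943/968) * x * z' + (-2313/3872) * x' ^ 2 + (-567/968) * x' * y + (-819/3872) * x' * y'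
      + (-2943/968) * x' * z + (-6921/3872) * x' * z' + 441/7744 * y ^ 2 + 441/968 * y * y' +
      (-1449/484) * y * z + (-1575/968) * y * z' + 441/7744 * y' ^ 2 + (-1575/968) * y' * z +
      (-1449/484) * y' * z' + 4491/7744 * z ^ 2 + 4761/968 * z * z' + 4491/7744 * z' ^ 2) * h11 +
    (9/88 * x ^ 2 + 9/11 * x * x' + 9/32 * x * y + 45/88 * x * y' + 387/352 * x * z + (-9/88) *
      x * z' + 9/88 * x' ^ 2 + 45/88 * x' * y + 9/32 * x' * y' + (-9/88) * x' * z + 387/352 * x'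
      * z' + 9/704 * y ^ 2 + 9/88 * y * y' + 27/32 * y * z + 81/88 * y * z' + 9/704 * y' ^ 2 +
      81/88 * y' * z + 27/32 * y' * z' + (-1323/704) * z ^ 2 + (-135/88) * z * z' + (-1323/704)
      * z' ^ 2) * h5

theorem relLin_relMat₂_skew (x y z x' y' z' : ℝ) :
    relLin relMat₂ (crossMatrix (scaledVec x y z)) (crossMatrix (scaledVec x' y' z')) 1 2 +
      relLin relMat₂ (crossMatrix (scaledVec x y z)) (crossMatrix (scaledVec x' y' z')) 2 1 =
    √11 * ((-15 + 21 * √5) / 88 * x + (-21 + 3 * √5) / 44 * y + (-69 - 9 * √5) / 44 * z + (-15 +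
    21 * √5) / 88 * x' + (-21 + 3 * √5) / 44 * y' + (-69 - 9 * √5) / 44 * z') := by
  have h2 : √2 ^ 2 = 2 := Real.sq_sqrt (by norm_num)
  have h3 : √3 ^ 2 = 3 := Real.sq_sqrt (by norm_num)
  have h5 : √5 ^ 2 = 5 := Real.sq_sqrt (by norm_num)
  have h11 : √11 ^ 2 = 11 := Real.sq_sqrt (by norm_num)
  simp [relLin, relMat₂, crossMatrix, scaledVec]
  grind

theorem relLin_relMat₂_diag (x y z x' y' z' : ℝ) :
    relLin relMat₂ (crossMatrix (scaledVec x y z)) (crossMatrix (scaledVec x' y' z')) 1 1 =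
    (-21 + 3 * √5) / 16 * x + (21 - 3 * √5) / 4 * z + (-21 + 3 * √5) / 16 * x' + (21 - 3 * √5) /
    4 * z' := by
  have h2 : √2 ^ 2 = 2 := Real.sq_sqrt (by norm_num)
  have h3 : √3 ^ 2 = 3 := Real.sq_sqrt (by norm_num)
  have h5 : √5 ^ 2 = 5 := Real.sq_sqrt (by norm_num)
  have h11 : √11 ^ 2 = 11 := Real.sq_sqrt (by norm_num)
  simp [relLin, relMat₂, crossMatrix, scaledVec]
  grind

theorem relQuad_relMat₂_skew (x y z x' y' z' : ℝ) :
    relQuad relMat₂ (crossMatrix (scaledVec x y z)) (crossMatrix (scaledVec x' y' z')) 1 2 +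
      relQuad relMat₂ (crossMatrix (scaledVec x y z)) (crossMatrix (scaledVec x' y' z')) 2 1 =
    √11 * ((21 - 3 * √5) / 16 * x * x + (69 + 9 * √5) / 88 * x * y + (-21 + 3 * √5) / 8 * x * z
    + (21 - 3 * √5) / 8 * x * x' + (69 + 9 * √5) / 44 * x * y' + (-21 + 3 * √5) / 4 * x * z' +
    (63 - 9 * √5) / 176 * y * y + (-69 - 9 * √5) / 22 * y * z + (69 + 9 * √5) / 44 * y * x' +
    (-3 - 9 * √5) / 11 * y * z' + (63 - 9 * √5) / 16 * z * z + (-21 + 3 * √5) / 4 * z * x' + (-3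
    - 9 * √5) / 11 * z * y' + (21 - 3 * √5) / 16 * x' * x' + (69 + 9 * √5) / 88 * x' * y' + (-21
    + 3 * √5) / 8 * x' * z' + (63 - 9 * √5) / 176 * y' * y' + (-69 - 9 * √5) / 22 * y' * z' +
    (63 - 9 * √5) / 16 * z' * z') := by
  have h2 : √2 ^ 2 = 2 := Real.sq_sqrt (by norm_num)
  have h3 : √3 ^ 2 = 3 := Real.sq_sqrt (by norm_num)
  have h5 : √5 ^ 2 = 5 := Real.sq_sqrt (by norm_num)
  have h11 : √11 ^ 2 = 11 := Real.sq_sqrt (by norm_num)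
  simp [relQuad, relMat₂, crossMatrix, scaledVec]
  grind

theorem relQuad_relMat₂_diag (x y z x' y' z' : ℝ) :
    relQuad relMat₂ (crossMatrix (scaledVec x y z)) (crossMatrix (scaledVec x' y' z')) 1 1 =
    (77 + 33 * √5) / 32 * x * x + (-21 + 3 * √5) / 8 * x * y + (-107 + 9 * √5) / 16 * x * x' +
    (-69 - 9 * √5) / 4 * x * z' + (-63 + 9 * √5) / 16 * y * z + (231 + 99 * √5) / 16 * z * z +
    (-69 - 9 * √5) / 4 * z * x' + (3 + 9 * √5) * z * z' + (77 + 33 * √5) / 32 * x' * x' + (-21 +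
    3 * √5) / 8 * x' * y' + (-63 + 9 * √5) / 16 * y' * z' + (231 + 99 * √5) / 16 * z' * z' := by
  have h2 : √2 ^ 2 = 2 := Real.sq_sqrt (by norm_num)
  have h3 : √3 ^ 2 = 3 := Real.sq_sqrt (by norm_num)
  have h5 : √5 ^ 2 = 5 := Real.sq_sqrt (by norm_num)
  have h11 : √11 ^ 2 = 11 := Real.sq_sqrt (by norm_num)
  simp [relQuad, relMat₂, crossMatrix, scaledVec]
  grind

theorem gapLin_relMat₂ (x y z x' y' z' : ℝ) :
    gapLin relMat₂ (scaledVec x y z) (scaledVec x' y' z') =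
    (117 - 45 * √5) / 44 * x + (243 - 63 * √5) / 88 * y + (351 - 135 * √5) / 88 * z + (117 - 45
    * √5) / 44 * x' + (243 - 63 * √5) / 88 * y' + (351 - 135 * √5) / 88 * z' := by
  have h5 : √5 ^ 2 = 5 := Real.sq_sqrt (by norm_num)
  have h11 : √11 ^ 2 = 11 := Real.sq_sqrt (by norm_num)
  rw [gapLin, relLin_relMat₂_skew, relLin_relMat₂_diag]
  simp only [relMat₂, Matrix.of_apply, Matrix.cons_val]
  linear_combination
      (63/3872 * √5 ^ 2 * x + 63/3872 * √5 ^ 2 * x' + 9/1936 * √5 ^ 2 * y + 9/1936 * √5 ^ 2 * y'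
      + (-27/1936) * √5 ^ 2 * z + (-27/1936) * √5 ^ 2 * z' + (-243/1936) * √5 * x + (-243/1936)
      * √5 * x' + (-63/968) * √5 * y + (-63/968) * √5 * y' + (-9/968) * √5 * z + (-9/968) * √5 *
      z' + 315/3872 * x + 315/3872 * x' + 441/1936 * y + 441/1936 * y' + 1449/1936 * z +
      1449/1936 * z') * h11 +
    (9/88 * x + 9/88 * x' + 9/176 * y + 9/176 * y' + 27/176 * z + 27/176 * z') * h5

theorem gapQuad_relMat₂ (x y z x' y' z' : ℝ) :
    gapQuad relMat₂ (scaledVec x y z) (scaledVec x' y' z') =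
    (-285 - 63 * √5) / 44 * x * x + (279 - 351 * √5) / 176 * x * y + (-153 - 1251 * √5) / 176 *
    x * z + (12 + 36 * √5) / 11 * x * x' + (-171 - 117 * √5) / 44 * x * y' + (1557 - 81 * √5) /
    44 * x * z' + (243 - 63 * √5) / 352 * y * y + (5715 + 117 * √5) / 176 * y * z + (-171 - 117
    * √5) / 44 * y * x' + (243 - 63 * √5) / 44 * y * y' + (585 + 171 * √5) / 44 * y * z' + (4671
    - 2619 * √5) / 352 * z * z + (1557 - 81 * √5) / 44 * z * x' + (585 + 171 * √5) / 44 * z * y'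
    + (4563 - 567 * √5) / 44 * z * z' + (-285 - 63 * √5) / 44 * x' * x' + (279 - 351 * √5) / 176
    * x' * y' + (-153 - 1251 * √5) / 176 * x' * z' + (243 - 63 * √5) / 352 * y' * y' + (5715 +
    117 * √5) / 176 * y' * z' + (4671 - 2619 * √5) / 352 * z' * z' := by
  have h5 : √5 ^ 2 = 5 := Real.sq_sqrt (by norm_num)
  have h11 : √11 ^ 2 = 11 := Real.sq_sqrt (by norm_num)
  rw [gapQuad, relLin_relMat₂_skew, relLin_relMat₂_diag, relQuad_relMat₂_skew, relQuad_relMat₂_diag]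
  simp only [relMat₂, Matrix.of_apply, Matrix.cons_val]
  linear_combination
      (171/3872 * √5 ^ 2 * x ^ 2 + 171/1936 * √5 ^ 2 * x * x' + 153/3872 * √5 ^ 2 * x * y +
      45/968 * √5 ^ 2 * x * y' + (-279/3872) * √5 ^ 2 * x * z + (-45/968) * √5 ^ 2 * x * z' +
      171/3872 * √5 ^ 2 * x' ^ 2 + 45/968 * √5 ^ 2 * x' * y + 153/3872 * √5 ^ 2 * x' * y' +
      (-45/968) * √5 ^ 2 * x' * z + (-279/3872) * √5 ^ 2 * x' * z' + 9/7744 * √5 ^ 2 * y ^ 2 +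
      9/968 * √5 ^ 2 * y * y' + (-27/484) * √5 ^ 2 * y * z + (-81/968) * √5 ^ 2 * y * z' +
      9/7744 * √5 ^ 2 * y' ^ 2 + (-81/968) * √5 ^ 2 * y' * z + (-27/484) * √5 ^ 2 * y' * z' +
      27/7744 * √5 ^ 2 * z ^ 2 + 81/968 * √5 ^ 2 * z * z' + 27/7744 * √5 ^ 2 * z' ^ 2 + 189/1936
      * √5 * x ^ 2 + 189/968 * √5 * x * x' + (-477/1936) * √5 * x * y + (-117/484) * √5 * x * y'
      + (-2007/1936) * √5 * x * z + (-675/484) * √5 * x * z' + 189/1936 * √5 * x' ^ 2 +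
      (-117/484) * √5 * x' * y + (-477/1936) * √5 * x' * y' + (-675/484) * √5 * x' * z +
      (-2007/1936) * √5 * x' * z' + (-63/3872) * √5 * y ^ 2 + (-63/484) * √5 * y * y' + (-9/242)
      * √5 * y * z + 171/484 * √5 * y * z' + (-63/3872) * √5 * y' ^ 2 + 171/484 * √5 * y' * z +
      (-9/242) * √5 * y' * z' + 4563/3872 * √5 * z ^ 2 + 621/484 * √5 * z * z' + 4563/3872 * √5
      * z' ^ 2 + (-2313/3872) * x ^ 2 + (-2313/1936) * x * x' + (-819/3872) * x * y + (-567/968)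
      * x * y' + 6921/3872 * x * z + 2943/968 * x * z' + (-2313/3872) * x' ^ 2 + (-567/968) * x'
      * y + (-819/3872) * x' * y' + 2943/968 * x' * z + 6921/3872 * x' * z' + 441/7744 * y ^ 2 +
      441/968 * y * y' + 1449/484 * y * z + 1575/968 * y * z' + 441/7744 * y' ^ 2 + 1575/968 *
      y' * z + 1449/484 * y' * z' + 4491/7744 * z ^ 2 + 4761/968 * z * z' + 4491/7744 * z' ^ 2) *
      h11 +
    (9/88 * x ^ 2 + 9/11 * x * x' + 9/32 * x * y + 45/88 * x * y' + (-387/352) * x * z + 9/88 *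
      x * z' + 9/88 * x' ^ 2 + 45/88 * x' * y + 9/32 * x' * y' + 9/88 * x' * z + (-387/352) * x'
      * z' + 9/704 * y ^ 2 + 9/88 * y * y' + (-27/32) * y * z + (-81/88) * y * z' + 9/704 * y' ^
      2 + (-81/88) * y' * z + (-27/32) * y' * z' + (-1323/704) * z ^ 2 + (-135/88) * z * z' +
      (-1323/704) * z' ^ 2) * h5

/-! ### Contacts, multipliers and the Lagrangian -/

/-- The infinitesimal rotation with the coordinates `f`, `h`, `u`, chosen such that the linearized
gaps are `f + h'` at `relMat₀` and `u + u'` at `relMat₁`. -/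
noncomputable def bodyVec (f h u : ℝ) : E3 :=
  scaledVec ((3 + 2 * √5) / 54 * f + (-4 + √5) / 27 * h + (-15 + 5 * √5) / 27 * u)
    ((-33 - 11 * √5) / 432 * f + (11 - 11 * √5) / 432 * h + (-33 + 11 * √5) / 108 * u)
    ((-29 + 21 * √5) / 1296 * f + (-29 - 23 * √5) / 1296 * h + (5 - 3 * √5) / 324 * u)

theorem gapLin_relMat₀_bodyVec (f h u f' h' u' : ℝ) :
    gapLin relMat₀ (bodyVec f h u) (bodyVec f' h' u') =
    1 * f + 1 * h' := by
  have h5 : √5 ^ 2 = 5 := Real.sq_sqrt (by norm_num)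
  rw [bodyVec, bodyVec, gapLin_relMat₀]
  linear_combination
      (4/33 * f + 1/528 * f' + (-1/264) * h + 67/528 * h' + (-1/132) * u + 2/33 * u') * h5

theorem gapQuad_relMat₀_bodyVec (f h u f' h' u' : ℝ) :
    gapQuad relMat₀ (bodyVec f h u) (bodyVec f' h' u') =
    (451 - 198 * √5) / 3888 * f * f + (418 + 55 * √5) / 1944 * f * h + (715 - 99 * √5) / 972 * f
    * u + (-1111 - 363 * √5) / 3888 * f * f' + (1529 + 77 * √5) / 3888 * f * h' + (-121 + 66 *
    √5) / 486 * f * u' + (-627 + 44 * √5) / 3888 * h * h + (187 - 275 * √5) / 972 * h * u + (77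
    + 473 * √5) / 3888 * h * f' + (-2475 + 913 * √5) / 3888 * h * h' + (-1639 + 704 * √5) / 486
    * h * u' + (539 - 297 * √5) / 486 * u * u + (77 + 132 * √5) / 486 * u * f' + (-451 + 176 *
    √5) / 486 * u * h' + (-1771 + 759 * √5) / 243 * u * u' + (-781 - 495 * √5) / 7776 * f' * f'
    + (77 + 11 * √5) / 3888 * f' * h' + (319 - 165 * √5) / 972 * f' * u' + (-1089 + 1045 * √5) /
    7776 * h' * h' + (-2849 + 1243 * √5) / 972 * h' * u' + (-1463 + 660 * √5) / 243 * u' * u' := by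
  have h5 : √5 ^ 2 = 5 := Real.sq_sqrt (by norm_num)
  rw [bodyVec, bodyVec, gapQuad_relMat₀]
  linear_combination
      (34813/1368576 * f ^ 2 + (-2605/456192) * f ^ 2 * √5 + (-1795/42768) * f * f' + (-119/14256)
    * f * f' * √5 + 14507/684288 * f * h + 6595/684288 * f * h * √5 + 85/3168 * f * h' +
    17/42768 * f * h' * √5 + (-947/14256) * f * √5 * u + 97/1782 * f * √5 * u' + 8461/85536 * f
    * u + (-7475/42768) * f * u' + (-28883/1368576) * f' ^ 2 + (-685/456192) * f' ^ 2 * √5 +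
    (-1159/85536) * f' * h + 17/42768 * f' * h * √5 + (-4619/228096) * f' * h' + (-6125/684288)
    * f' * h' * √5 + (-305/7128) * f' * √5 * u + 377/28512 * f' * √5 * u' + (-4901/42768) * f' *
    u + 14/2673 * f' * u' + (-6773/456192) * h ^ 2 + 1645/1368576 * h ^ 2 * √5 + (-1751/42768) *
    h * h' + 391/42768 * h * h' * √5 + (-1205/85536) * h * √5 * u + 505/10692 * h * √5 * u' +
    4241/21384 * h * u + (-16429/42768) * h * u' + (-13351/1368576) * h' ^ 2 + 3055/456192 * h'
    ^ 2 * √5 + (-1069/21384) * h' * √5 * u + 433/5346 * h' * √5 * u' + 509/4752 * h' * u +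
    (-4195/9504) * h' * u' + (-2887/28512) * √5 * u ^ 2 + (-7/1782) * √5 * u * u' + 3821/28512 *
    √5 * u' ^ 2 + 41449/85536 * u ^ 2 + (-2723/5346) * u * u' + (-79667/85536) * u' ^ 2) * h5

theorem gapLin_relMat₁_bodyVec (f h u f' h' u' : ℝ) :
    gapLin relMat₁ (bodyVec f h u) (bodyVec f' h' u') =
    1 * u + 1 * u' := by
  have h5 : √5 ^ 2 = 5 := Real.sq_sqrt (by norm_num)
  rw [bodyVec, bodyVec, gapLin_relMat₁]
  linear_combination
      (1/192 * f + 1/192 * f' + (-3/64) * h + (-3/64) * h' + (-73/264) * u + (-73/264) * u') * h5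

theorem gapQuad_relMat₁_bodyVec (f h u f' h' u' : ℝ) :
    gapQuad relMat₁ (bodyVec f h u) (bodyVec f' h' u') =
    (-297 - 77 * √5) / 3888 * f * f + (209 - 143 * √5) / 1944 * f * h + (-429 + 407 * √5) / 1944
    * f * u + (-22 - 55 * √5) / 972 * f * f' + (-33 + 583 * √5) / 3888 * f * h' + (-1133 + 649 *
    √5) / 972 * f * u' + (-1133 + 495 * √5) / 3888 * h * h + (-4829 + 1925 * √5) / 1944 * h * u
    + (-33 + 583 * √5) / 3888 * h * f' + (1177 - 385 * √5) / 1944 * h * h' + (957 - 583 * √5) /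
    972 * h * u' + (-2541 + 1133 * √5) / 486 * u * u + (-1133 + 649 * √5) / 972 * u * f' + (957
    - 583 * √5) / 972 * u * h' + (176 - 88 * √5) / 243 * u * u' + (-297 - 77 * √5) / 3888 * f' *
    f' + (209 - 143 * √5) / 1944 * f' * h' + (-429 + 407 * √5) / 1944 * f' * u' + (-1133 + 495 *
    √5) / 3888 * h' * h' + (-4829 + 1925 * √5) / 1944 * h' * u' + (-2541 + 1133 * √5) / 486 * u'
    * u' := by
  have h5 : √5 ^ 2 = 5 := Real.sq_sqrt (by norm_num)
  rw [bodyVec, bodyVec, gapQuad_relMat₁]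
  linear_combination
      ((-187/248832) * f ^ 2 + (-11/4608) * f ^ 2 * √5 + (-385/10368) * f * f' + (-55/5184) * f *
    f' * √5 + 11/10368 * f * h + (-143/41472) * f * h * √5 + 605/31104 * f * h' + (-187/15552) *
    f * h' * √5 + (-7/2304) * f * √5 * u + (-73/2592) * f * √5 * u' + (-6367/62208) * f * u +
    (-301/2592) * f * u' + (-187/248832) * f' ^ 2 + (-11/4608) * f' ^ 2 * √5 + 605/31104 * f' *
    h + (-187/15552) * f' * h * √5 + 11/10368 * f' * h' + (-143/41472) * f' * h' * √5 +
    (-73/2592) * f' * √5 * u + (-7/2304) * f' * √5 * u' + (-301/2592) * f' * u + (-6367/62208) *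
    f' * u' + (-2849/82944) * h ^ 2 + 935/124416 * h ^ 2 * √5 + 55/384 * h * h' + 11/7776 * h *
    h' * √5 + 913/20736 * h * √5 * u + (-101/3888) * h * √5 * u' + (-5065/20736) * h * u +
    1205/3888 * h * u' + (-2849/82944) * h' ^ 2 + 935/124416 * h' ^ 2 * √5 + (-101/3888) * h' *
    √5 * u + 913/20736 * h' * √5 * u' + 1205/3888 * h' * u + (-5065/20736) * h' * u' +
    1277/12672 * √5 * u ^ 2 + 43/14256 * √5 * u * u' + 1277/12672 * √5 * u' ^ 2 +
    (-253981/342144) * u ^ 2 + 413/4752 * u * u' + (-253981/342144) * u' ^ 2) * h5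

theorem gapLin_relMat₂_bodyVec (f h u f' h' u' : ℝ) :
    gapLin relMat₂ (bodyVec f h u) (bodyVec f' h' u') =
    (-3 + √5) / 8 * f + (-3 + √5) / 8 * h + (-7 + 3 * √5) / 2 * u + (-3 + √5) / 8 * f' + (-3 +
    √5) / 8 * h' + (-7 + 3 * √5) / 2 * u' := by
  have h5 : √5 ^ 2 = 5 := Real.sq_sqrt (by norm_num)
  rw [bodyVec, bodyVec, gapLin_relMat₂]
  linear_combination
      ((-47/1056) * f + (-47/1056) * f' + 1/132 * h + 1/132 * h' + (-131/528) * u +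
      (-131/528) * u') * h5

theorem gapQuad_relMat₂_bodyVec (f h u f' h' u' : ℝ) :
    gapQuad relMat₂ (bodyVec f h u) (bodyVec f' h' u') =
    (-231 - 671 * √5) / 7776 * f * f + (2101 + 1133 * √5) / 7776 * f * h + (1023 - 286 * √5) /
    972 * f * u + (1177 + 11 * √5) / 1944 * f * f' + (11 - 264 * √5) / 1944 * f * h' + (847 -
    517 * √5) / 972 * f * u' + (-341 + 99 * √5) / 1944 * h * h + (-1969 + 715 * √5) / 1944 * h *
    u + (11 - 264 * √5) / 1944 * h * f' + (11 + 539 * √5) / 1944 * h * h' + (-539 + 330 * √5) /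
    486 * h * u' + (-231 + 55 * √5) / 486 * u * u + (847 - 517 * √5) / 972 * u * f' + (-539 +
    330 * √5) / 486 * u * h' + (-484 + 220 * √5) / 243 * u * u' + (-231 - 671 * √5) / 7776 * f'
    * f' + (2101 + 1133 * √5) / 7776 * f' * h' + (1023 - 286 * √5) / 972 * f' * u' + (-341 + 99
    * √5) / 1944 * h' * h' + (-1969 + 715 * √5) / 1944 * h' * u' + (-231 + 55 * √5) / 486 * u' *
    u' := by
  have h5 : √5 ^ 2 = 5 := Real.sq_sqrt (by norm_num)
  rw [bodyVec, bodyVec, gapQuad_relMat₂]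
  linear_combination
      ((-76909/5474304) * f ^ 2 + (-1357/202752) * f ^ 2 * √5 + 8021/76032 * f * f' + (-17/76032) *
    f * f' * √5 + 53419/2737152 * f * h + 3935/912384 * f * h * √5 + (-8969/684288) * f * h' +
    8581/684288 * f * h' * √5 + (-817/25344) * f * √5 * u + 157/4752 * f * √5 * u' +
    57073/684288 * f * u + 521/7128 * f * u' + (-76909/5474304) * f' ^ 2 + (-1357/202752) * f' ^
    2 * √5 + (-8969/684288) * f' * h + 8581/684288 * f' * h * √5 + 53419/2737152 * f' * h' +
    3935/912384 * f' * h' * √5 + 157/4752 * f' * √5 * u + (-817/25344) * f' * √5 * u' + 521/7128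
    * f' * u + 57073/684288 * f' * u' + (-14209/5474304) * h ^ 2 + 13301/5474304 * h ^ 2 * √5 +
    (-44147/684288) * h * h' + 7151/684288 * h * h' * √5 + 1249/228096 * h * √5 * u + 145/5346 *
    h * √5 * u' + (-27649/684288) * h * u + (-12439/42768) * h * u' + (-14209/5474304) * h' ^ 2
    + 13301/5474304 * h' ^ 2 * √5 + 145/5346 * h' * √5 * u + 1249/228096 * h' * √5 * u' +
    (-12439/42768) * h' * u + (-27649/684288) * h' * u' + (-41/528) * √5 * u ^ 2 + (-1/198) * √5
    * u * u' + (-41/528) * √5 * u' ^ 2 + 45601/171072 * u ^ 2 + (-1165/7128) * u * u' +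
    45601/171072 * u' ^ 2) * h5

/-- The relative positions of the pairs of lines of the record configuration, one for each of the
four orbits of its symmetry group on pairs. -/
noncomputable def relMat : Fin 4 → Mat3 := ![relMat₀, relMat₁, relMat₂, relMat₃]

/-- The partner of the line `i` in the `k`-th orbit of pairs. The orbits `k = 0, 1, 2` consist of
the twelve pairs at the minimal distance, and `k = 3` of the three remaining pairs. For `k = 0` each
pair occurs once as `(i, nbr 0 i)`, for `k ≠ 0` the map `nbr k` is an involution and each pair
occurs twice. -/
def nbr : Fin 4 → Fin 6 → Fin 6 :=
  ![![2, 5, 4, 1, 0, 3], ![1, 0, 3, 2, 5, 4], ![5, 2, 1, 4, 3, 0], ![3, 4, 5, 0, 1, 2]]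

/-- The Lagrange multipliers: positive weights for which the linearized gaps of the twelve
contacts add up to zero. -/
noncomputable def mult : Fin 3 → ℝ := ![(3 - √5) / 8, (7 - 3 * √5) / 4, 1 / 2]

/-- The linearized gap of the contact `(i, nbr k i)`. -/
noncomputable def edgeLin (a : Fin 6 → E3) (k : Fin 3) (i : Fin 6) : ℝ :=
  gapLin (relMat k.castSucc) (a i) (a (nbr k.castSucc i))

/-- The second order term of the gap of the contact `(i, nbr k i)`. -/
noncomputable def edgeQuad (a : Fin 6 → E3) (k : Fin 3) (i : Fin 6) : ℝ :=
  gapQuad (relMat k.castSucc) (a i) (a (nbr k.castSucc i))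

/-- The weighted sum of the second order terms of all contacts. -/
noncomputable def lagrangian (a : Fin 6 → E3) : ℝ := ∑ k, ∑ i, mult k * edgeQuad a k i

/-- The general solution, in the body coordinates, of the linear system `edgeLin a k i = 0`;
there are seven parameters, three of which belong to the global rotations. -/
noncomputable def kernelVec (f : Fin 6 → ℝ) (w : ℝ) : Fin 6 → E3 :=
  ![bodyVec (f 0) (-f 4) ((3 + √5) / 8 * (w - f 0 + f 1)),
    bodyVec (f 1) (-f 3) (-((3 + √5) / 8 * (w - f 0 + f 1))),
    bodyVec (f 2) (-f 0) ((3 + √5) / 8 * (w - f 2 + f 3)),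
    bodyVec (f 3) (-f 5) (-((3 + √5) / 8 * (w - f 2 + f 3))),
    bodyVec (f 4) (-f 2) ((3 + √5) / 8 * (w - f 4 + f 5)),
    bodyVec (f 5) (-f 1) (-((3 + √5) / 8 * (w - f 4 + f 5)))]

/-- The linear form whose cyclic copies make up the part of the Lagrangian living on the
isotypic component of the two-dimensional representation of the symmetry group. -/
noncomputable def irrForm (p q r p' q' r' : ℝ) : ℝ :=
  8 * p - 4 * q - 4 * r - (1 + 3 * √5) * p' + (3 * √5 - 1) * q' + 2 * r'

set_option maxHeartbeats 1000000 in
/-- On the kernel of the linearized contacts the Lagrangian is minus a sum of squares, found by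
decomposing the kernel under the symmetry group. -/
theorem lagrangian_kernelVec (f : Fin 6 → ℝ) (w : ℝ) : lagrangian (kernelVec f w) =
    -((1 - √5 / 3) * (4939 / 1728 * (w - (f 0 + f 2 + f 4) + (f 1 + f 3 + f 5)) ^ 2 +
      220 / 1728 * ((f 0 + f 2 + f 4) + (f 1 + f 3 + f 5)) ^ 2 +
      77 / 5184 * (irrForm (f 0) (f 2) (f 4) (f 1) (f 3) (f 5) ^ 2 +
        irrForm (f 2) (f 4) (f 0) (f 3) (f 5) (f 1) ^ 2 +
        irrForm (f 4) (f 0) (f 2) (f 5) (f 1) (f 3) ^ 2))) := by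
  have h5 : √5 ^ 2 = 5 := Real.sq_sqrt (by norm_num)
  simp only [lagrangian, edgeQuad, mult, relMat, nbr, kernelVec, Fin.sum_univ_three,
    Fin.sum_univ_six, Fin.castSucc_zero, Fin.castSucc_one, Fin.reduceCastSucc, Matrix.cons_val,
    gapQuad_relMat₀_bodyVec, gapQuad_relMat₁_bodyVec, gapQuad_relMat₂_bodyVec, irrForm]
  linear_combination
      (124157/124416 * f 0 ^ 2 + (-16643/62208) * f 0 ^ 2 * √5 + (-5225/41472) * f 0 ^ 2 * √5 ^ 2 +
    (-116941/62208) * f 0 * f 1 + 16643/31104 * f 0 * f 1 * √5 + 5225/20736 * f 0 * f 1 * √5 ^ 2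
    + 30899/62208 * f 0 * f 2 + (-913/2592) * f 0 * f 2 * √5 + (-253/20736) * f 0 * f 2 * √5 ^ 2
    + (-65945/62208) * f 0 * f 3 + 20075/31104 * f 0 * f 3 * √5 + 253/20736 * f 0 * f 3 * √5 ^ 2
    + 30899/62208 * f 0 * f 4 + (-913/2592) * f 0 * f 4 * √5 + (-253/20736) * f 0 * f 4 * √5 ^ 2
    + 4961/20736 * f 0 * f 5 + 1837/31104 * f 0 * f 5 * √5 + 253/20736 * f 0 * f 5 * √5 ^ 2 +
    5731/20736 * f 0 * √5 ^ 2 * w + 8437/10368 * f 0 * √5 * w + (-20075/6912) * f 0 * w +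
    157421/124416 * f 1 ^ 2 + (-22187/62208) * f 1 ^ 2 * √5 + (-5225/41472) * f 1 ^ 2 * √5 ^ 2 +
    4961/20736 * f 1 * f 2 + 1837/31104 * f 1 * f 2 * √5 + 253/20736 * f 1 * f 2 * √5 ^ 2 +
    14267/62208 * f 1 * f 3 + (-341/1296) * f 1 * f 3 * √5 + (-253/20736) * f 1 * f 3 * √5 ^ 2 +
    (-65945/62208) * f 1 * f 4 + 20075/31104 * f 1 * f 4 * √5 + 253/20736 * f 1 * f 4 * √5 ^ 2 +
    14267/62208 * f 1 * f 5 + (-341/1296) * f 1 * f 5 * √5 + (-253/20736) * f 1 * f 5 * √5 ^ 2 +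
    (-5731/20736) * f 1 * √5 ^ 2 * w + (-8437/10368) * f 1 * √5 * w + 20075/6912 * f 1 * w +
    124157/124416 * f 2 ^ 2 + (-16643/62208) * f 2 ^ 2 * √5 + (-5225/41472) * f 2 ^ 2 * √5 ^ 2 +
    (-116941/62208) * f 2 * f 3 + 16643/31104 * f 2 * f 3 * √5 + 5225/20736 * f 2 * f 3 * √5 ^ 2
    + 30899/62208 * f 2 * f 4 + (-913/2592) * f 2 * f 4 * √5 + (-253/20736) * f 2 * f 4 * √5 ^ 2
    + (-65945/62208) * f 2 * f 5 + 20075/31104 * f 2 * f 5 * √5 + 253/20736 * f 2 * f 5 * √5 ^ 2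
    + 5731/20736 * f 2 * √5 ^ 2 * w + 8437/10368 * f 2 * √5 * w + (-20075/6912) * f 2 * w +
    157421/124416 * f 3 ^ 2 + (-22187/62208) * f 3 ^ 2 * √5 + (-5225/41472) * f 3 ^ 2 * √5 ^ 2 +
    4961/20736 * f 3 * f 4 + 1837/31104 * f 3 * f 4 * √5 + 253/20736 * f 3 * f 4 * √5 ^ 2 +
    14267/62208 * f 3 * f 5 + (-341/1296) * f 3 * f 5 * √5 + (-253/20736) * f 3 * f 5 * √5 ^ 2 +
    (-5731/20736) * f 3 * √5 ^ 2 * w + (-8437/10368) * f 3 * √5 * w + 20075/6912 * f 3 * w +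
    124157/124416 * f 4 ^ 2 + (-16643/62208) * f 4 ^ 2 * √5 + (-5225/41472) * f 4 ^ 2 * √5 ^ 2 +
    (-116941/62208) * f 4 * f 5 + 16643/31104 * f 4 * f 5 * √5 + 5225/20736 * f 4 * f 5 * √5 ^ 2
    + 5731/20736 * f 4 * √5 ^ 2 * w + 8437/10368 * f 4 * √5 * w + (-20075/6912) * f 4 * w +
    157421/124416 * f 5 ^ 2 + (-22187/62208) * f 5 ^ 2 * √5 + (-5225/41472) * f 5 ^ 2 * √5 ^ 2 +
    (-5731/20736) * f 5 * √5 ^ 2 * w + (-8437/10368) * f 5 * √5 * w + 20075/6912 * f 5 * w +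
    (-5731/13824) * √5 ^ 2 * w ^ 2 + (-12067/20736) * √5 * w ^ 2 + 47201/13824 * w ^ 2) * h5

/-! ### The kernel of the linearized contacts -/

/-- The coordinate `f` of `bodyVec f h u`. -/
noncomputable def fCoord (a : E3) : ℝ :=
  (9 + 9 * √5) / 11 * (√11 * a 0 / 11) + (-45 - 27 * √5) / 22 * (√2 * √3 * a 1 / 6) + (-189 +
    81 * √5) / 22 * (√2 * √3 * √11 * a 2 / 66)

/-- The coordinate `h` of `bodyVec f h u`. -/
noncomputable def hCoord (a : E3) : ℝ :=
  (-9 + 9 * √5) / 11 * (√11 * a 0 / 11) + (45 - 27 * √5) / 22 * (√2 * √3 * a 1 / 6) + (-189 -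
    81 * √5) / 22 * (√2 * √3 * √11 * a 2 / 66)

/-- The coordinate `u` of `bodyVec f h u`. -/
noncomputable def uCoord (a : E3) : ℝ :=
  (-117 - 45 * √5) / 44 * (√11 * a 0 / 11) + (-243 - 63 * √5) / 88 * (√2 * √3 * a 1 / 6) +
    (351 + 135 * √5) / 88 * (√2 * √3 * √11 * a 2 / 66)

theorem bodyVec_coord (a : E3) : bodyVec (fCoord a) (hCoord a) (uCoord a) = a := by
  have h2 : √2 ^ 2 = 2 := Real.sq_sqrt (by norm_num)
  have h3 : √3 ^ 2 = 3 := Real.sq_sqrt (by norm_num)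
  have h5 : √5 ^ 2 = 5 := Real.sq_sqrt (by norm_num)
  have h11 : √11 ^ 2 = 11 := Real.sq_sqrt (by norm_num)
  ext i
  fin_cases i <;> simp [bodyVec, scaledVec, fCoord, hCoord, uCoord] <;> grind

theorem fCoord_bodyVec (f h u : ℝ) : fCoord (bodyVec f h u) = f := by
  have h2 : √2 ^ 2 = 2 := Real.sq_sqrt (by norm_num)
  have h3 : √3 ^ 2 = 3 := Real.sq_sqrt (by norm_num)
  have h5 : √5 ^ 2 = 5 := Real.sq_sqrt (by norm_num)
  have h11 : √11 ^ 2 = 11 := Real.sq_sqrt (by norm_num)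
  simp [bodyVec, scaledVec, fCoord]
  grind

theorem hCoord_bodyVec (f h u : ℝ) : hCoord (bodyVec f h u) = h := by
  have h2 : √2 ^ 2 = 2 := Real.sq_sqrt (by norm_num)
  have h3 : √3 ^ 2 = 3 := Real.sq_sqrt (by norm_num)
  have h5 : √5 ^ 2 = 5 := Real.sq_sqrt (by norm_num)
  have h11 : √11 ^ 2 = 11 := Real.sq_sqrt (by norm_num)
  simp [bodyVec, scaledVec, hCoord]
  grind

theorem uCoord_bodyVec (f h u : ℝ) : uCoord (bodyVec f h u) = u := by
  have h2 : √2 ^ 2 = 2 := Real.sq_sqrt (by norm_num)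
  have h3 : √3 ^ 2 = 3 := Real.sq_sqrt (by norm_num)
  have h5 : √5 ^ 2 = 5 := Real.sq_sqrt (by norm_num)
  have h11 : √11 ^ 2 = 11 := Real.sq_sqrt (by norm_num)
  simp [bodyVec, scaledVec, uCoord]
  grind

theorem bodyVec_zero : bodyVec 0 0 0 = 0 := by
  ext i
  fin_cases i <;> simp [bodyVec, scaledVec]

theorem sqrt_five_bounds : 2 < √5 ∧ √5 < 9 / 4 :=
  ⟨Real.lt_sqrt_of_sq_lt (by norm_num), by
    rw [Real.sqrt_lt' (by norm_num)]; norm_num⟩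

theorem mult_pos (k : Fin 3) : 0 < mult k := by
  have h := sqrt_five_bounds
  have h5 : √5 ^ 2 = 5 := Real.sq_sqrt (by norm_num)
  fin_cases k <;> simp [mult] <;> nlinarith

/-- The equilibrium condition: no infinitesimal motion increases all the twelve distances to first
order. -/
theorem sum_mult_edgeLin (a : Fin 6 → E3) : ∑ k, ∑ i, mult k * edgeLin a k i = 0 := by
  have h5 : √5 ^ 2 = 5 := Real.sq_sqrt (by norm_num)
  have e : ∀ i, a i = bodyVec (fCoord (a i)) (hCoord (a i)) (uCoord (a i)) := fun i =>
    (bodyVec_coord _).symm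
  have key : ∀ f h u : Fin 6 → ℝ,
      ∑ k, ∑ i, mult k * edgeLin (fun i => bodyVec (f i) (h i) (u i)) k i = 0 := by
    intro f h u
    simp only [edgeLin, mult, relMat, nbr, Fin.sum_univ_three, Fin.sum_univ_six,
      Fin.castSucc_zero, Fin.castSucc_one, Fin.reduceCastSucc, Matrix.cons_val,
      gapLin_relMat₀_bodyVec, gapLin_relMat₁_bodyVec, gapLin_relMat₂_bodyVec]
    ring
  rw [show a = fun i => bodyVec (fCoord (a i)) (hCoord (a i)) (uCoord (a i)) from funext e]
  exact key _ _ _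

theorem edgeLin_zero_bodyVec (f h u : Fin 6 → ℝ) (i : Fin 6) :
    edgeLin (fun i => bodyVec (f i) (h i) (u i)) 0 i = f i + h (nbr 0 i) := by
  refine (gapLin_relMat₀_bodyVec _ _ _ _ _ _).trans ?_
  simp

theorem edgeLin_one_bodyVec (f h u : Fin 6 → ℝ) (i : Fin 6) :
    edgeLin (fun i => bodyVec (f i) (h i) (u i)) 1 i = u i + u (nbr 1 i) := by
  refine (gapLin_relMat₁_bodyVec _ _ _ _ _ _).trans ?_
  simp

theorem edgeLin_two_bodyVec (f h u : Fin 6 → ℝ) (i : Fin 6) :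
    edgeLin (fun i => bodyVec (f i) (h i) (u i)) 2 i =
      -((3 - √5) / 8 * (f i + h i + f (nbr 2 i) + h (nbr 2 i)) +
        (7 - 3 * √5) / 2 * (u i + u (nbr 2 i))) := by
  refine (gapLin_relMat₂_bodyVec _ _ _ _ _ _).trans ?_
  simp
  ring

theorem kernelVec_eq (f : Fin 6 → ℝ) (w : ℝ) : kernelVec f w = fun i =>
    bodyVec (f i) ((![-f 4, -f 3, -f 0, -f 5, -f 2, -f 1] : Fin 6 → ℝ) i)
      ((![(3 + √5) / 8 * (w - f 0 + f 1), -((3 + √5) / 8 * (w - f 0 + f 1)),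
        (3 + √5) / 8 * (w - f 2 + f 3), -((3 + √5) / 8 * (w - f 2 + f 3)),
        (3 + √5) / 8 * (w - f 4 + f 5), -((3 + √5) / 8 * (w - f 4 + f 5))] : Fin 6 → ℝ) i) := by
  funext i
  fin_cases i <;> rfl

theorem edgeLin_kernelVec (f : Fin 6 → ℝ) (w : ℝ) (k : Fin 3) (i : Fin 6) :
    edgeLin (kernelVec f w) k i = 0 := by
  have h5 : √5 ^ 2 = 5 := Real.sq_sqrt (by norm_num)
  rw [kernelVec_eq]
  fin_cases k
  · refine (edgeLin_zero_bodyVec _ _ _ i).trans ?_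
    fin_cases i <;> simp [nbr]
  · refine (edgeLin_one_bodyVec _ _ _ i).trans ?_
    fin_cases i <;> simp [nbr]
  · refine (edgeLin_two_bodyVec _ _ _ i).trans ?_
    fin_cases i <;> simp [nbr] <;> grind

theorem exists_kernelVec_of_edgeLin {a : Fin 6 → E3} (hz : ∀ k i, edgeLin a k i = 0) :
    ∃ f w, a = kernelVec f w := by
  have h5 : √5 ^ 2 = 5 := Real.sq_sqrt (by norm_num)
  have key : ∀ f h u : Fin 6 → ℝ, (a = fun i => bodyVec (f i) (h i) (u i)) →
      ∃ w, a = kernelVec f w := by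
    rintro f h u rfl
    have z0 := fun i => (edgeLin_zero_bodyVec f h u i).symm.trans (hz 0 i)
    have z1 := fun i => (edgeLin_one_bodyVec f h u i).symm.trans (hz 1 i)
    have z2 := fun i => (edgeLin_two_bodyVec f h u i).symm.trans (hz 2 i)
    have a0 : f 0 + h 2 = 0 := z0 0
    have a1 : f 1 + h 5 = 0 := z0 1
    have a2 : f 2 + h 4 = 0 := z0 2
    have a3 : f 3 + h 1 = 0 := z0 3
    have a4 : f 4 + h 0 = 0 := z0 4
    have a5 : f 5 + h 3 = 0 := z0 5
    have b0 : u 0 + u 1 = 0 := z1 0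
    have b2 : u 2 + u 3 = 0 := z1 2
    have b4 : u 4 + u 5 = 0 := z1 4
    have c1 : -((3 - √5) / 8 * (f 1 + h 1 + f 2 + h 2) + (7 - 3 * √5) / 2 * (u 1 + u 2)) = 0 :=
      z2 1
    have c0 : -((3 - √5) / 8 * (f 0 + h 0 + f 5 + h 5) + (7 - 3 * √5) / 2 * (u 0 + u 5)) = 0 :=
      z2 0
    clear z0 z1 z2 hz
    refine ⟨(6 - 2 * √5) * u 0 + f 0 - f 1, ?_⟩
    have u0 : u 0 = (3 + √5) / 8 * ((6 - 2 * √5) * u 0 + f 0 - f 1 - f 0 + f 1) := by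
      linear_combination (u 0 / 4) * h5
    have h21 : h 2 = -f 0 := by linarith
    have h11 : h 1 = -f 3 := by linarith
    have h01 : h 0 = -f 4 := by linarith
    have h51 : h 5 = -f 1 := by linarith
    have u1 : u 1 = -u 0 := by linarith
    have u5 : u 5 = -u 4 := by linarith
    rw [h21, h11, u1] at c1
    rw [h01, h51, u5] at c0
    have u2 : u 2 = (3 + √5) / 8 * ((6 - 2 * √5) * u 0 + f 0 - f 1 - f 2 + f 3) := by grind
    have u4 : u 4 = (3 + √5) / 8 * ((6 - 2 * √5) * u 0 + f 0 - f 1 - f 4 + f 5) := by grind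
    rw [kernelVec, ← u0, ← u2, ← u4, ← eq_neg_of_add_eq_zero_right a0,
      ← eq_neg_of_add_eq_zero_right a1, ← eq_neg_of_add_eq_zero_right a2,
      ← eq_neg_of_add_eq_zero_right a3, ← eq_neg_of_add_eq_zero_right a4,
      ← eq_neg_of_add_eq_zero_right a5, ← eq_neg_of_add_eq_zero_right b0,
      ← eq_neg_of_add_eq_zero_right b2, ← eq_neg_of_add_eq_zero_right b4]
    funext i
    fin_cases i <;> rfl
  obtain ⟨w, hw⟩ := key (fun i => fCoord (a i)) (fun i => hCoord (a i)) (fun i => uCoord (a i))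
    (funext fun i => (bodyVec_coord _).symm)
  exact ⟨_, w, hw⟩

theorem lagrangian_nonpos {a : Fin 6 → E3} (ha : ∀ k i, edgeLin a k i = 0) : lagrangian a ≤ 0 := by
  obtain ⟨f, w, rfl⟩ := exists_kernelVec_of_edgeLin ha
  have h5 : 0 ≤ 1 - √5 / 3 := by linarith [sqrt_five_bounds.2]
  rw [lagrangian_kernelVec, neg_nonpos]
  positivity

/-- The Lagrangian is negative definite on the infinitesimal motions in the kernel that fix the line
with the index `0`. -/
theorem eq_zero_of_lagrangian_eq_zero {a : Fin 6 → E3} (ha : ∀ k i, edgeLin a k i = 0)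
    (h0 : a 0 = 0) (hq : lagrangian a = 0) : a = 0 := by
  obtain ⟨f, w, rfl⟩ := exists_kernelVec_of_edgeLin ha
  have h5 : 0 < 1 - √5 / 3 := by linarith [sqrt_five_bounds.2]
  have hs : √5 ^ 2 = 5 := Real.sq_sqrt (by norm_num)
  have hb : bodyVec (f 0) (-f 4) ((3 + √5) / 8 * (w - f 0 + f 1)) = 0 := h0
  have f0 : f 0 = 0 := by
    have := congrArg fCoord (hb.trans bodyVec_zero.symm)
    rwa [fCoord_bodyVec, fCoord_bodyVec] at this
  have f4 : f 4 = 0 := by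
    have := congrArg hCoord (hb.trans bodyVec_zero.symm)
    rwa [hCoord_bodyVec, hCoord_bodyVec, neg_eq_zero] at this
  have fw : (3 + √5) / 8 * (w - f 0 + f 1) = 0 := by
    have := congrArg uCoord (hb.trans bodyVec_zero.symm)
    rwa [uCoord_bodyVec, uCoord_bodyVec] at this
  have fw' : w - f 0 + f 1 = 0 := by
    rcases mul_eq_zero.1 fw with h | h
    · linarith [sqrt_five_bounds.1]
    · exact h
  rw [lagrangian_kernelVec, neg_eq_zero, mul_eq_zero, or_iff_right h5.ne'] at hq
  obtain ⟨e1, e2, e3, e4⟩ : w - (f 0 + f 2 + f 4) + (f 1 + f 3 + f 5) = 0 ∧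
      f 0 + f 2 + f 4 + (f 1 + f 3 + f 5) = 0 ∧
      irrForm (f 0) (f 2) (f 4) (f 1) (f 3) (f 5) = 0 ∧
      irrForm (f 2) (f 4) (f 0) (f 3) (f 5) (f 1) = 0 := by
    have q1 := sq_nonneg (w - (f 0 + f 2 + f 4) + (f 1 + f 3 + f 5))
    have q2 := sq_nonneg (f 0 + f 2 + f 4 + (f 1 + f 3 + f 5))
    have q3 := sq_nonneg (irrForm (f 0) (f 2) (f 4) (f 1) (f 3) (f 5))
    have q4 := sq_nonneg (irrForm (f 2) (f 4) (f 0) (f 3) (f 5) (f 1))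
    have q5 := sq_nonneg (irrForm (f 4) (f 0) (f 2) (f 5) (f 1) (f 3))
    exact ⟨sq_eq_zero_iff.1 (by linarith), sq_eq_zero_iff.1 (by linarith),
      sq_eq_zero_iff.1 (by linarith), sq_eq_zero_iff.1 (by linarith)⟩
  simp only [irrForm, f0, f4] at e3 e4
  rw [f0] at fw' e1 e2
  rw [f4] at e1 e2
  have f1 : f 1 = -2 * f 2 := by linarith
  have f5 : f 5 = f 2 - f 3 := by linarith
  rw [f1, f5] at e3 e4
  have f2 : f 2 = 0 := by grind
  have f3 : f 3 = 0 := by grind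
  have hw : w = 0 := by linarith
  have f1' : f 1 = 0 := by linarith
  have f5' : f 5 = 0 := by linarith
  funext i
  fin_cases i <;> simp [kernelVec, f0, f1', f2, f3, f4, f5', hw, bodyVec_zero]

/-! ### Lines, frames and distances -/

theorem transpose_mul_self (X : SO3) : X.1ᵀ * X.1 = 1 :=
  (Matrix.mem_orthogonalGroup_iff' (Fin 3) ℝ).1 ((Matrix.mem_specialOrthogonalGroup_iff).1 X.2).1

theorem mul_transpose_self (X : SO3) : X.1 * X.1ᵀ = 1 := mul_eq_one_comm.1 (transpose_mul_self X)

theorem det_eq_one (X : SO3) : X.1.det = 1 := ((Matrix.mem_specialOrthogonalGroup_iff).1 X.2).2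

theorem mem_SO3 {A : Mat3} (h : Aᵀ * A = 1) (hd : A.det = 1) :
    A ∈ Matrix.specialOrthogonalGroup (Fin 3) ℝ :=
  (Matrix.mem_specialOrthogonalGroup_iff).2 ⟨(Matrix.mem_orthogonalGroup_iff' (Fin 3) ℝ).2 h, hd⟩

theorem adjugate_eq_transpose (X : SO3) : X.1.adjugate = X.1ᵀ := by
  have h := Matrix.mul_adjugate X.1
  rw [det_eq_one, one_smul] at h
  calc X.1.adjugate = (X.1ᵀ * X.1) * X.1.adjugate := by rw [transpose_mul_self, one_mul]
    _ = X.1ᵀ := by rw [mul_assoc, h, mul_one]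

/-- The `j`-th column of a rotation matrix. -/
def col (j : Fin 3) (X : SO3) : E3 := WithLp.toLp 2 fun i => X.1 i j

theorem inner_col (X Y : SO3) (i j : Fin 3) : inner ℝ (col i X) (col j Y) = (X.1ᵀ * Y.1) i j := by
  simp [col, PiLp.inner_apply, Matrix.mul_apply, Fin.sum_univ_three, mul_comm]

theorem norm_col (X : SO3) (j : Fin 3) : ‖col j X‖ = 1 := by
  have h : ‖col j X‖ ^ 2 = 1 := by
    rw [← real_inner_self_eq_norm_sq, inner_col, transpose_mul_self, Matrix.one_apply_eq]
  exact (sq_eq_sq₀ (norm_nonneg _) zero_le_one).1 (by rw [h, one_pow])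

theorem rotateVec_col (R X : SO3) (j : Fin 3) : rotateVec R (col j X) = col j (R * X) := rfl

/-- The unit tangent vector `(x, ξ)` given by the first two columns of the frame
`X = (x, ξ, x × ξ)`. -/
def tangentOf (X : SO3) : UnitTangent :=
  ⟨(col 0 X, col 1 X), norm_col X 0, norm_col X 1, by
    rw [inner_col, transpose_mul_self]; rfl⟩

/-- The tangent line of a frame. Each line has exactly two frames. -/
def lineOf (X : SO3) : M := Quotient.mk lineSetoid (tangentOf X)

theorem rotateLine_lineOf (R X : SO3) : rotateLine R (lineOf X) = lineOf (R * X) := rfl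

theorem third_column (X : SO3) :
    X.1 0 2 = X.1 1 0 * X.1 2 1 - X.1 2 0 * X.1 1 1 ∧
    X.1 1 2 = X.1 2 0 * X.1 0 1 - X.1 0 0 * X.1 2 1 ∧
    X.1 2 2 = X.1 0 0 * X.1 1 1 - X.1 1 0 * X.1 0 1 := by
  have h := adjugate_eq_transpose X
  rw [Matrix.adjugate_fin_three] at h
  refine ⟨?_, ?_, ?_⟩
  · have := congrFun (congrFun h 2) 0
    simp at this
    linarith
  · have := congrFun (congrFun h 2) 1
    simp at this
    linarith
  · have := congrFun (congrFun h 2) 2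
    simp at this
    linarith

theorem mem_parallelLine_lineOf {ρ : ℝ} {X : SO3} {p : E3} :
    p ∈ parallelLine ρ (lineOf X) ↔ ∃ s : ℝ, ρ • col 0 X + s • col 1 X = p := Iff.rfl

/-- The squared distance of points of two lines as a sum of squares. The first square does not
depend on the points, and the two others vanish at the feet of the common perpendicular. -/
theorem sq_dist_points (X Y : SO3) (s t : ℝ) :
    dist (col 0 X + s • col 1 X) (col 0 Y + t • col 1 Y) ^ 2 * (1 - (X.1ᵀ * Y.1) 1 1 ^ 2) =
      ((X.1ᵀ * Y.1) 1 2 + (X.1ᵀ * Y.1) 2 1) ^ 2 +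
      ((X.1ᵀ * Y.1) 1 0 + t * (X.1ᵀ * Y.1) 1 1 - s -
        (X.1ᵀ * Y.1) 1 1 * (t + s * -(X.1ᵀ * Y.1) 1 1 - (X.1ᵀ * Y.1) 0 1)) ^ 2 +
      (1 - (X.1ᵀ * Y.1) 1 1 ^ 2) * (t + s * -(X.1ᵀ * Y.1) 1 1 - (X.1ᵀ * Y.1) 0 1) ^ 2 := by
  obtain ⟨x0, x1, x2⟩ := third_column X
  obtain ⟨y0, y1, y2⟩ := third_column Y
  have hX := transpose_mul_self X
  have hY := transpose_mul_self Y
  have a1 := congrFun (congrFun hX 0) 1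
  have a2 := congrFun (congrFun hX 1) 1
  have b1 := congrFun (congrFun hY 0) 1
  have b2 := congrFun (congrFun hY 1) 1
  rw [EuclideanSpace.dist_eq, Real.sq_sqrt (Finset.sum_nonneg fun _ _ => sq_nonneg _)]
  simp only [Matrix.mul_apply, Matrix.transpose_apply, Fin.sum_univ_three, Real.dist_eq, sq_abs,
    col, PiLp.add_apply, PiLp.smul_apply, smul_eq_mul, Matrix.one_apply_eq, ne_eq, zero_ne_one,
    not_false_eq_true, Matrix.one_apply_ne] at a1 a2 b1 b2 ⊢
  rw [x0, x1, x2, y0, y1, y2]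
  generalize X.1 0 0 = p0 at *
  generalize X.1 1 0 = p1 at *
  generalize X.1 2 0 = p2 at *
  generalize X.1 0 1 = q0 at *
  generalize X.1 1 1 = q1 at *
  generalize X.1 2 1 = q2 at *
  generalize Y.1 0 0 = u0 at *
  generalize Y.1 1 0 = u1 at *
  generalize Y.1 2 0 = u2 at *
  generalize Y.1 0 1 = v0 at *
  generalize Y.1 1 1 = v1 at *
  generalize Y.1 2 1 = v2 at *
  clear x0 x1 x2 y0 y1 y2 hX hY
  -- Gram's identity for the determinant of three vectors
  have gram : ∀ z0 z1 z2 : ℝ, (z0 ^ 2 + z1 ^ 2 + z2 ^ 2) *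
      (1 - (q0 * v0 + q1 * v1 + q2 * v2) ^ 2) =
      (z0 * (q1 * v2 - q2 * v1) + z1 * (q2 * v0 - q0 * v2) + z2 * (q0 * v1 - q1 * v0)) ^ 2 +
      (z0 * q0 + z1 * q1 + z2 * q2) ^ 2 + (z0 * v0 + z1 * v1 + z2 * v2) ^ 2 -
      2 * (q0 * v0 + q1 * v1 + q2 * v2) * (z0 * q0 + z1 * q1 + z2 * q2) *
        (z0 * v0 + z1 * v1 + z2 * v2) := by
    intro z0 z1 z2
    linear_combination (-(z0 ^ 2 + z1 ^ 2 + z2 ^ 2) * (v0 * v0 + v1 * v1 + v2 * v2) +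
      (z0 * v0 + z1 * v1 + z2 * v2) ^ 2) * a2 +
      (-(z0 ^ 2 + z1 ^ 2 + z2 ^ 2) + (z0 * q0 + z1 * q1 + z2 * q2) ^ 2) * b2
  rw [show (p0 + s * q0 - (u0 + t * v0)) ^ 2 + (p1 + s * q1 - (u1 + t * v1)) ^ 2 +
    (p2 + s * q2 - (u2 + t * v2)) ^ 2 = (u0 + t * v0 - (p0 + s * q0)) ^ 2 +
    (u1 + t * v1 - (p1 + s * q1)) ^ 2 + (u2 + t * v2 - (p2 + s * q2)) ^ 2 by ring, gram]
  have e1 : (u0 + t * v0 - (p0 + s * q0)) * q0 + (u1 + t * v1 - (p1 + s * q1)) * q1 +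
      (u2 + t * v2 - (p2 + s * q2)) * q2 =
      (q0 * u0 + q1 * u1 + q2 * u2) + t * (q0 * v0 + q1 * v1 + q2 * v2) - s := by
    linear_combination -a1 - s * a2
  have e2 : (u0 + t * v0 - (p0 + s * q0)) * v0 + (u1 + t * v1 - (p1 + s * q1)) * v1 +
      (u2 + t * v2 - (p2 + s * q2)) * v2 =
      t + s * -(q0 * v0 + q1 * v1 + q2 * v2) - (p0 * v0 + p1 * v1 + p2 * v2) := by
    linear_combination b1 + t * b2
  rw [e1, e2]
  ring

theorem setDist_nonneg (A B : Set E3) : 0 ≤ setDist A B :=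
  Real.sInf_nonneg (by rintro _ ⟨a, _, b, _, rfl⟩; exact dist_nonneg)

theorem lineDist_nonneg (u v : M) : 0 ≤ lineDist u v := setDist_nonneg _ _

theorem setDist_comm (A B : Set E3) : setDist A B = setDist B A := by
  rw [setDist, setDist, image2_swap]
  simp only [dist_comm]

theorem lineDist_comm (u v : M) : lineDist u v = lineDist v u := setDist_comm _ _

theorem bddBelow_dist (A B : Set E3) : BddBelow (image2 dist A B) :=
  ⟨0, by rintro _ ⟨a, _, b, _, rfl⟩; exact dist_nonneg⟩

theorem setDist_le_dist {A B : Set E3} {p q : E3} (hp : p ∈ A) (hq : q ∈ B) :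
    setDist A B ≤ dist p q := csInf_le (bddBelow_dist A B) ⟨p, hp, q, hq, rfl⟩

theorem mem_lineSet_lineOf {X : SO3} {p : E3} :
    p ∈ lineSet (lineOf X) ↔ ∃ s : ℝ, col 0 X + s • col 1 X = p := by
  rw [lineSet, mem_parallelLine_lineOf]
  simp only [one_smul]

/-- The distance of two lines that are not parallel is attained at the feet of the common
perpendicular. -/
theorem exists_closest_points {X Y : SO3} (hc : (X.1ᵀ * Y.1) 1 1 ^ 2 < 1) :
    ∃ s t : ℝ,
      lineDist (lineOf X) (lineOf Y) = dist (col 0 X + s • col 1 X) (col 0 Y + t • col 1 Y) ∧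
      dist (col 0 X + s • col 1 X) (col 0 Y + t • col 1 Y) ^ 2 * (1 - (X.1ᵀ * Y.1) 1 1 ^ 2) =
        ((X.1ᵀ * Y.1) 1 2 + (X.1ᵀ * Y.1) 2 1) ^ 2 := by
  have hpos : 0 < 1 - (X.1ᵀ * Y.1) 1 1 ^ 2 := by linarith
  have key := sq_dist_points X Y
  generalize (X.1ᵀ * Y.1) 1 1 = c at *
  generalize (X.1ᵀ * Y.1) 1 2 + (X.1ᵀ * Y.1) 2 1 = d at *
  generalize (X.1ᵀ * Y.1) 1 0 = p at *
  generalize (X.1ᵀ * Y.1) 0 1 = q at *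
  -- the parameters of the feet of the common perpendicular
  obtain ⟨s, t, h1, h2⟩ : ∃ s t : ℝ, p + t * c - s = 0 ∧ t + s * -c - q = 0 := by
    refine ⟨p + (q + c * p) / (1 - c ^ 2) * c, (q + c * p) / (1 - c ^ 2), by ring, ?_⟩
    field_simp
    ring
  have hst := key s t
  rw [h1, h2] at hst
  have hst' : dist (col 0 X + s • col 1 X) (col 0 Y + t • col 1 Y) ^ 2 * (1 - c ^ 2) = d ^ 2 := by
    rw [hst]; ring
  refine ⟨s, t, ?_, hst'⟩
  refine IsLeast.csInf_eq
    ⟨⟨_, mem_lineSet_lineOf.2 ⟨s, rfl⟩, _, mem_lineSet_lineOf.2 ⟨t, rfl⟩, rfl⟩, ?_⟩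
  rintro _ ⟨a, ha, b, hb, rfl⟩
  obtain ⟨s', rfl⟩ := mem_lineSet_lineOf.1 ha
  obtain ⟨t', rfl⟩ := mem_lineSet_lineOf.1 hb
  have hk := key s' t'
  have : d ^ 2 ≤ dist (col 0 X + s' • col 1 X) (col 0 Y + t' • col 1 Y) ^ 2 * (1 - c ^ 2) := by
    rw [hk]
    have := mul_nonneg hpos.le (sq_nonneg (t' + s' * -c - q))
    nlinarith [sq_nonneg (p + t' * c - s' - c * (t' + s' * -c - q))]
  rw [← hst'] at this
  exact abs_le_of_sq_le_sq' (le_of_mul_le_mul_right this hpos) dist_nonneg |>.2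

theorem sq_lineDist_lineOf {X Y : SO3} (hc : (X.1ᵀ * Y.1) 1 1 ^ 2 < 1) :
    (lineDist (lineOf X) (lineOf Y) ^ 2 - 12 / 11) * (1 - (X.1ᵀ * Y.1) 1 1 ^ 2) =
      gap (X.1ᵀ * Y.1) := by
  obtain ⟨s, t, h1, h2⟩ := exists_closest_points hc
  rw [h1, gap, ← h2]
  ring

theorem sqrt_value_bounds : 1 < √(12 / 11 : ℝ) ∧ √(12 / 11 : ℝ) < 2 :=
  ⟨Real.lt_sqrt_of_sq_lt (by norm_num), by rw [Real.sqrt_lt' (by norm_num)]; norm_num⟩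

theorem sq_sqrt_value : √(12 / 11 : ℝ) ^ 2 = 12 / 11 := Real.sq_sqrt (by norm_num)

/-- The constant `4` exceeds the sum of the two distances, as `√(12 / 11) < 2`. -/
theorem lineDist_le_of_gap_le {X Y : SO3} {ε : ℝ} (hc : (X.1ᵀ * Y.1) 1 1 ^ 2 < 1) (hε : 0 ≤ ε)
    (hg : gap (X.1ᵀ * Y.1) ≤ -ε) : lineDist (lineOf X) (lineOf Y) ≤ √(12 / 11) - ε / 4 := by
  have h := sq_lineDist_lineOf hc
  have h0 := lineDist_nonneg (lineOf X) (lineOf Y)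
  obtain ⟨v1, v2⟩ := sqrt_value_bounds
  have v3 := sq_sqrt_value
  have hpos : 0 < 1 - (X.1ᵀ * Y.1) 1 1 ^ 2 := by linarith
  have hsq : lineDist (lineOf X) (lineOf Y) ^ 2 - 12 / 11 ≤ -ε := by
    by_contra! hlt
    have := mul_lt_mul_of_pos_right hlt hpos
    nlinarith [sq_nonneg ((X.1ᵀ * Y.1) 1 1)]
  generalize lineDist (lineOf X) (lineOf Y) = d at *
  have : 0 ≤ √(12 / 11 : ℝ) - ε / 4 := by nlinarith
  refine (abs_le_of_sq_le_sq' ?_ this).2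
  nlinarith

/-- The bound `3 / 4` keeps `sin² θ` above `1 / 4`, and the sum of the two distances exceeds `1`. -/
theorem le_lineDist_of_le_gap {X Y : SO3} {ε : ℝ} (hc : (X.1ᵀ * Y.1) 1 1 ^ 2 < 3 / 4) (hε : 0 ≤ ε)
    (hg : -ε ≤ gap (X.1ᵀ * Y.1)) : √(12 / 11) - 4 * ε ≤ lineDist (lineOf X) (lineOf Y) := by
  have h := sq_lineDist_lineOf (hc.trans (by norm_num))
  have h0 := lineDist_nonneg (lineOf X) (lineOf Y)
  obtain ⟨v1, v2⟩ := sqrt_value_bounds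
  have v3 := sq_sqrt_value
  rw [← h] at hg
  generalize lineDist (lineOf X) (lineOf Y) = d at *
  generalize (X.1ᵀ * Y.1) 1 1 ^ 2 = c at *
  by_contra! hlt
  have hd : d < √(12 / 11 : ℝ) := by linarith
  have h1 : (√(12 / 11 : ℝ) - d) * (√(12 / 11 : ℝ) + d) > 4 * ε := by nlinarith
  have h2 : (12 / 11 - d ^ 2) > 4 * ε := by nlinarith
  nlinarith

theorem gap_nonneg_of_le_lineDist {X Y : SO3} (hc : (X.1ᵀ * Y.1) 1 1 ^ 2 < 1)
    (hd : √(12 / 11) ≤ lineDist (lineOf X) (lineOf Y)) : 0 ≤ gap (X.1ᵀ * Y.1) := by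
  rw [← sq_lineDist_lineOf hc]
  have v3 := sq_sqrt_value
  have := pow_le_pow_left₀ (Real.sqrt_nonneg _) hd 2
  exact mul_nonneg (by linarith) (by linarith)

theorem minDist_le (m : M6) {i j : Fin 6} (h : i ≠ j) : minDist m ≤ lineDist (m i) (m j) := by
  rcases lt_or_gt_of_ne h with h | h
  · exact ciInf_le (Finite.bddBelow_range _)
      (⟨(i, j), h⟩ : {p : Fin 6 × Fin 6 // p.1 < p.2})
  · rw [lineDist_comm]
    exact ciInf_le (Finite.bddBelow_range _)
      (⟨(j, i), h⟩ : {p : Fin 6 × Fin 6 // p.1 < p.2})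

/-- Every pair of lines belongs to one of the four orbits. -/
theorem exists_edge : ∀ i j : Fin 6, i ≠ j → ∃ k, nbr k i = j ∨ nbr k j = i := by decide

theorem nbr_ne : ∀ k i, nbr k i ≠ i := by decide

theorem le_minDist {m : M6} {c : ℝ} (h : ∀ k i, c ≤ lineDist (m i) (m (nbr k i))) :
    c ≤ minDist m := by
  have : Nonempty {p : Fin 6 × Fin 6 // p.1 < p.2} := ⟨⟨(0, 1), by decide⟩⟩
  refine le_ciInf ?_
  rintro ⟨⟨i, j⟩, hij⟩
  obtain ⟨k, hk | hk⟩ := exists_edge i j (ne_of_lt hij)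
  · have := h k i
    rwa [hk] at this
  · have := h k j
    rwa [hk, lineDist_comm] at this

/-! ### The dihedral symmetry of the record configuration -/

/-- The frame of the line with the index `0`, with entries computed from the angles of the record
configuration. -/
noncomputable def baseMat : Mat3 :=
  !![√2 * √11 * (1 + 3 * √5) / 44, √3 * (1 - √5) / 8, √3 * √11 * (3 * √5 + 1) / 88;
    √2 * √3 * √11 * (√5 - 1) / 44, -(3 + √5) / 8, √11 * (1 - 9 * √5) / 88;
    √3 * √11 / 11, √2 / 2, -(√2 * √5 * √11) / 22]

/-- The rotation by `2π/3` about the polar axis. -/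
noncomputable def turnMat : Mat3 := !![-1 / 2, -√3 / 2, 0; √3 / 2, -1 / 2, 0; 0, 0, 1]

/-- The half-turn about the horizontal axis of longitude `π/3`. -/
noncomputable def flipMat : Mat3 := !![-1 / 2, √3 / 2, 0; √3 / 2, 1 / 2, 0; 0, 0, -1]

theorem turnMat_orthogonal : turnMatᵀ * turnMat = 1 := by
  have h3 : √3 ^ 2 = 3 := Real.sq_sqrt (by norm_num)
  ext i j
  fin_cases i <;> fin_cases j <;>
    simp [turnMat, Matrix.mul_apply, Fin.sum_univ_three] <;> grind

theorem flipMat_orthogonal : flipMatᵀ * flipMat = 1 := by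
  have h3 : √3 ^ 2 = 3 := Real.sq_sqrt (by norm_num)
  ext i j
  fin_cases i <;> fin_cases j <;>
    simp [flipMat, Matrix.mul_apply, Fin.sum_univ_three] <;> grind

theorem baseMat_orthogonal : baseMatᵀ * baseMat = 1 := by
  have h2 : √2 ^ 2 = 2 := Real.sq_sqrt (by norm_num)
  have h3 : √3 ^ 2 = 3 := Real.sq_sqrt (by norm_num)
  have h5 : √5 ^ 2 = 5 := Real.sq_sqrt (by norm_num)
  have h11 : √11 ^ 2 = 11 := Real.sq_sqrt (by norm_num)
  ext i j
  fin_cases i <;> fin_cases j <;>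
    simp [baseMat, Matrix.mul_apply, Fin.sum_univ_three] <;> grind

/-- `turnMat` as an element of `SO(3)`. -/
noncomputable def turn : SO3 := ⟨turnMat, mem_SO3 turnMat_orthogonal (by
  have h3 : √3 ^ 2 = 3 := Real.sq_sqrt (by norm_num)
  simp [turnMat, Matrix.det_fin_three]; grind)⟩

/-- `flipMat` as an element of `SO(3)`. -/
noncomputable def flip : SO3 := ⟨flipMat, mem_SO3 flipMat_orthogonal (by
  have h3 : √3 ^ 2 = 3 := Real.sq_sqrt (by norm_num)
  simp [flipMat, Matrix.det_fin_three]; grind)⟩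

/-- `baseMat` as an element of `SO(3)`. -/
noncomputable def base : SO3 := ⟨baseMat, mem_SO3 baseMat_orthogonal (by
  have h2 : √2 ^ 2 = 2 := Real.sq_sqrt (by norm_num)
  have h3 : √3 ^ 2 = 3 := Real.sq_sqrt (by norm_num)
  have h5 : √5 ^ 2 = 5 := Real.sq_sqrt (by norm_num)
  have h11 : √11 ^ 2 = 11 := Real.sq_sqrt (by norm_num)
  simp [baseMat, Matrix.det_fin_three]; grind)⟩

/-- The symmetry group of the record configuration, enumerated so that the `i`-th element takes the
line `0` to the line `i`. -/
noncomputable def dihedral : Fin 6 → SO3 :=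
  ![1, flip, turn, turn * flip, turn * turn, turn * turn * flip]

/-- Frames of the lines of the record configuration. -/
noncomputable def frame (i : Fin 6) : SO3 := dihedral i * base

theorem turn_cubed : turn * turn * turn = 1 := by
  have h3 : √3 ^ 2 = 3 := Real.sq_sqrt (by norm_num)
  apply Subtype.ext
  simp only [Submonoid.coe_mul, turn, Submonoid.coe_one]
  ext i j
  fin_cases i <;> fin_cases j <;>
    simp [turnMat, Matrix.mul_apply, Fin.sum_univ_three] <;> grind

theorem flip_mul_flip : flip * flip = 1 := by
  have h3 : √3 ^ 2 = 3 := Real.sq_sqrt (by norm_num)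
  apply Subtype.ext
  simp only [Submonoid.coe_mul, flip, Submonoid.coe_one]
  ext i j
  fin_cases i <;> fin_cases j <;>
    simp [flipMat, Matrix.mul_apply, Fin.sum_univ_three] <;> grind

theorem flip_mul_turn : flip * turn = turn * turn * flip := by
  have h3 : √3 ^ 2 = 3 := Real.sq_sqrt (by norm_num)
  apply Subtype.ext
  simp only [Submonoid.coe_mul, flip, turn]
  ext i j
  fin_cases i <;> fin_cases j <;>
    simp [flipMat, turnMat, Matrix.mul_apply, Fin.sum_univ_three] <;> grind

/-- The symmetry that takes the line `0` to its partner `nbr k 0`. -/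
noncomputable def edgeRotation : Fin 4 → SO3 := ![turn, flip, turn * turn * flip, turn * flip]

/-- The orbits of pairs correspond to right multiplications in the symmetry group, which is why all
pairs of an orbit have the same relative position. -/
theorem dihedral_nbr (k : Fin 4) (i : Fin 6) :
    dihedral (nbr k i) = dihedral i * edgeRotation k := by
  have t3 := turn_cubed
  have f2 := flip_mul_flip
  have ft := flip_mul_turn
  have t3' : ∀ x, turn * (turn * (turn * x)) = x := fun x => by
    rw [← mul_assoc, ← mul_assoc, t3, one_mul]
  have ft' : ∀ x, flip * (turn * x) = turn * (turn * (flip * x)) := fun x => by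
    rw [← mul_assoc, ft, mul_assoc, mul_assoc]
  have t3'' : turn * (turn * turn) = 1 := by rw [← mul_assoc, t3]
  rw [mul_assoc] at ft
  fin_cases k <;> fin_cases i <;>
    simp [dihedral, nbr, edgeRotation, mul_assoc, t3', t3'', ft, f2, ft']

theorem turn_turn_flip_val : (turn * turn * flip).1 = !![1, 0, 0; 0, -1, 0; 0, 0, -1] := by
  have h3 : √3 ^ 2 = 3 := Real.sq_sqrt (by norm_num)
  simp only [Submonoid.coe_mul, turn, flip]
  ext i j
  fin_cases i <;> fin_cases j <;>
    simp [turnMat, flipMat, Matrix.mul_apply, Fin.sum_univ_three] <;> grind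

theorem turn_flip_val :
    (turn * flip).1 = !![-1 / 2, -√3 / 2, 0; -√3 / 2, 1 / 2, 0; 0, 0, -1] := by
  have h3 : √3 ^ 2 = 3 := Real.sq_sqrt (by norm_num)
  simp only [Submonoid.coe_mul, turn, flip]
  ext i j
  fin_cases i <;> fin_cases j <;>
    simp [turnMat, flipMat, Matrix.mul_apply, Fin.sum_univ_three] <;> grind

theorem turn_turn_val :
    (turn * turn).1 = !![-1 / 2, √3 / 2, 0; -√3 / 2, -1 / 2, 0; 0, 0, 1] := by
  have h3 : √3 ^ 2 = 3 := Real.sq_sqrt (by norm_num)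
  simp only [Submonoid.coe_mul, turn]
  ext i j
  fin_cases i <;> fin_cases j <;>
    simp [turnMat, Matrix.mul_apply, Fin.sum_univ_three] <;> grind

theorem base_relations (k : Fin 4) : base.1ᵀ * (edgeRotation k).1 * base.1 = relMat k := by
  have h2 : √2 ^ 2 = 2 := Real.sq_sqrt (by norm_num)
  have h3 : √3 ^ 2 = 3 := Real.sq_sqrt (by norm_num)
  have h5 : √5 ^ 2 = 5 := Real.sq_sqrt (by norm_num)
  have h11 : √11 ^ 2 = 11 := Real.sq_sqrt (by norm_num)
  fin_cases k
  · change base.1ᵀ * turnMat * base.1 = relMat₀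
    ext i j
    fin_cases i <;> fin_cases j <;>
      simp [base, baseMat, turnMat, relMat₀, Matrix.mul_apply, Fin.sum_univ_three] <;> grind
  · change base.1ᵀ * flipMat * base.1 = relMat₁
    ext i j
    fin_cases i <;> fin_cases j <;>
      simp [base, baseMat, flipMat, relMat₁, Matrix.mul_apply, Fin.sum_univ_three] <;> grind
  · change base.1ᵀ * (turn * turn * flip).1 * base.1 = relMat₂
    rw [turn_turn_flip_val]
    ext i j
    fin_cases i <;> fin_cases j <;>
      simp [base, baseMat, relMat₂, Matrix.mul_apply, Fin.sum_univ_three] <;> grind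
  · change base.1ᵀ * (turn * flip).1 * base.1 = relMat₃
    rw [turn_flip_val]
    ext i j
    fin_cases i <;> fin_cases j <;>
      simp [base, baseMat, relMat₃, Matrix.mul_apply, Fin.sum_univ_three] <;> grind

theorem frame_relation (k : Fin 4) (i : Fin 6) :
    (frame i).1ᵀ * (frame (nbr k i)).1 = relMat k := by
  rw [frame, frame, dihedral_nbr, ← base_relations]
  simp only [Submonoid.coe_mul, Matrix.transpose_mul]
  rw [show base.1ᵀ * (dihedral i).1ᵀ * ((dihedral i).1 * (edgeRotation k).1 * base.1) =
    base.1ᵀ * ((dihedral i).1ᵀ * (dihedral i).1) * (edgeRotation k).1 * base.1 by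
    simp only [mul_assoc], transpose_mul_self, mul_one]

theorem gap_relMat (k : Fin 3) : gap (relMat k.castSucc) = 0 := by
  have h5 : √5 ^ 2 = 5 := Real.sq_sqrt (by norm_num)
  have h11 : √11 ^ 2 = 11 := Real.sq_sqrt (by norm_num)
  fin_cases k <;> simp [gap, relMat, relMat₀, relMat₁, relMat₂] <;> grind

theorem gap_relMat_three : gap (relMat 3) = 18 / 11 := by
  have h5 : √5 ^ 2 = 5 := Real.sq_sqrt (by norm_num)
  have h11 : √11 ^ 2 = 11 := Real.sq_sqrt (by norm_num)
  simp [gap, relMat, relMat₃]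
  grind

theorem relMat_direction (k : Fin 4) : (relMat k) 1 1 ^ 2 < 3 / 4 := by
  have h5 : √5 ^ 2 = 5 := Real.sq_sqrt (by norm_num)
  have h := sqrt_five_bounds
  fin_cases k <;> simp [relMat, relMat₀, relMat₁, relMat₂, relMat₃] <;> nlinarith

/-! ### The record configuration in coordinates -/

theorem cos_sin_latitude :
    Real.cos (Real.arcsin √(3 / 11)) = 2 * √2 * √11 / 11 ∧
    Real.sin (Real.arcsin √(3 / 11)) = √3 * √11 / 11 := by
  have h2 : √2 ^ 2 = 2 := Real.sq_sqrt (by norm_num)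
  have h3 : √3 ^ 2 = 3 := Real.sq_sqrt (by norm_num)
  have h11 : √11 ^ 2 = 11 := Real.sq_sqrt (by norm_num)
  have hs : √(3 / 11 : ℝ) ^ 2 = 3 / 11 := Real.sq_sqrt (by norm_num)
  constructor
  · rw [Real.cos_arcsin, hs, Real.sqrt_eq_iff_mul_self_eq (by norm_num) (by positivity)]
    grind
  · rw [Real.sin_arcsin (by linarith [Real.sqrt_nonneg (3 / 11 : ℝ)])
      (Real.sqrt_le_one.2 (by norm_num)),
      Real.sqrt_eq_iff_mul_self_eq (by norm_num) (by positivity)]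
    grind

theorem cos_sin_direction :
    Real.cos (Real.arctan √(5 / 11)) = √11 / 4 ∧ Real.sin (Real.arctan √(5 / 11)) = √5 / 4 := by
  have h5 : √5 ^ 2 = 5 := Real.sq_sqrt (by norm_num)
  have h11 : √11 ^ 2 = 11 := Real.sq_sqrt (by norm_num)
  have hs : √(5 / 11 : ℝ) ^ 2 = 5 / 11 := Real.sq_sqrt (by norm_num)
  have p11 : 0 < √11 := by positivity
  have e : √(1 + √(5 / 11 : ℝ) ^ 2) = 4 / √11 := by
    rw [hs, Real.sqrt_eq_iff_mul_self_eq (by norm_num) (by positivity)]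
    field_simp
    rw [h11]; norm_num
  have e2 : √(5 / 11 : ℝ) = √5 / √11 := Real.sqrt_div (by norm_num) 11
  rw [Real.cos_arctan, Real.sin_arctan, e, e2]
  constructor <;> field_simp

theorem cos_sin_shift :
    Real.cos (-Real.arctan (1 / √15)) = √3 * √5 / 4 ∧
    Real.sin (-Real.arctan (1 / √15)) = -1 / 4 := by
  have h15 : √15 = √3 * √5 := by rw [← Real.sqrt_mul (by norm_num)]; norm_num
  have h3 : √3 ^ 2 = 3 := Real.sq_sqrt (by norm_num)
  have h5 : √5 ^ 2 = 5 := Real.sq_sqrt (by norm_num)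
  have p3 : 0 < √3 := by positivity
  have p5 : 0 < √5 := by positivity
  have e : √(1 + (1 / √15) ^ 2) = 4 / (√3 * √5) := by
    rw [h15, Real.sqrt_eq_iff_mul_self_eq (by positivity) (by positivity)]
    field_simp
    rw [h3, h5]; norm_num
  rw [Real.cos_neg, Real.sin_neg, Real.cos_arctan, Real.sin_arctan, e, h15]
  constructor <;> field_simp

theorem cos_sin_first_longitude :
    Real.cos (Real.pi / 6 + -Real.arctan (1 / √15)) = (1 + 3 * √5) / 8 ∧
    Real.sin (Real.pi / 6 + -Real.arctan (1 / √15)) = √3 * (√5 - 1) / 8 := by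
  have h3 : √3 ^ 2 = 3 := Real.sq_sqrt (by norm_num)
  obtain ⟨h1, h2⟩ := cos_sin_shift
  rw [Real.cos_add, Real.sin_add, h1, h2, Real.cos_pi_div_six, Real.sin_pi_div_six]
  constructor <;> grind

/-- A line is recognized from the first two columns of a frame; the sign `ε` accounts for the two
orientations. -/
theorem tangentLine_eq_lineOf {φ ϰ δ : ℝ} {X : SO3}
    (hx : X.1 0 0 = Real.cos φ * Real.cos ϰ ∧ X.1 1 0 = Real.cos φ * Real.sin ϰ ∧
      X.1 2 0 = Real.sin φ) {ε : ℝ} (hε : ε = 1 ∨ ε = -1)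
    (hξ : X.1 0 1 = ε * (-(Real.cos δ * Real.sin φ * Real.cos ϰ) + Real.sin δ * Real.sin ϰ) ∧
      X.1 1 1 = ε * (-(Real.cos δ * Real.sin φ * Real.sin ϰ) - Real.sin δ * Real.cos ϰ) ∧
      X.1 2 1 = ε * (Real.cos δ * Real.cos φ)) :
    tangentLine φ ϰ δ = lineOf X := by
  refine Quotient.sound ⟨?_, ?_⟩
  · ext i
    fin_cases i <;> simp [tangentOf, col, hx]
  · rcases hε with rfl | rfl
    · left
      ext i
      fin_cases i <;> simp [tangentOf, col, hξ]
    · right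
      ext i
      fin_cases i <;> simp [tangentOf, col, hξ]
      ring

theorem cos_two_pi_div_three : Real.cos (2 * Real.pi / 3) = -1 / 2 := by
  rw [show 2 * Real.pi / 3 = Real.pi - Real.pi / 3 by ring, Real.cos_pi_sub, Real.cos_pi_div_three]
  norm_num

theorem sin_two_pi_div_three : Real.sin (2 * Real.pi / 3) = √3 / 2 := by
  rw [show 2 * Real.pi / 3 = Real.pi - Real.pi / 3 by ring, Real.sin_pi_sub, Real.sin_pi_div_three]

theorem cos_four_pi_div_three : Real.cos (4 * Real.pi / 3) = -1 / 2 := by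
  rw [show 4 * Real.pi / 3 = Real.pi / 3 + Real.pi by ring, Real.cos_add_pi, Real.cos_pi_div_three]
  norm_num

theorem sin_four_pi_div_three : Real.sin (4 * Real.pi / 3) = -√3 / 2 := by
  rw [show 4 * Real.pi / 3 = Real.pi / 3 + Real.pi by ring, Real.sin_add_pi, Real.sin_pi_div_three]
  ring

theorem Cm_zero : Cm 0 = lineOf (frame 0) := by
  have h2 : √2 ^ 2 = 2 := Real.sq_sqrt (by norm_num)
  have h3 : √3 ^ 2 = 3 := Real.sq_sqrt (by norm_num)
  have h5 : √5 ^ 2 = 5 := Real.sq_sqrt (by norm_num)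
  have h11 : √11 ^ 2 = 11 := Real.sq_sqrt (by norm_num)
  have hf : (frame 0).1 = (1 : Mat3) * baseMat := rfl
  obtain ⟨c1, s1⟩ := cos_sin_first_longitude
  refine tangentLine_eq_lineOf (ε := 1) ?_ (Or.inl rfl) ?_ <;>
    rw [hf] <;>
    generalize Real.pi / 6 + -Real.arctan (1 / √15) = θ at c1 s1 ⊢ <;>
    simp only [c1, s1,
      cos_sin_latitude, cos_sin_direction] <;>
    simp [baseMat, Matrix.mul_apply, Fin.sum_univ_three] <;> grind

theorem Cm_one : Cm 1 = lineOf (frame 1) := by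
  have h2 : √2 ^ 2 = 2 := Real.sq_sqrt (by norm_num)
  have h3 : √3 ^ 2 = 3 := Real.sq_sqrt (by norm_num)
  have h5 : √5 ^ 2 = 5 := Real.sq_sqrt (by norm_num)
  have h11 : √11 ^ 2 = 11 := Real.sq_sqrt (by norm_num)
  have hf : (frame 1).1 = flipMat * baseMat := rfl
  obtain ⟨c1, s1⟩ := cos_sin_first_longitude
  refine tangentLine_eq_lineOf (ε := -1) ?_ (Or.inr rfl) ?_ <;>
    rw [hf, show Real.pi / 2 - -Real.arctan (1 / √15) =
      2 * Real.pi / 3 - (Real.pi / 6 + -Real.arctan (1 / √15)) by ring] <;>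
    generalize Real.pi / 6 + -Real.arctan (1 / √15) = θ at c1 s1 ⊢ <;>
    simp only [Real.cos_sub, Real.sin_sub, Real.cos_neg, Real.sin_neg, cos_two_pi_div_three,
      sin_two_pi_div_three, c1, s1,
      cos_sin_latitude, cos_sin_direction] <;>
    simp [baseMat, flipMat, Matrix.mul_apply, Fin.sum_univ_three] <;> grind

theorem Cm_two : Cm 2 = lineOf (frame 2) := by
  have h2 : √2 ^ 2 = 2 := Real.sq_sqrt (by norm_num)
  have h3 : √3 ^ 2 = 3 := Real.sq_sqrt (by norm_num)
  have h5 : √5 ^ 2 = 5 := Real.sq_sqrt (by norm_num)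
  have h11 : √11 ^ 2 = 11 := Real.sq_sqrt (by norm_num)
  have hf : (frame 2).1 = turnMat * baseMat := rfl
  obtain ⟨c1, s1⟩ := cos_sin_first_longitude
  refine tangentLine_eq_lineOf (ε := 1) ?_ (Or.inl rfl) ?_ <;>
    rw [hf, show 5 * Real.pi / 6 + -Real.arctan (1 / √15) =
      (Real.pi / 6 + -Real.arctan (1 / √15)) + 2 * Real.pi / 3 by ring] <;>
    generalize Real.pi / 6 + -Real.arctan (1 / √15) = θ at c1 s1 ⊢ <;>
    simp only [Real.cos_add, Real.sin_add, cos_two_pi_div_three, sin_two_pi_div_three, c1, s1,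
      cos_sin_latitude, cos_sin_direction] <;>
    simp [baseMat, turnMat, Matrix.mul_apply, Fin.sum_univ_three] <;> grind

theorem Cm_three : Cm 3 = lineOf (frame 3) := by
  have h2 : √2 ^ 2 = 2 := Real.sq_sqrt (by norm_num)
  have h3 : √3 ^ 2 = 3 := Real.sq_sqrt (by norm_num)
  have h5 : √5 ^ 2 = 5 := Real.sq_sqrt (by norm_num)
  have h11 : √11 ^ 2 = 11 := Real.sq_sqrt (by norm_num)
  have hf : (frame 3).1 = (turn * flip).1 * baseMat := rfl
  obtain ⟨c1, s1⟩ := cos_sin_first_longitude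
  refine tangentLine_eq_lineOf (ε := -1) ?_ (Or.inr rfl) ?_ <;>
    rw [hf, turn_flip_val, show 7 * Real.pi / 6 - -Real.arctan (1 / √15) =
      4 * Real.pi / 3 - (Real.pi / 6 + -Real.arctan (1 / √15)) by ring] <;>
    generalize Real.pi / 6 + -Real.arctan (1 / √15) = θ at c1 s1 ⊢ <;>
    simp only [Real.cos_sub, Real.sin_sub, Real.cos_neg, Real.sin_neg, cos_four_pi_div_three,
      sin_four_pi_div_three, c1, s1,
      cos_sin_latitude, cos_sin_direction] <;>
    simp [baseMat, Matrix.mul_apply, Fin.sum_univ_three] <;> grind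

theorem Cm_four : Cm 4 = lineOf (frame 4) := by
  have h2 : √2 ^ 2 = 2 := Real.sq_sqrt (by norm_num)
  have h3 : √3 ^ 2 = 3 := Real.sq_sqrt (by norm_num)
  have h5 : √5 ^ 2 = 5 := Real.sq_sqrt (by norm_num)
  have h11 : √11 ^ 2 = 11 := Real.sq_sqrt (by norm_num)
  have hf : (frame 4).1 = (turn * turn).1 * baseMat := rfl
  obtain ⟨c1, s1⟩ := cos_sin_first_longitude
  refine tangentLine_eq_lineOf (ε := 1) ?_ (Or.inl rfl) ?_ <;>
    rw [hf, turn_turn_val, show 3 * Real.pi / 2 + -Real.arctan (1 / √15) =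
      (Real.pi / 6 + -Real.arctan (1 / √15)) + 4 * Real.pi / 3 by ring] <;>
    generalize Real.pi / 6 + -Real.arctan (1 / √15) = θ at c1 s1 ⊢ <;>
    simp only [Real.cos_add, Real.sin_add, cos_four_pi_div_three, sin_four_pi_div_three, c1, s1,
      cos_sin_latitude, cos_sin_direction] <;>
    simp [baseMat, Matrix.mul_apply, Fin.sum_univ_three] <;> grind

theorem Cm_five : Cm 5 = lineOf (frame 5) := by
  have h2 : √2 ^ 2 = 2 := Real.sq_sqrt (by norm_num)
  have h3 : √3 ^ 2 = 3 := Real.sq_sqrt (by norm_num)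
  have h5 : √5 ^ 2 = 5 := Real.sq_sqrt (by norm_num)
  have h11 : √11 ^ 2 = 11 := Real.sq_sqrt (by norm_num)
  have hf : (frame 5).1 = (turn * turn * flip).1 * baseMat := rfl
  obtain ⟨c1, s1⟩ := cos_sin_first_longitude
  refine tangentLine_eq_lineOf (ε := -1) ?_ (Or.inr rfl) ?_ <;>
    rw [hf, turn_turn_flip_val, show 11 * Real.pi / 6 - -Real.arctan (1 / √15) =
      2 * Real.pi - (Real.pi / 6 + -Real.arctan (1 / √15)) by ring] <;>
    generalize Real.pi / 6 + -Real.arctan (1 / √15) = θ at c1 s1 ⊢ <;>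
    simp only [Real.cos_sub, Real.sin_sub, Real.cos_neg, Real.sin_neg, Real.cos_two_pi,
      Real.sin_two_pi, c1, s1,
      cos_sin_latitude, cos_sin_direction] <;>
    simp [baseMat, Matrix.mul_apply, Fin.sum_univ_three] <;> grind

theorem Cm_eq (i : Fin 6) : Cm i = lineOf (frame i) := by
  fin_cases i
  · exact Cm_zero
  · exact Cm_one
  · exact Cm_two
  · exact Cm_three
  · exact Cm_four
  · exact Cm_five

/-! ### Infinitesimal motions in body coordinates -/

/-- The coordinates `Xᵀ ω` of the vector `ω` in the frame `X`. -/
def bodyCoord (X : SO3) (ω : E3) : E3 := WithLp.toLp 2 (X.1ᵀ *ᵥ ω.ofLp)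

theorem first_column (X : SO3) :
    X.1 0 0 = X.1 1 1 * X.1 2 2 - X.1 2 1 * X.1 1 2 ∧
    X.1 1 0 = X.1 2 1 * X.1 0 2 - X.1 0 1 * X.1 2 2 ∧
    X.1 2 0 = X.1 0 1 * X.1 1 2 - X.1 1 1 * X.1 0 2 := by
  have h := adjugate_eq_transpose X
  rw [Matrix.adjugate_fin_three] at h
  refine ⟨?_, ?_, ?_⟩
  · have := congrFun (congrFun h 0) 0
    simp at this
    linarith
  · have := congrFun (congrFun h 0) 1
    simp at this
    linarith
  · have := congrFun (congrFun h 0) 2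
    simp at this
    linarith

theorem second_column (X : SO3) :
    X.1 0 1 = X.1 1 2 * X.1 2 0 - X.1 2 2 * X.1 1 0 ∧
    X.1 1 1 = X.1 2 2 * X.1 0 0 - X.1 0 2 * X.1 2 0 ∧
    X.1 2 1 = X.1 0 2 * X.1 1 0 - X.1 1 2 * X.1 0 0 := by
  have h := adjugate_eq_transpose X
  rw [Matrix.adjugate_fin_three] at h
  refine ⟨?_, ?_, ?_⟩
  · have := congrFun (congrFun h 1) 0
    simp at this
    linarith
  · have := congrFun (congrFun h 1) 1
    simp at this
    linarith
  · have := congrFun (congrFun h 1) 2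
    simp at this
    linarith

theorem crossMatrix_bodyCoord (X : SO3) (ω : E3) :
    crossMatrix (bodyCoord X ω) = X.1ᵀ * crossMatrix ω * X.1 := by
  obtain ⟨a0, a1, a2⟩ := first_column X
  obtain ⟨b0, b1, b2⟩ := second_column X
  obtain ⟨c0, c1, c2⟩ := third_column X
  ext i j
  fin_cases i <;> fin_cases j <;>
    simp [crossMatrix, bodyCoord, Matrix.mul_apply, Fin.sum_univ_three, Matrix.mulVec,
      dotProduct]
  · ring
  · linear_combination (-ω 0) * c0 - ω 1 * c1 - ω 2 * c2
  · linear_combination ω 0 * b0 + ω 1 * b1 + ω 2 * b2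
  · linear_combination ω 0 * c0 + ω 1 * c1 + ω 2 * c2
  · ring
  · linear_combination (-ω 0) * a0 - ω 1 * a1 - ω 2 * a2
  · linear_combination (-ω 0) * b0 - ω 1 * b1 - ω 2 * b2
  · linear_combination ω 0 * a0 + ω 1 * a1 + ω 2 * a2
  · ring

theorem bodyCoord_smul (X : SO3) (t : ℝ) (ω : E3) : bodyCoord X (t • ω) = t • bodyCoord X ω := by
  simp [bodyCoord, Matrix.mulVec_smul]

theorem rotateVec_bodyCoord (X : SO3) (ω : E3) : rotateVec X (bodyCoord X ω) = ω := by
  simp [rotateVec, bodyCoord, Matrix.mulVec_mulVec, mul_transpose_self]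

theorem bodyCoord_rotateVec (X : SO3) (a : E3) : bodyCoord X (rotateVec X a) = a := by
  simp [rotateVec, bodyCoord, Matrix.mulVec_mulVec, transpose_mul_self]

theorem continuous_crossMatrix : Continuous crossMatrix := by
  unfold crossMatrix
  fun_prop

theorem continuous_gapLin (W : Mat3) (i j : Fin 6) :
    Continuous fun a : Fin 6 → E3 => gapLin W (a i) (a j) := by
  have := continuous_crossMatrix
  unfold gapLin relLin
  fun_prop

theorem continuous_gapQuad (W : Mat3) (i j : Fin 6) :
    Continuous fun a : Fin 6 → E3 => gapQuad W (a i) (a j) := by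
  have := continuous_crossMatrix
  unfold gapQuad relLin relQuad
  fun_prop

theorem continuous_edgeLin (k : Fin 3) (i : Fin 6) :
    Continuous fun a : Fin 6 → E3 => edgeLin a k i := continuous_gapLin _ _ _

theorem continuous_edgeQuad (k : Fin 3) (i : Fin 6) :
    Continuous fun a : Fin 6 → E3 => edgeQuad a k i := continuous_gapQuad _ _ _

theorem continuous_lagrangian : Continuous lagrangian := by
  unfold lagrangian
  have := continuous_edgeQuad
  fun_prop

theorem continuous_gap : Continuous gap := by
  unfold gap
  fun_prop

theorem edgeLin_smul (t : ℝ) (a : Fin 6 → E3) (k : Fin 3) (i : Fin 6) :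
    edgeLin (t • a) k i = t * edgeLin a k i := gapLin_smul _ _ _ _

theorem edgeQuad_smul (t : ℝ) (a : Fin 6 → E3) (k : Fin 3) (i : Fin 6) :
    edgeQuad (t • a) k i = t ^ 2 * edgeQuad a k i := gapQuad_smul _ _ _ _

theorem lagrangian_smul (t : ℝ) (a : Fin 6 → E3) : lagrangian (t • a) = t ^ 2 * lagrangian a := by
  simp only [lagrangian, edgeQuad_smul, Finset.mul_sum]
  exact Finset.sum_congr rfl fun k _ => Finset.sum_congr rfl fun i _ => by ring

theorem crossMatrix_add (a b : E3) : crossMatrix (a + b) = crossMatrix a + crossMatrix b := by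
  ext i j
  fin_cases i <;> fin_cases j <;> simp [crossMatrix] <;> ring

theorem gapLin_add (W : Mat3) (a b a' b' : E3) :
    gapLin W (a + a') (b + b') = gapLin W a b + gapLin W a' b' := by
  simp only [gapLin, relLin, crossMatrix_add, mul_add, add_mul, Matrix.sub_apply, Matrix.add_apply]
  ring

theorem edgeLin_add (a b : Fin 6 → E3) (k : Fin 3) (i : Fin 6) :
    edgeLin (a + b) k i = edgeLin a k i + edgeLin b k i := gapLin_add _ _ _ _ _

theorem gapQuad_parallelogram (W : Mat3) (a b a' b' : E3) :
    gapQuad W (a + a') (b + b') + gapQuad W (a - a') (b - b') =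
      2 * gapQuad W a b + 2 * gapQuad W a' b' := by
  have hs : ∀ x y : E3, crossMatrix (x - y) = crossMatrix x - crossMatrix y := fun x y => by
    rw [sub_eq_add_neg, crossMatrix_add, ← neg_one_smul ℝ y, crossMatrix_smul, neg_one_smul,
      sub_eq_add_neg]
  simp only [gapQuad, relLin, relQuad, crossMatrix_add, hs, mul_add, add_mul, mul_sub, sub_mul,
    Matrix.sub_apply, Matrix.add_apply, Matrix.smul_apply, smul_eq_mul]
  ring

theorem lagrangian_parallelogram (a b : Fin 6 → E3) :
    lagrangian (a + b) + lagrangian (a - b) = 2 * lagrangian a + 2 * lagrangian b := by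
  simp only [lagrangian, Finset.mul_sum, ← Finset.sum_add_distrib]
  refine Finset.sum_congr rfl fun k _ => Finset.sum_congr rfl fun i _ => ?_
  have := gapQuad_parallelogram (relMat k.castSucc) (a i) (a (nbr k.castSucc i)) (b i)
    (b (nbr k.castSucc i))
  simp only [edgeQuad, Pi.add_apply, Pi.sub_apply]
  linear_combination mult k * this

/-- Angular velocities of the six lines, each in the coordinates of the frame of its line. -/
noncomputable def bodyTuple (l : Fin 6 → E3) : Fin 6 → E3 := fun i => bodyCoord (frame i) (l i)

/-- A global rotation moves the two frames of a pair together. -/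
theorem crossMatrix_body_comm (k : Fin 4) (i : Fin 6) (ω : E3) :
    crossMatrix (bodyCoord (frame i) ω) * relMat k =
      relMat k * crossMatrix (bodyCoord (frame (nbr k i)) ω) := by
  rw [crossMatrix_bodyCoord, crossMatrix_bodyCoord, ← frame_relation k i]
  calc _ = (frame i).1ᵀ * crossMatrix ω * ((frame i).1 * (frame i).1ᵀ) * (frame (nbr k i)).1 := by
        simp only [mul_assoc]
    _ = (frame i).1ᵀ * ((frame (nbr k i)).1 * (frame (nbr k i)).1ᵀ) * crossMatrix ω *
        (frame (nbr k i)).1 := by simp only [mul_transpose_self, mul_one]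
    _ = _ := by simp only [mul_assoc]

theorem gapLin_eq_zero_of_comm {W : Mat3} {a b : E3}
    (h : crossMatrix a * W = W * crossMatrix b) : gapLin W a b = 0 := by
  simp [gapLin, relLin, h]

theorem gapQuad_eq_zero_of_comm {W : Mat3} {a b : E3}
    (h : crossMatrix a * W = W * crossMatrix b) : gapQuad W a b = 0 := by
  have e : relQuad W (crossMatrix a) (crossMatrix b) = 0 := by
    have h1 : crossMatrix a * crossMatrix a * W = crossMatrix a * W * crossMatrix b := by
      rw [mul_assoc, mul_assoc, h]
    have h2 : W * (crossMatrix b * crossMatrix b) = crossMatrix a * W * crossMatrix b := by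
      rw [← mul_assoc, h]
    rw [relQuad, h1, h2]
    module
  simp [gapQuad, relLin, h, e]

theorem edgeLin_rotation (ω : E3) (k : Fin 3) (i : Fin 6) :
    edgeLin (bodyTuple fun _ => ω) k i = 0 :=
  gapLin_eq_zero_of_comm (crossMatrix_body_comm _ _ _)

theorem lagrangian_rotation (ω : E3) : lagrangian (bodyTuple fun _ => ω) = 0 :=
  Finset.sum_eq_zero fun k _ => Finset.sum_eq_zero fun i _ => by
    rw [edgeQuad, bodyTuple, bodyTuple, gapQuad_eq_zero_of_comm (crossMatrix_body_comm _ _ _),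
      mul_zero]

/-- In the kernel the null vectors of the Lagrangian are the global rotations. The parallelogram
identity reduces this to `eq_zero_of_lagrangian_eq_zero`, since the Lagrangian is at most zero on
the kernel and adding a rotation does not leave the kernel. -/
theorem eq_const_of_lagrangian_eq_zero {l : Fin 6 → E3}
    (hl : ∀ k i, edgeLin (bodyTuple l) k i = 0) (hq : lagrangian (bodyTuple l) = 0) (i : Fin 6) :
    l i = l 0 := by
  have hadd : ∀ m : Fin 6 → E3, ∀ c : ℝ, bodyTuple (m + c • fun _ => l 0) =
      bodyTuple m + c • bodyTuple fun _ => l 0 := by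
    intro m c
    funext i
    simp [bodyTuple, bodyCoord, Matrix.mulVec_add, Matrix.mulVec_smul]
  have hlin : ∀ c : ℝ, ∀ k i, edgeLin (bodyTuple l + c • bodyTuple fun _ => l 0) k i = 0 := by
    intro c k i
    rw [edgeLin_add, hl, edgeLin_smul, edgeLin_rotation, mul_zero, add_zero]
  have h1 := lagrangian_nonpos (hlin 1)
  have h2 := lagrangian_nonpos (hlin (-1))
  rw [one_smul] at h1
  rw [neg_one_smul, ← sub_eq_add_neg] at h2
  have h3 := lagrangian_parallelogram (bodyTuple l) (bodyTuple fun _ => l 0)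
  rw [hq, lagrangian_rotation] at h3
  have h4 : bodyTuple l - (bodyTuple fun _ => l 0) = 0 := by
    refine eq_zero_of_lagrangian_eq_zero (fun k i => ?_) ?_ (by linarith)
    · have := hlin (-1) k i
      rwa [neg_one_smul, ← sub_eq_add_neg] at this
    · simp [bodyTuple]
  have h5 := congrFun h4 i
  rw [Pi.sub_apply, bodyTuple, bodyTuple, Pi.zero_apply, sub_eq_zero] at h5
  rw [← rotateVec_bodyCoord (frame i) (l i), h5, rotateVec_bodyCoord]

section

attribute [local instance] Matrix.linftyOpNormedRing Matrix.linftyOpNormedAlgebra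

open Asymptotics

theorem body_exp_expansion (X : SO3) (ω : E3) :
    (fun t : ℝ => X.1ᵀ * (rot (t • ω)).1 * X.1 - 1 - crossMatrix (t • bodyCoord X ω) -
      (1 / 2 : ℝ) • (crossMatrix (t • bodyCoord X ω) * crossMatrix (t • bodyCoord X ω))) =O[𝓝 0]
      fun t => t ^ 3 := by
  have h1 : (fun _ : ℝ => X.1ᵀ) =O[𝓝 0] fun _ => (1 : ℝ) := isBigO_const_const _ one_ne_zero _
  have h2 : (fun _ : ℝ => X.1) =O[𝓝 0] fun _ => (1 : ℝ) := isBigO_const_const _ one_ne_zero _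
  have h := (h1.mul (exp_expansion (crossMatrix ω))).mul h2
  simp only [one_mul, mul_one] at h
  refine h.congr_left fun t => ?_
  have e : crossMatrix (bodyCoord X ω) * crossMatrix (bodyCoord X ω) =
      X.1ᵀ * (crossMatrix ω * crossMatrix ω) * X.1 := by
    rw [crossMatrix_bodyCoord]
    calc _ = X.1ᵀ * crossMatrix ω * (X.1 * X.1ᵀ) * crossMatrix ω * X.1 := by simp only [mul_assoc]
      _ = _ := by rw [mul_transpose_self, mul_one]; simp only [mul_assoc]
  simp only [crossMatrix_smul, smul_mul_assoc, mul_smul_comm, e]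
  rw [crossMatrix_bodyCoord]
  simp only [rot, crossMatrix_smul, mul_sub, sub_mul, mul_one, smul_mul_assoc, mul_smul_comm,
    transpose_mul_self]

theorem edgeGap_exp_expansion (l : Fin 6 → E3) (k : Fin 4) (i : Fin 6) :
    (fun t : ℝ =>
      gap ((rot (t • l i) * frame i)⁻¹ * (rot (t • l (nbr k i)) * frame (nbr k i))).1 -
      gap (relMat k) - t * gapLin (relMat k) (bodyTuple l i) (bodyTuple l (nbr k i)) -
      t ^ 2 * gapQuad (relMat k) (bodyTuple l i) (bodyTuple l (nbr k i))) =O[𝓝 0]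
      fun t => t ^ 3 := by
  have hb : ∀ a : E3, (fun t : ℝ => t • a) =O[𝓝 0] fun t : ℝ => t := fun a =>
    IsBigO.of_bound ‖a‖ (Eventually.of_forall fun t => by rw [norm_smul, mul_comm])
  have h := gap_expansion (relMat k) (tendsto_id (x := 𝓝 (0 : ℝ))) (hb (bodyTuple l i))
    (hb (bodyTuple l (nbr k i))) (body_exp_expansion (frame i) (l i))
    (body_exp_expansion (frame (nbr k i)) (l (nbr k i)))
  refine h.congr_left fun t => ?_
  rw [gapLin_smul, gapQuad_smul]
  have e : ((rot (t • l i) * frame i)⁻¹ * (rot (t • l (nbr k i)) * frame (nbr k i))).1 =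
      ((frame i).1ᵀ * (rot (t • l i)).1 * (frame i).1)ᵀ * relMat k *
        ((frame (nbr k i)).1ᵀ * (rot (t • l (nbr k i))).1 * (frame (nbr k i)).1) := by
    change ((rot (t • l i)).1 * (frame i).1)ᵀ *
      ((rot (t • l (nbr k i))).1 * (frame (nbr k i)).1) = _
    rw [← frame_relation k i]
    simp only [Matrix.transpose_mul, Matrix.transpose_transpose]
    calc _ = (frame i).1ᵀ * (rot (t • l i)).1ᵀ * 1 * 1 *
          ((rot (t • l (nbr k i))).1 * (frame (nbr k i)).1) := by simp only [mul_one]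
      _ = (frame i).1ᵀ * (rot (t • l i)).1ᵀ * ((frame i).1 * (frame i).1ᵀ) *
          ((frame (nbr k i)).1 * (frame (nbr k i)).1ᵀ) *
          ((rot (t • l (nbr k i))).1 * (frame (nbr k i)).1) := by
            simp only [mul_transpose_self]
      _ = _ := by simp only [mul_assoc]
  rw [e]

theorem edgeGap_expansion {α : Type*} {L : Filter α} {B : α → Fin 6 → SO3}
    (h1 : ∀ i, Tendsto (fun x => (B x i).1) L (𝓝 1)) (k : Fin 3) (i : Fin 6) :
    (fun x => gap ((B x i).1ᵀ * relMat k.castSucc * (B x (nbr k.castSucc i)).1) -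
      edgeLin (fun i => skewPart (B x i).1) k i - edgeQuad (fun i => skewPart (B x i).1) k i) =O[L]
      fun x => ‖fun i => skewPart (B x i).1‖ ^ 3 := by
  have hle : ∀ (x : α) (i : Fin 6),
      ‖skewPart (B x i).1‖ ≤ ‖fun i => skewPart (B x i).1‖ := fun x i =>
    norm_le_pi_norm (fun i => skewPart (B x i).1) i
  have hr : Tendsto (fun x => ‖fun i => skewPart (B x i).1‖) L (𝓝 0) := by
    have hs : skewPart 1 = 0 := by
      ext j
      fin_cases j <;> simp [skewPart]
    have ht : Tendsto (fun x => fun i => skewPart (B x i).1) L (𝓝 fun _ => skewPart 1) :=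
      tendsto_pi_nhds.2 fun i => (continuous_skewPart.tendsto 1).comp (h1 i)
    have := ht.norm
    rw [hs] at this
    rwa [show ‖fun _ : Fin 6 => (0 : E3)‖ = 0 from norm_zero] at this
  have ha : ∀ i, (fun x => skewPart (B x i).1) =O[L] fun x => ‖fun i => skewPart (B x i).1‖ :=
    fun i => IsBigO.of_bound 1 (Eventually.of_forall fun x => by simpa using hle x i)
  have hB : ∀ i, (fun x => (B x i).1 - 1 - crossMatrix (skewPart (B x i).1) - (1 / 2 : ℝ) •
      (crossMatrix (skewPart (B x i).1) * crossMatrix (skewPart (B x i).1))) =O[L]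
      fun x => ‖fun i => skewPart (B x i).1‖ ^ 3 := fun i =>
    (orthogonal_expansion (h1 i) fun x => transpose_mul_self (B x i)).trans
      (IsBigO.of_bound 1 (Eventually.of_forall fun x => by
        rw [one_mul, norm_pow, norm_pow, norm_norm, norm_norm]
        exact pow_le_pow_left₀ (norm_nonneg _) (hle x i) 3))
  refine (gap_expansion (relMat k.castSucc) hr (ha i) (ha (nbr k.castSucc i)) (hB i)
    (hB (nbr k.castSucc i))).congr_left fun x => ?_
  rw [gap_relMat, sub_zero]
  rfl

theorem eventually_eq_one_of_skewPart {α : Type*} {L : Filter α} {R : α → SO3}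
    (h1 : Tendsto (fun x => (R x).1) L (𝓝 1)) :
    ∀ᶠ x in L, skewPart (R x).1 = 0 → R x = 1 := by
  obtain ⟨C, hC⟩ := (orthogonal_expansion h1 fun x => transpose_mul_self (R x)).bound
  filter_upwards [hC] with x hx h0
  have hz : crossMatrix 0 = 0 := by
    ext i j
    fin_cases i <;> fin_cases j <;> simp [crossMatrix]
  rw [h0, hz] at hx
  simp only [sub_zero, mul_zero, smul_zero, norm_zero, ne_eq, OfNat.ofNat_ne_zero,
    not_false_eq_true, zero_pow, norm_le_zero_iff, sub_eq_zero] at hx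
  exact Subtype.ext hx

end

/-! ### Rigidity of the contact inequalities -/

open Asymptotics in
/-- A small perturbation `B i` (in body coordinates) of the frames that fixes the line `0` and makes
no contact gap negative is trivial. Otherwise the rescaled perturbations converge along an
ultrafilter at a unit vector `s`. To first order, the gaps of `s` are nonnegative, hence zero by the
equilibrium condition; to second order, the Lagrangian of `s` is nonnegative, since the first order
terms cancel in the weighted sum. So `s = 0` by definiteness. -/
theorem local_rigidity {α : Type*} {L : Filter α} {B : α → Fin 6 → SO3}
    (h1 : ∀ i, Tendsto (fun x => (B x i).1) L (𝓝 1)) (h0 : ∀ x, B x 0 = 1) :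
    ∀ᶠ x in L, (∀ k i,
      0 ≤ gap ((B x i).1ᵀ * relMat (Fin.castSucc k) * (B x (nbr (Fin.castSucc k) i)).1)) →
      ∀ i, B x i = 1 := by
  by_contra hcon
  rw [not_eventually, frequently_iff_neBot] at hcon
  set bad : Set α := {x | ¬((∀ k i,
      0 ≤ gap ((B x i).1ᵀ * relMat (Fin.castSucc k) * (B x (nbr (Fin.castSucc k) i)).1)) →
      ∀ i, B x i = 1)} with hbad
  let U : Ultrafilter α := Ultrafilter.of (L ⊓ 𝓟 bad)
  have hUL : (U : Filter α) ≤ L := (Ultrafilter.of_le _).trans inf_le_left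
  have hUb : ∀ᶠ x in (U : Filter α), x ∈ bad :=
    ((Ultrafilter.of_le _).trans inf_le_right) (mem_principal_self bad)
  have h1U : ∀ i, Tendsto (fun x => (B x i).1) U (𝓝 1) := fun i => (h1 i).mono_left hUL
  set a : α → Fin 6 → E3 := fun x i => skewPart (B x i).1 with ha
  set r : α → ℝ := fun x => ‖a x‖ with hr
  have hskew1 : skewPart 1 = 0 := by
    ext j
    fin_cases j <;> simp [skewPart]
  have hrpos : ∀ᶠ x in (U : Filter α), 0 < r x := by
    have hall : ∀ᶠ x in (U : Filter α), ∀ i, skewPart (B x i).1 = 0 → B x i = 1 :=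
      eventually_all.2 fun i => eventually_eq_one_of_skewPart (h1U i)
    filter_upwards [hall, hUb] with x hx hb
    refine norm_pos_iff.2 fun hz => hb fun _ i => hx i (congrFun hz i)
  have hr0 : Tendsto r U (𝓝 0) := by
    have ht : Tendsto a U (𝓝 fun _ => skewPart 1) :=
      tendsto_pi_nhds.2 fun i => (continuous_skewPart.tendsto 1).comp (h1U i)
    have := ht.norm
    rw [hskew1] at this
    rwa [show ‖fun _ : Fin 6 => (0 : E3)‖ = 0 from norm_zero] at this
  have hS : IsCompact (Metric.sphere (0 : Fin 6 → E3) 1 ∩ {b | b 0 = 0}) :=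
    (isCompact_sphere 0 1).inter_right (isClosed_singleton.preimage (continuous_apply 0))
  set b : α → Fin 6 → E3 := fun x => (r x)⁻¹ • a x with hb
  obtain ⟨s, ⟨hs1, hs0⟩, hs⟩ := hS.ultrafilter_le_nhds (U.map b) (by
    rw [Ultrafilter.coe_map, le_principal_iff, mem_map]
    filter_upwards [hrpos] with x hx
    refine ⟨?_, ?_⟩
    · rw [mem_sphere_zero_iff_norm, hb, norm_smul, norm_inv, norm_norm]
      exact inv_mul_cancel₀ hx.ne'
    · change (r x)⁻¹ • skewPart (B x 0).1 = 0
      rw [h0 x, Submonoid.coe_one, hskew1, smul_zero])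
  have hbs : Tendsto b U (𝓝 s) := hs
  have hab : ∀ᶠ x in (U : Filter α), a x = r x • b x := by
    filter_upwards [hrpos] with x hx
    rw [hb, smul_smul, mul_inv_cancel₀ hx.ne', one_smul]
  -- the gaps, and the remainders of their second order expansions
  set g : Fin 3 → Fin 6 → α → ℝ := fun k i x =>
    gap ((B x i).1ᵀ * relMat k.castSucc * (B x (nbr k.castSucc i)).1) with hg
  set e : Fin 3 → Fin 6 → α → ℝ := fun k i x =>
    g k i x - edgeLin (a x) k i - edgeQuad (a x) k i with he
  have hE : ∀ k i, e k i =O[U] fun x => r x ^ 3 := fun k i => edgeGap_expansion h1U k i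
  have hE2 : ∀ k i, Tendsto (fun x => e k i x / r x ^ 2) U (𝓝 0) := by
    intro k i
    refine ((hE k i).trans_isLittleO ?_).tendsto_div_nhds_zero
    have := (isBigO_refl (fun x => r x ^ 2) (U : Filter α)).mul_isLittleO
      ((isLittleO_one_iff ℝ).2 hr0)
    exact (this.congr_left fun x => by ring).congr_right fun x => mul_one _
  have hE1 : ∀ k i, Tendsto (fun x => e k i x / r x) U (𝓝 0) := by
    intro k i
    have := (hE2 k i).mul hr0
    rw [zero_mul] at this
    refine this.congr' ?_
    filter_upwards [hrpos] with x hx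
    field_simp
  have hg0 : ∀ᶠ x in (U : Filter α), ∀ k i, 0 ≤ g k i x := by
    filter_upwards [hUb] with x hx
    exact (Classical.not_imp.1 hx).1
  have hLs : ∀ k i, 0 ≤ edgeLin s k i := by
    intro k i
    have hlim : Tendsto (fun x => edgeLin (b x) k i + r x * edgeQuad (b x) k i + e k i x / r x) U
        (𝓝 (edgeLin s k i + 0 * edgeQuad s k i + 0)) :=
      ((((continuous_edgeLin k i).tendsto s).comp hbs).add
        (hr0.mul (((continuous_edgeQuad k i).tendsto s).comp hbs))).add (hE1 k i)
    rw [zero_mul, add_zero, add_zero] at hlim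
    refine ge_of_tendsto hlim ?_
    filter_upwards [hg0, hrpos, hab] with x hx hrx habx
    have h2 : e k i x = g k i x - r x * edgeLin (b x) k i - r x ^ 2 * edgeQuad (b x) k i := by
      rw [he, ← edgeLin_smul, ← edgeQuad_smul, ← habx]
    have : edgeLin (b x) k i + r x * edgeQuad (b x) k i + e k i x / r x = g k i x / r x := by
      rw [h2]
      field_simp
      ring
    rw [this]
    exact div_nonneg (hx k i) hrx.le
  have hQs : 0 ≤ lagrangian s := by
    have hlim : Tendsto (fun x => lagrangian (b x) + ∑ k, ∑ i, mult k * (e k i x / r x ^ 2)) U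
        (𝓝 (lagrangian s + ∑ k, ∑ i : Fin 6, mult k * 0)) :=
      ((continuous_lagrangian.tendsto s).comp hbs).add
        (tendsto_finsetSum _ fun k _ => tendsto_finsetSum _ fun i _ => (hE2 k i).const_mul _)
    simp only [mul_zero, Finset.sum_const_zero, add_zero] at hlim
    refine ge_of_tendsto hlim ?_
    filter_upwards [hg0, hrpos, hab] with x hx hrx habx
    have h3 : lagrangian (b x) + ∑ k, ∑ i, mult k * (e k i x / r x ^ 2) =
        ∑ k, ∑ i, mult k * (g k i x / r x ^ 2) := by
      have h4 : (r x)⁻¹ * ∑ k, ∑ i, mult k * edgeLin (b x) k i = 0 := by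
        rw [sum_mult_edgeLin, mul_zero]
      rw [lagrangian, ← add_zero (∑ k, ∑ i, mult k * edgeQuad (b x) k i), ← h4, Finset.mul_sum,
        ← Finset.sum_add_distrib, ← Finset.sum_add_distrib]
      refine Finset.sum_congr rfl fun k _ => ?_
      rw [Finset.mul_sum, ← Finset.sum_add_distrib, ← Finset.sum_add_distrib]
      refine Finset.sum_congr rfl fun i _ => ?_
      have h2 : e k i x = g k i x - r x * edgeLin (b x) k i - r x ^ 2 * edgeQuad (b x) k i := by
        rw [he, ← edgeLin_smul, ← edgeQuad_smul, ← habx]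
      rw [h2]
      field_simp
      ring
    rw [h3]
    exact Finset.sum_nonneg fun k _ => Finset.sum_nonneg fun i _ =>
      mul_nonneg (mult_pos k).le (div_nonneg (hx k i) (sq_nonneg _))
  have hLz : ∀ k i, edgeLin s k i = 0 := by
    have h5 := sum_mult_edgeLin s
    rw [Finset.sum_eq_zero_iff_of_nonneg fun k _ => Finset.sum_nonneg fun i _ =>
      mul_nonneg (mult_pos k).le (hLs k i)] at h5
    intro k i
    have h6 := h5 k (Finset.mem_univ k)
    rw [Finset.sum_eq_zero_iff_of_nonneg fun i _ => mul_nonneg (mult_pos k).le (hLs k i)] at h6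
    exact (mul_eq_zero.1 (h6 i (Finset.mem_univ i))).resolve_left (mult_pos k).ne'
  have hs' := eq_zero_of_lagrangian_eq_zero hLz hs0 (le_antisymm (lagrangian_nonpos hLz) hQs)
  rw [hs', mem_sphere_zero_iff_norm, norm_zero] at hs1
  exact zero_ne_one hs1

theorem relMat_eq (k : Fin 4) (i : Fin 6) :
    relMat k = ((frame i)⁻¹ * frame (nbr k i)).1 := (frame_relation k i).symm

/-- The perturbation is normalized by the rotation `X 0 (frame 0)⁻¹` before applying
`local_rigidity`. -/
theorem rigidity_of_tendsto {α : Type*} {L : Filter α} {X : α → Fin 6 → SO3}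
    (h1 : ∀ i, Tendsto (fun x => ((frame i)⁻¹ * (X x 0 * (frame 0)⁻¹)⁻¹ * X x i).1) L (𝓝 1)) :
    ∀ᶠ x in L, (∀ k i, 0 ≤ gap ((X x i)⁻¹ * X x (nbr (Fin.castSucc k) i)).1) →
      ∀ i, X x i = X x 0 * (frame 0)⁻¹ * frame i := by
  have h := local_rigidity (B := fun x i => (frame i)⁻¹ * (X x 0 * (frame 0)⁻¹)⁻¹ * X x i) h1
    (fun x => by group)
  filter_upwards [h] with x hx hg i
  have := hx (fun k i => by
    refine (hg k i).trans_eq ?_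
    rw [relMat_eq _ i]
    congr 1
    refine congrArg Subtype.val (?_ : _ = ((frame i)⁻¹ * (X x 0 * (frame 0)⁻¹)⁻¹ * X x i)⁻¹ *
      ((frame i)⁻¹ * frame (nbr k.castSucc i)) * ((frame (nbr k.castSucc i))⁻¹ *
      (X x 0 * (frame 0)⁻¹)⁻¹ * X x (nbr k.castSucc i)))
    group) i
  rw [mul_assoc, inv_mul_eq_iff_eq_mul, mul_one, inv_mul_eq_iff_eq_mul] at this
  exact this

/-- The least gap is at most the weighted mean of the gaps of the contacts. -/
theorem minDist_le_of_sum_le {X : Fin 6 → SO3} {ε : ℝ}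
    (hc : ∀ k i, ((X i)⁻¹ * X (nbr k i)).1 1 1 ^ 2 < 1) (hε : 0 ≤ ε)
    (hs : ∑ k : Fin 3, ∑ i, mult k * gap ((X i)⁻¹ * X (nbr k.castSucc i)).1 ≤
      -ε * ∑ k : Fin 3, ∑ _i : Fin 6, mult k) :
    minDist (fun i => lineOf (X i)) ≤ √(12 / 11) - ε / 4 := by
  obtain ⟨k, i, h⟩ : ∃ (k : Fin 3) (i : Fin 6),
      gap ((X i)⁻¹ * X (nbr k.castSucc i)).1 ≤ -ε := by
    by_contra! hlt
    refine absurd hs (not_le.2 ?_)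
    rw [Finset.mul_sum]
    refine Finset.sum_lt_sum_of_nonempty Finset.univ_nonempty fun k _ => ?_
    rw [Finset.mul_sum]
    refine Finset.sum_lt_sum_of_nonempty Finset.univ_nonempty fun i _ => ?_
    rw [mul_comm]
    exact mul_lt_mul_of_pos_left (hlt k i) (mult_pos k)
  exact (minDist_le _ (nbr_ne k.castSucc i).symm).trans (lineDist_le_of_gap_le (hc _ _) hε h)

theorem le_minDist_of_le_gap {X : Fin 6 → SO3} {ε : ℝ}
    (hc : ∀ k i, ((X i)⁻¹ * X (nbr k i)).1 1 1 ^ 2 < 3 / 4) (hε : 0 ≤ ε)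
    (hg : ∀ k i, -ε ≤ gap ((X i)⁻¹ * X (nbr k i)).1) :
    √(12 / 11) - 4 * ε ≤ minDist (fun i => lineOf (X i)) :=
  le_minDist fun k i => le_lineDist_of_le_gap (hc k i) hε (hg k i)

theorem Cm_eq_lineOf : Cm = fun i => lineOf (frame i) := funext Cm_eq

theorem minDist_Cm : minDist Cm = √(12 / 11) := by
  rw [Cm_eq_lineOf]
  have hc : ∀ k i, ((frame i)⁻¹ * frame (nbr k i)).1 1 1 ^ 2 < 3 / 4 := fun k i => by
    rw [← relMat_eq]
    exact relMat_direction k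
  refine le_antisymm ?_ ?_
  · have := minDist_le_of_sum_le (X := frame) (ε := 0)
      (fun k i => (hc k i).trans (by norm_num)) le_rfl (by
        rw [neg_zero, zero_mul]
        exact (Finset.sum_eq_zero fun k _ => Finset.sum_eq_zero fun i _ => by
          rw [← relMat_eq, gap_relMat, mul_zero]).le)
    linarith
  · have := le_minDist_of_le_gap (X := frame) (ε := 0) hc le_rfl (fun k i => by
      rw [← relMat_eq, neg_zero]
      induction k using Fin.lastCases with
      | last => exact (by norm_num : (0 : ℝ) ≤ 18 / 11).trans_eq gap_relMat_three.symm
      | cast k => exact (gap_relMat k).ge)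
    linarith

/-! ### Frames as local coordinates, and the strict local maximum -/

/-- The frame `(x, ξ, x × ξ)` of a unit tangent vector. -/
def frameMat (p : UnitTangent) : Mat3 :=
  !![p.1.1 0, p.1.2 0, p.1.1 1 * p.1.2 2 - p.1.1 2 * p.1.2 1;
    p.1.1 1, p.1.2 1, p.1.1 2 * p.1.2 0 - p.1.1 0 * p.1.2 2;
    p.1.1 2, p.1.2 2, p.1.1 0 * p.1.2 1 - p.1.1 1 * p.1.2 0]

theorem frameMat_mem (p : UnitTangent) :
    frameMat p ∈ Matrix.specialOrthogonalGroup (Fin 3) ℝ := by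
  obtain ⟨⟨x, ξ⟩, h1, h2, h3⟩ := p
  simp only at h1 h2 h3
  have e1 : x 0 ^ 2 + x 1 ^ 2 + x 2 ^ 2 = 1 := by
    have := EuclideanSpace.real_norm_sq_eq x
    rw [h1, Fin.sum_univ_three] at this
    linarith
  have e2 : ξ 0 ^ 2 + ξ 1 ^ 2 + ξ 2 ^ 2 = 1 := by
    have := EuclideanSpace.real_norm_sq_eq ξ
    rw [h2, Fin.sum_univ_three] at this
    linarith
  have e3 : x 0 * ξ 0 + x 1 * ξ 1 + x 2 * ξ 2 = 0 := by
    rw [← h3]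
    simp [PiLp.inner_apply, Fin.sum_univ_three, mul_comm]
  have e4 : (x 1 * ξ 2 - x 2 * ξ 1) ^ 2 + (x 2 * ξ 0 - x 0 * ξ 2) ^ 2 +
      (x 0 * ξ 1 - x 1 * ξ 0) ^ 2 = 1 := by
    linear_combination (ξ 0 ^ 2 + ξ 1 ^ 2 + ξ 2 ^ 2) * e1 + e2 -
      (x 0 * ξ 0 + x 1 * ξ 1 + x 2 * ξ 2) * e3
  refine mem_SO3 ?_ ?_
  · ext i j
    fin_cases i <;> fin_cases j <;>
      simp [frameMat, Matrix.mul_apply, Fin.sum_univ_three]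
    · linear_combination e1
    · linear_combination e3
    · ring
    · linear_combination e3
    · linear_combination e2
    · ring
    · ring
    · ring
    · linear_combination e4
  · rw [Matrix.det_fin_three]
    simp [frameMat]
    linear_combination e4

/-- `frameMat` as an element of `SO(3)`; a continuous inverse of `tangentOf`. -/
def frameOf (p : UnitTangent) : SO3 := ⟨frameMat p, frameMat_mem p⟩

theorem continuous_frameOf : Continuous frameOf := by
  refine Continuous.subtype_mk ?_ _
  unfold frameMat
  fun_prop

theorem lineOf_frameOf (p : UnitTangent) : lineOf (frameOf p) = Quotient.mk lineSetoid p := by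
  refine congrArg (Quotient.mk lineSetoid) (Subtype.ext (Prod.ext ?_ ?_)) <;>
    ext i <;> fin_cases i <;> simp [tangentOf, col, frameOf, frameMat]

theorem frameOf_tangentOf (X : SO3) : frameOf (tangentOf X) = X := by
  obtain ⟨c0, c1, c2⟩ := third_column X
  apply Subtype.ext
  ext i j
  fin_cases i <;> fin_cases j <;> simp [frameOf, frameMat, tangentOf, col, c0, c1, c2]

theorem isOpenMap_mk : IsOpenMap (Quotient.mk lineSetoid) := by
  intro U hU
  let σ : UnitTangent → UnitTangent := fun p => ⟨(p.1.1, -p.1.2), p.2.1, by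
    rw [norm_neg]; exact p.2.2.1, by rw [inner_neg_right, p.2.2.2, neg_zero]⟩
  have hσ : Continuous σ := by
    refine Continuous.subtype_mk ?_ _
    fun_prop
  have e : Quotient.mk lineSetoid ⁻¹' (Quotient.mk lineSetoid '' U) = U ∪ σ ⁻¹' U := by
    ext p
    constructor
    · rintro ⟨q, hq, hqp⟩
      obtain ⟨h1, h2 | h2⟩ := Quotient.exact hqp
      · left
        rwa [← show q = p from Subtype.ext (Prod.ext h1 h2)]
      · right
        rwa [mem_preimage, ← show q = σ p from Subtype.ext (Prod.ext h1 h2)]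
    · rintro (hp | hp)
      · exact ⟨p, hp, rfl⟩
      · exact ⟨σ p, hp, Quotient.sound ⟨rfl, Or.inr rfl⟩⟩
  refine isOpen_coinduced.2 (?_ : IsOpen (Quotient.mk lineSetoid ⁻¹' (Quotient.mk lineSetoid '' U)))
  rw [e]
  exact hU.union (hU.preimage hσ)

theorem continuous_inv_SO3 : Continuous fun X : SO3 => X⁻¹ := by
  refine Continuous.subtype_mk (f := fun X : SO3 => X.1ᵀ) ?_ _
  fun_prop

theorem continuous_entry (i j : Fin 3) : Continuous fun X : SO3 => X.1 i j :=
  Continuous.matrix_elem continuous_subtype_val i j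

theorem tendsto_relative {α : Type*} {L : Filter α} {X Y : α → SO3} {A B : SO3}
    (hX : Tendsto X L (𝓝 A)) (hY : Tendsto Y L (𝓝 B)) :
    Tendsto (fun x => (X x)⁻¹ * Y x) L (𝓝 (A⁻¹ * B)) :=
  ((continuous_inv_SO3.tendsto A).comp hX).mul hY

theorem eventually_direction_lt {α : Type*} {L : Filter α} {X : α → Fin 6 → SO3}
    (hX : ∀ i, Tendsto (fun x => X x i) L (𝓝 (frame i))) :
    ∀ᶠ x in L, ∀ k i, ((X x i)⁻¹ * X x (nbr k i)).1 1 1 ^ 2 < 3 / 4 := by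
  refine eventually_all.2 fun k => eventually_all.2 fun i => ?_
  have h := (((continuous_entry 1 1).tendsto _).comp
    (tendsto_relative (hX i) (hX (nbr k i)))).pow 2
  refine h.eventually_lt_const ?_
  rw [← relMat_eq]
  exact relMat_direction k

theorem tendsto_normalized {α : Type*} {L : Filter α} {X : α → Fin 6 → SO3} {Y : Fin 6 → SO3}
    (hX : ∀ i, Tendsto (fun x => X x i) L (𝓝 (Y i)))
    (hY : ∀ i, Y i = Y 0 * (frame 0)⁻¹ * frame i) (i : Fin 6) :
    Tendsto (fun x => ((frame i)⁻¹ * (X x 0 * (frame 0)⁻¹)⁻¹ * X x i).1) L (𝓝 1) := by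
  have h : Tendsto (fun x => (frame i)⁻¹ * (X x 0 * (frame 0)⁻¹)⁻¹ * X x i) L
      (𝓝 ((frame i)⁻¹ * (Y 0 * (frame 0)⁻¹)⁻¹ * Y i)) :=
    (((continuous_inv_SO3.tendsto _).comp ((hX 0).mul_const (frame 0)⁻¹)).const_mul
      (frame i)⁻¹).mul (hX i)
  rw [hY i, show (frame i)⁻¹ * (Y 0 * (frame 0)⁻¹)⁻¹ * (Y 0 * (frame 0)⁻¹ * frame i) = 1 by
    group] at h
  exact (continuous_subtype_val.tendsto _).comp h

/-- Near a rotated copy of the record configuration, only its rotated copies have minimal distance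
at least `√(12 / 11)`. -/
theorem eventually_eq_of_le_minDist {α : Type*} {L : Filter α} {X : α → Fin 6 → SO3}
    {Y : Fin 6 → SO3} (hX : ∀ i, Tendsto (fun x => X x i) L (𝓝 (Y i)))
    (hY : ∀ i, Y i = Y 0 * (frame 0)⁻¹ * frame i) :
    ∀ᶠ x in L, √(12 / 11) ≤ minDist (fun i => lineOf (X x i)) →
      ∀ i, X x i = X x 0 * (frame 0)⁻¹ * frame i := by
  have hc := eventually_direction_lt (X := fun x i => (Y 0 * (frame 0)⁻¹)⁻¹ * X x i) (L := L)
    fun i => by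
      have := (hX i).const_mul (Y 0 * (frame 0)⁻¹)⁻¹
      rwa [hY i, inv_mul_cancel_left] at this
  filter_upwards [rigidity_of_tendsto (tendsto_normalized hX hY), hc] with x hx hc hge
  have hd : ∀ i j, i ≠ j → √(12 / 11) ≤ lineDist (lineOf (X x i)) (lineOf (X x j)) :=
    fun i j hij => hge.trans (minDist_le _ hij)
  refine hx fun k i => gap_nonneg_of_le_lineDist ?_ (hd _ _ (nbr_ne k.castSucc i).symm)
  have h := hc k.castSucc i
  rw [show ((Y 0 * (frame 0)⁻¹)⁻¹ * X x i)⁻¹ * ((Y 0 * (frame 0)⁻¹)⁻¹ * X x (nbr k.castSucc i)) =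
    (X x i)⁻¹ * X x (nbr k.castSucc i) by group] at h
  exact h.trans (by norm_num)

/-- Neighbourhoods of the record configuration in the quotient are images of neighbourhoods of
oriented configurations. -/
theorem nhds_Cm_le : 𝓝 Cm ≤ map (fun (p : Fin 6 → UnitTangent) i => Quotient.mk lineSetoid (p i))
    (𝓝 fun i => tangentOf (frame i)) := by
  have hopen : IsOpenMap (fun (p : Fin 6 → UnitTangent) i => Quotient.mk lineSetoid (p i)) :=
    IsOpenMap.piMap (fun _ => isOpenMap_mk) (Filter.Eventually.of_forall fun _ =>
      Quotient.mk_surjective)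
  have hle := hopen.nhds_le (fun i => tangentOf (frame i))
  rw [Cm_eq_lineOf]
  exact hle

theorem eventually_minDist_lt : ∀ᶠ m in 𝓝 Cm,
    (∀ R : SO3, m ≠ fun i => rotateLine R (Cm i)) → minDist m < √(12 / 11) := by
  -- the frames of oriented configurations are continuous, so rigidity applies upstairs
  refine nhds_Cm_le (mem_map.2 ?_)
  have hX : ∀ i, Tendsto (fun p : Fin 6 → UnitTangent => frameOf (p i))
      (𝓝 fun i => tangentOf (frame i)) (𝓝 (frame i)) := by
    intro i
    have := ((continuous_frameOf.comp (continuous_apply i)).tendsto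
      (fun i : Fin 6 => tangentOf (frame i)))
    rwa [Function.comp_apply, frameOf_tangentOf] at this
  have h := eventually_eq_of_le_minDist (X := fun (p : Fin 6 → UnitTangent) i => frameOf (p i)) hX
    fun i => by group
  refine h.mono fun p hp hne => ?_
  by_contra! hge
  have e : (fun i => Quotient.mk lineSetoid (p i)) = fun i => lineOf (frameOf (p i)) :=
    funext fun i => (lineOf_frameOf (p i)).symm
  rw [e] at hge
  refine hne (frameOf (p 0) * (frame 0)⁻¹) (e.trans (funext fun i => ?_))
  rw [Cm_eq, rotateLine_lineOf, ← hp hge i]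

/-! ### The tangent space modulo rotations -/

theorem expMap_Cm (l : TM6) (t : ℝ) :
    expMap Cm (t • l) = fun i => lineOf (rot (t • l i) * frame i) := by
  funext i
  rw [expMap, Cm_eq, rotateLine_lineOf]
  rfl

section

attribute [local instance] Matrix.linftyOpNormedRing Matrix.linftyOpNormedAlgebra

theorem continuous_exp_mat : Continuous fun A : Mat3 => NormedSpace.exp A :=
  NormedSpace.exp_continuous

end

theorem rot_zero : rot 0 = 1 := by
  apply Subtype.ext
  change NormedSpace.exp (crossMatrix 0) = 1
  have hz : crossMatrix 0 = 0 := by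
    ext i j
    fin_cases i <;> fin_cases j <;> simp [crossMatrix]
  rw [hz]
  exact NormedSpace.exp_zero

theorem tendsto_rot (ω : E3) (X : SO3) :
    Tendsto (fun t : ℝ => rot (t • ω) * X) (𝓝 0) (𝓝 X) := by
  have hc : Continuous fun t : ℝ => rot (t • ω) := by
    refine Continuous.subtype_mk (f := fun t : ℝ => NormedSpace.exp (crossMatrix (t • ω))) ?_ _
    exact continuous_exp_mat.comp (continuous_crossMatrix.comp (by fun_prop))
  have := (hc.tendsto 0).mul_const X
  rwa [zero_smul, rot_zero, one_mul] at this

/-- The linearized gaps of the contacts as a linear map on the tangent space of `M⁶`. -/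
noncomputable def gapDifferential : TM6 →ₗ[ℝ] (Fin 3 → Fin 6 → ℝ) where
  toFun l := edgeLin (bodyTuple l)
  map_add' l m := by
    funext k i
    have : bodyTuple (l + m : TM6) = bodyTuple l + bodyTuple m := by
      funext i
      simp [bodyTuple, bodyCoord, Matrix.mulVec_add]
    rw [this]
    exact edgeLin_add _ _ _ _
  map_smul' c l := by
    funext k i
    have : bodyTuple (c • l : TM6) = c • bodyTuple l := by
      funext i
      simp [bodyTuple, bodyCoord, Matrix.mulVec_smul]
    rw [this]
    exact edgeLin_smul _ _ _ _

theorem mem_ker_gapDifferential {l : TM6} :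
    l ∈ gapDifferential.ker ↔ ∀ k i, edgeLin (bodyTuple l) k i = 0 := by
  rw [LinearMap.mem_ker]
  exact ⟨fun h k i => congrFun (congrFun h k) i, fun h => funext fun k => funext fun i => h k i⟩

theorem rotDirections_le : rotDirections ≤ gapDifferential.ker := by
  intro l hl
  rw [mem_ker_gapDifferential]
  have : (l : Fin 6 → E3) = fun _ => l 0 := funext fun i => hl i 0
  rw [show bodyTuple l = bodyTuple fun _ => l 0 from congrArg bodyTuple this]
  exact edgeLin_rotation (l 0)

/-- As the kernel contains the rotations, it is the full preimage of its image modulo them. -/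
theorem mkQ_mem_iff (l : TM6) :
    rotDirections.mkQ l ∈ gapDifferential.ker.map rotDirections.mkQ ↔
      ∀ k i, edgeLin (bodyTuple l) k i = 0 := by
  rw [← Submodule.mem_comap, Submodule.comap_map_mkQ, sup_eq_right.2 rotDirections_le,
    mem_ker_gapDifferential]

theorem bodyVec_add (f h u f' h' u' : ℝ) :
    bodyVec (f + f') (h + h') (u + u') = bodyVec f h u + bodyVec f' h' u' := by
  ext i
  fin_cases i <;> simp [bodyVec, scaledVec] <;> ring

theorem bodyVec_smul (c f h u : ℝ) : bodyVec (c * f) (c * h) (c * u) = c • bodyVec f h u := by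
  ext i
  fin_cases i <;> simp [bodyVec, scaledVec] <;> ring

theorem rotateVec_add (R : SO3) (v w : E3) :
    rotateVec R (v + w) = rotateVec R v + rotateVec R w := by
  simp [rotateVec, Matrix.mulVec_add]

theorem rotateVec_smul (R : SO3) (c : ℝ) (v : E3) : rotateVec R (c • v) = c • rotateVec R v := by
  simp [rotateVec, Matrix.mulVec_smul]

/-- The parametrization of the tangent vectors in the kernel of the linearized contacts by the seven
parameters of `kernelVec`. -/
noncomputable def kernelParam : (Fin 6 → ℝ) × ℝ →ₗ[ℝ] TM6 where
  toFun p := WithLp.toLp 2 fun i => rotateVec (frame i) (kernelVec p.1 p.2 i)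
  map_add' p q := by
    ext1 i
    have : kernelVec (p + q).1 (p + q).2 = kernelVec p.1 p.2 + kernelVec q.1 q.2 := by
      funext i
      fin_cases i <;> simp [kernelVec, ← bodyVec_add] <;> congr 1 <;> ring
    simp only [this, Pi.add_apply, rotateVec_add, PiLp.add_apply]
  map_smul' c p := by
    ext1 i
    have : kernelVec (c • p).1 (c • p).2 = c • kernelVec p.1 p.2 := by
      funext i
      fin_cases i <;> simp [kernelVec, ← bodyVec_smul] <;> congr 1 <;> ring
    simp only [this, Pi.smul_apply, rotateVec_smul, PiLp.smul_apply, RingHom.id_apply]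

theorem bodyTuple_kernelParam (p : (Fin 6 → ℝ) × ℝ) :
    bodyTuple (kernelParam p) = kernelVec p.1 p.2 :=
  funext fun i => bodyCoord_rotateVec (frame i) (kernelVec p.1 p.2 i)

theorem kernelParam_injective : Function.Injective kernelParam := by
  rw [← LinearMap.ker_eq_bot, LinearMap.ker_eq_bot']
  intro p hp
  have h : kernelVec p.1 p.2 = fun _ => 0 := by
    rw [← bodyTuple_kernelParam, hp]
    funext i
    simp [bodyTuple, bodyCoord]
  have hf : ∀ i, p.1 i = 0 := by
    intro i
    have h1 := congrArg fCoord (congrFun h i)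
    rw [← bodyVec_zero, kernelVec_eq, fCoord_bodyVec, fCoord_bodyVec] at h1
    exact h1
  have hu := congrArg uCoord (congrFun h 0)
  rw [← bodyVec_zero, kernelVec_eq, uCoord_bodyVec, uCoord_bodyVec] at hu
  have hu' : (3 + √5) / 8 * (p.2 - p.1 0 + p.1 1) = 0 := hu
  rw [hf, hf, sub_zero, add_zero, mul_eq_zero] at hu'
  refine Prod.ext (funext hf) (hu'.resolve_left ?_)
  have := sqrt_five_bounds.1
  linarith

theorem range_kernelParam : kernelParam.range = gapDifferential.ker := by
  ext l
  rw [LinearMap.mem_range, mem_ker_gapDifferential]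
  constructor
  · rintro ⟨p, rfl⟩
    rw [bodyTuple_kernelParam]
    exact edgeLin_kernelVec p.1 p.2
  · intro h
    obtain ⟨f, w, hfw⟩ := exists_kernelVec_of_edgeLin h
    refine ⟨(f, w), ?_⟩
    ext1 i
    change rotateVec (frame i) (kernelVec f w i) = l i
    rw [← hfw]
    exact rotateVec_bodyCoord (frame i) (l i)

theorem finrank_ker_gapDifferential : Module.finrank ℝ gapDifferential.ker = 7 := by
  rw [← range_kernelParam, LinearMap.finrank_range_of_inj kernelParam_injective]
  simp

theorem finrank_rotDirections : Module.finrank ℝ rotDirections = 3 := by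
  let c : E3 →ₗ[ℝ] TM6 :=
    { toFun := fun ω => WithLp.toLp 2 fun _ => ω
      map_add' := fun _ _ => rfl
      map_smul' := fun _ _ => rfl }
  have hc : Function.Injective c := fun a b h => congrFun (congrArg WithLp.ofLp h) 0
  have hr : c.range = rotDirections := by
    ext l
    rw [LinearMap.mem_range]
    constructor
    · rintro ⟨ω, rfl⟩ i j
      rfl
    · intro h
      refine ⟨l 0, ?_⟩
      ext1 i
      exact h 0 i
  rw [← hr, LinearMap.finrank_range_of_inj hc]
  simp

/-- The seven-dimensional kernel contains the three-dimensional space of global rotations. -/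
theorem finrank_decay_space :
    Module.finrank ℝ (gapDifferential.ker.map rotDirections.mkQ) = 4 := by
  have h := LinearMap.finrank_range_add_finrank_ker
    (rotDirections.mkQ ∘ₗ gapDifferential.ker.subtype)
  rw [LinearMap.range_comp, Submodule.range_subtype, LinearMap.ker_comp, Submodule.ker_mkQ,
    (Submodule.comapSubtypeEquivOfLe rotDirections_le).finrank_eq, finrank_rotDirections,
    finrank_ker_gapDifferential] at h
  omega

/-! ### Decay of the minimal distance along geodesics -/

/-- The gap of the pair `(i, nbr k i)` at the time `t` along the geodesic with the initial
velocity `l`. -/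
noncomputable def expGap (l : TM6) (k : Fin 4) (i : Fin 6) (t : ℝ) : ℝ :=
  gap ((rot (t • l i) * frame i)⁻¹ * (rot (t • l (nbr k i)) * frame (nbr k i))).1

open Asymptotics in
theorem expGap_second_order {l : TM6} {k : Fin 3} {i : Fin 6}
    (hl : edgeLin (bodyTuple l) k i = 0) {δ : ℝ} (hδ : 0 < δ) :
    ∀ᶠ t in 𝓝 (0 : ℝ), |expGap l k.castSucc i t - t ^ 2 * edgeQuad (bodyTuple l) k i| ≤
      δ * t ^ 2 := by
  have h := edgeGap_exp_expansion l k.castSucc i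
  have ho : (fun t : ℝ => t ^ 3) =o[𝓝 0] fun t : ℝ => t ^ 2 := isLittleO_pow_pow (by norm_num)
  filter_upwards [(h.trans_isLittleO ho).bound hδ] with t ht
  rw [gap_relMat] at ht
  rw [Real.norm_eq_abs, Real.norm_eq_abs, abs_of_nonneg (sq_nonneg t)] at ht
  have hl' : gapLin (relMat k.castSucc) (bodyTuple l i) (bodyTuple l (nbr k.castSucc i)) = 0 := hl
  rw [hl', mul_zero, sub_zero, sub_zero] at ht
  exact ht

open Asymptotics in
theorem expGap_first_order (l : TM6) (k : Fin 3) (i : Fin 6) {δ : ℝ} (hδ : 0 < δ) :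
    ∀ᶠ t in 𝓝 (0 : ℝ), |expGap l k.castSucc i t - t * edgeLin (bodyTuple l) k i| ≤ δ * |t| := by
  have h := edgeGap_exp_expansion l k.castSucc i
  have ho : (fun t : ℝ => t ^ 3) =o[𝓝 0] fun t : ℝ => t ^ 1 := isLittleO_pow_pow (by norm_num)
  have ho2 : (fun t : ℝ => t ^ 2 * edgeQuad (bodyTuple l) k i) =o[𝓝 0] fun t : ℝ => t ^ 1 := by
    have : (fun t : ℝ => t ^ 2) =o[𝓝 0] fun t : ℝ => t ^ 1 := isLittleO_pow_pow (by norm_num)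
    exact (this.const_mul_left (edgeQuad (bodyTuple l) k i)).congr_left fun t => mul_comm _ _
  filter_upwards [((h.trans_isLittleO ho).add ho2).bound hδ] with t ht
  rw [gap_relMat] at ht
  rw [Real.norm_eq_abs, Real.norm_eq_abs, pow_one] at ht
  refine le_of_eq_of_le (congrArg abs ?_) ht
  rw [expGap, edgeLin, edgeQuad]
  ring

theorem tendsto_exp_frames (l : TM6) (i : Fin 6) :
    Tendsto (fun t : ℝ => rot (t • l i) * frame i) (𝓝 0) (𝓝 (frame i)) :=
  tendsto_rot (l i) (frame i)

theorem expGap_last_nonneg (l : TM6) : ∀ᶠ t in 𝓝 (0 : ℝ), ∀ i, 0 ≤ expGap l (Fin.last 3) i t := by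
  refine eventually_all.2 fun i => ?_
  have h := (continuous_gap.comp continuous_subtype_val).tendsto _ |>.comp
    (tendsto_relative (tendsto_exp_frames l i) (tendsto_exp_frames l (nbr (Fin.last 3) i)))
  rw [Function.comp_apply, ← relMat_eq] at h
  have h2 := h.eventually_const_lt (u := 0) (by
    refine lt_of_lt_of_eq ?_ gap_relMat_three.symm
    norm_num)
  exact h2.mono fun t ht => ht.le

theorem mult_total_pos : 0 < ∑ k : Fin 3, ∑ _i : Fin 6, mult k :=
  Finset.sum_pos (fun k _ => Finset.sum_pos (fun _ _ => mult_pos k) Finset.univ_nonempty)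
    Finset.univ_nonempty

theorem minDist_exp_le_of_lagrangian_le {l : TM6} (hl : ∀ k i, edgeLin (bodyTuple l) k i = 0)
    {κ : ℝ} (hκ : 0 < κ) (hq : lagrangian (bodyTuple l) ≤ -κ) :
    ∀ᶠ t in 𝓝 (0 : ℝ), minDist (expMap Cm (t • l)) ≤
      √(12 / 11) - κ / (8 * ∑ k : Fin 3, ∑ _i : Fin 6, mult k) * t ^ 2 := by
  have hΛ := mult_total_pos
  have hq' : ∑ k, mult k * ∑ i, edgeQuad (bodyTuple l) k i ≤ -κ := by
    simpa only [lagrangian, ← Finset.mul_sum] using hq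
  set Λ := ∑ k : Fin 3, ∑ _i : Fin 6, mult k with hΛdef
  have hall : ∀ᶠ t in 𝓝 (0 : ℝ), ∀ k i,
      |expGap l (Fin.castSucc k) i t - t ^ 2 * edgeQuad (bodyTuple l) k i| ≤
        κ / (2 * Λ) * t ^ 2 :=
    eventually_all.2 fun k => eventually_all.2 fun i =>
      expGap_second_order (hl k i) (by positivity)
  filter_upwards [hall, eventually_direction_lt (tendsto_exp_frames l)] with t ht hc
  rw [expMap_Cm]
  have := minDist_le_of_sum_le (X := fun i => rot (t • l i) * frame i)
    (ε := κ / (2 * Λ) * t ^ 2) (fun k i => (hc k i).trans (by norm_num)) (by positivity) (by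
      have h1 : ∑ k : Fin 3, ∑ i, mult k * expGap l k.castSucc i t ≤
          ∑ k : Fin 3, ∑ i, (t ^ 2 * (mult k * edgeQuad (bodyTuple l) k i) +
            κ / (2 * Λ) * t ^ 2 * mult k) := by
        refine Finset.sum_le_sum fun k _ => Finset.sum_le_sum fun i _ => ?_
        have h2 := (abs_le.1 (ht k i)).2
        nlinarith [mult_pos k]
      refine h1.trans ?_
      simp only [Finset.sum_add_distrib, ← Finset.mul_sum]
      rw [← hΛdef]
      have h3 : t ^ 2 * ∑ k, mult k * ∑ i, edgeQuad (bodyTuple l) k i ≤ t ^ 2 * -κ :=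
        mul_le_mul_of_nonneg_left hq' (sq_nonneg t)
      have h4 : κ / (2 * Λ) * t ^ 2 * Λ = κ / 2 * t ^ 2 := by
        field_simp
      rw [h4, neg_mul, h4]
      linarith)
  refine this.trans_eq ?_
  field_simp
  ring

theorem le_minDist_exp_of_abs_edgeQuad_le {l : TM6} (hl : ∀ k i, edgeLin (bodyTuple l) k i = 0)
    {C δ : ℝ} (hδ : 0 < δ) (hC : ∀ k i, |edgeQuad (bodyTuple l) k i| ≤ C) :
    ∀ᶠ t in 𝓝 (0 : ℝ), √(12 / 11) - 4 * ((C + δ) * t ^ 2) ≤ minDist (expMap Cm (t • l)) := by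
  have hC0 : 0 ≤ C := (abs_nonneg _).trans (hC 0 0)
  have hall : ∀ᶠ t in 𝓝 (0 : ℝ), ∀ k i,
      |expGap l (Fin.castSucc k) i t - t ^ 2 * edgeQuad (bodyTuple l) k i| ≤ δ * t ^ 2 :=
    eventually_all.2 fun k => eventually_all.2 fun i => expGap_second_order (hl k i) hδ
  filter_upwards [hall, eventually_direction_lt (tendsto_exp_frames l),
    expGap_last_nonneg l] with t ht hc hlast
  rw [expMap_Cm]
  refine le_minDist_of_le_gap (X := fun i => rot (t • l i) * frame i) hc (by positivity) ?_
  intro k i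
  change -((C + δ) * t ^ 2) ≤ expGap l k i t
  induction k using Fin.lastCases with
  | last =>
    refine le_trans ?_ (hlast i)
    rw [neg_nonpos]
    positivity
  | cast k =>
    have h1 := (abs_le.1 (ht k i)).1
    have h2 := (abs_le.1 (hC k i)).1
    nlinarith [sq_nonneg t]

theorem minDist_exp_le_of_edgeLin_neg {l : TM6} {k : Fin 3} {i : Fin 6}
    (hl : edgeLin (bodyTuple l) k i < 0) :
    ∀ᶠ t in 𝓝[>] (0 : ℝ), minDist (expMap Cm (t • l)) ≤
      √(12 / 11) - -edgeLin (bodyTuple l) k i / 8 * t := by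
  have h1 := expGap_first_order l k i (δ := -edgeLin (bodyTuple l) k i / 2) (by linarith)
  filter_upwards [nhdsWithin_le_nhds h1,
    nhdsWithin_le_nhds (eventually_direction_lt (tendsto_exp_frames l)),
    self_mem_nhdsWithin] with t ht hc htpos
  rw [mem_Ioi] at htpos
  rw [expMap_Cm, show √(12 / 11) - -edgeLin (bodyTuple l) k i / 8 * t =
    √(12 / 11) - (-edgeLin (bodyTuple l) k i / 2 * t) / 4 by ring]
  refine (minDist_le _ (nbr_ne k.castSucc i).symm).trans
    (lineDist_le_of_gap_le ((hc k.castSucc i).trans (by norm_num))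
      (mul_nonneg (by linarith) htpos.le) ?_)
  rw [abs_of_pos htpos] at ht
  have h2 := (abs_le.1 ht).2
  change expGap l k.castSucc i t ≤ _
  linarith

theorem le_minDist_exp_of_abs_edgeLin_le {l : TM6} {C : ℝ}
    (hC : ∀ k i, |edgeLin (bodyTuple l) k i| ≤ C) :
    ∀ᶠ t in 𝓝[>] (0 : ℝ), √(12 / 11) - 4 * ((C + 1) * t) ≤ minDist (expMap Cm (t • l)) := by
  have hC0 : 0 ≤ C := (abs_nonneg _).trans (hC 0 0)
  have hall : ∀ᶠ t in 𝓝 (0 : ℝ), ∀ k i,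
      |expGap l (Fin.castSucc k) i t - t * edgeLin (bodyTuple l) k i| ≤ 1 * |t| :=
    eventually_all.2 fun k => eventually_all.2 fun i => expGap_first_order l k i one_pos
  filter_upwards [nhdsWithin_le_nhds hall,
    nhdsWithin_le_nhds (eventually_direction_lt (tendsto_exp_frames l)),
    nhdsWithin_le_nhds (expGap_last_nonneg l), self_mem_nhdsWithin] with t ht hc hlast htpos
  rw [mem_Ioi] at htpos
  rw [expMap_Cm]
  refine le_minDist_of_le_gap (X := fun i => rot (t • l i) * frame i) hc (by positivity) ?_
  intro k i
  change -((C + 1) * t) ≤ expGap l k i t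
  induction k using Fin.lastCases with
  | last =>
    refine le_trans ?_ (hlast i)
    rw [neg_nonpos]
    positivity
  | cast k =>
    have h0 := ht k i
    rw [abs_of_pos htpos] at h0
    have h1 := (abs_le.1 h0).1
    have h2 := (abs_le.1 (hC k i)).1
    nlinarith

theorem continuous_bodyTuple : Continuous fun l : TM6 => bodyTuple l := by
  refine continuous_pi fun i => ?_
  unfold bodyTuple bodyCoord
  fun_prop

theorem bodyTuple_smul (c : ℝ) (l : TM6) : bodyTuple (c • l : TM6) = c • bodyTuple l :=
  funext fun i => bodyCoord_smul (frame i) c (l i)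

theorem exists_edgeQuad_bound :
    ∃ C : ℝ, ∀ (l : TM6) k i, |edgeQuad (bodyTuple l) k i| ≤ C * ‖l‖ ^ 2 := by
  have hb : ∀ k i, ∃ C : ℝ, ∀ l : TM6, |edgeQuad (bodyTuple l) k i| ≤ C * ‖l‖ ^ 2 := by
    intro k i
    obtain ⟨C, hC⟩ := (isCompact_sphere (0 : TM6) 1).exists_bound_of_continuousOn
      ((continuous_edgeQuad k i).comp continuous_bodyTuple).continuousOn
    refine ⟨C, fun l => ?_⟩
    rcases eq_or_ne l 0 with rfl | hl
    · have : bodyTuple (0 : TM6) = (0 : ℝ) • bodyTuple (0 : TM6) := by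
        rw [← bodyTuple_smul, zero_smul]
      rw [this, edgeQuad_smul]
      simp
    · have hn : ‖l‖ ≠ 0 := norm_ne_zero_iff.2 hl
      have h1 := hC (‖l‖⁻¹ • l) (by simp [norm_smul, hn])
      have h2 : bodyTuple l = ‖l‖ • bodyTuple (‖l‖⁻¹ • l : TM6) := by
        rw [← bodyTuple_smul, smul_smul, mul_inv_cancel₀ hn, one_smul]
      rw [h2, edgeQuad_smul, abs_mul, abs_of_nonneg (sq_nonneg _), mul_comm]
      exact mul_le_mul_of_nonneg_right h1 (sq_nonneg _)
  choose C hC using hb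
  refine ⟨∑ k, ∑ i, |C k i|, fun l k i => (hC k i l).trans
    (mul_le_mul_of_nonneg_right ?_ (sq_nonneg _))⟩
  calc C k i ≤ |C k i| := le_abs_self _
    _ ≤ ∑ i, |C k i| := Finset.single_le_sum (f := fun i => |C k i|)
        (fun _ _ => abs_nonneg _) (Finset.mem_univ i)
    _ ≤ ∑ k, ∑ i, |C k i| := Finset.single_le_sum (f := fun k => ∑ i, |C k i|)
        (fun _ _ => Finset.sum_nonneg fun _ _ => abs_nonneg _) (Finset.mem_univ k)

theorem isClosed_submodule {E : Type*} [NormedAddCommGroup E] [NormedSpace ℝ E]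
    [FiniteDimensional ℝ E] (V : Submodule ℝ E) : IsClosed (V : Set E) :=
  V.closed_of_finiteDimensional

/-- A continuous function that is negative on the nonzero vectors of a subspace is bounded away
from zero on its unit sphere. -/
theorem exists_le_neg_on_sphere {E : Type*} [NormedAddCommGroup E] [NormedSpace ℝ E]
    [FiniteDimensional ℝ E] (V : Submodule ℝ E) {f : E → ℝ} (hf : Continuous f)
    (hneg : ∀ l ∈ V, l ≠ 0 → f l < 0) :
    ∃ κ : ℝ, 0 < κ ∧ ∀ l ∈ V, ‖l‖ = 1 → f l ≤ -κ := by
  have hcomp : IsCompact (Metric.sphere (0 : E) 1 ∩ (V : Set E)) :=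
    (isCompact_sphere 0 1).inter_right (isClosed_submodule V)
  rcases (Metric.sphere (0 : E) 1 ∩ (V : Set E)).eq_empty_or_nonempty with he | hne
  · refine ⟨1, one_pos, fun l hl hn => ?_⟩
    have : l ∈ Metric.sphere (0 : E) 1 ∩ (V : Set E) := ⟨mem_sphere_zero_iff_norm.2 hn, hl⟩
    rw [he] at this
    exact this.elim
  · obtain ⟨m, hm, hmax⟩ := hcomp.exists_isMaxOn hne hf.continuousOn
    refine ⟨-f m, ?_, fun l hl hn => ?_⟩
    · rw [neg_pos]
      refine hneg m hm.2 ?_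
      rintro rfl
      simpa using hm.1
    · rw [neg_neg]
      exact hmax ⟨mem_sphere_zero_iff_norm.2 hn, hl⟩

/-- On a complement of the rotations the Lagrangian is definite on the kernel, hence by compactness
at most a negative multiple of the squared norm. -/
theorem exists_lagrangian_bound {S : Submodule ℝ TM6} (hS : IsCompl S rotDirections) :
    ∃ κ : ℝ, 0 < κ ∧ ∀ l ∈ S, (∀ k i, edgeLin (bodyTuple l) k i = 0) →
      lagrangian (bodyTuple l) ≤ -(κ * ‖l‖ ^ 2) := by
  have hneg : ∀ l ∈ S ⊓ gapDifferential.ker, l ≠ 0 → lagrangian (bodyTuple l) < 0 := by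
    rintro l ⟨hlS, hlK⟩ hl
    have hlK' := mem_ker_gapDifferential.1 hlK
    refine lt_of_le_of_ne (lagrangian_nonpos hlK') fun h0 => hl ?_
    have hrot : l ∈ rotDirections := fun i j =>
      (eq_const_of_lagrangian_eq_zero hlK' h0 i).trans
        (eq_const_of_lagrangian_eq_zero hlK' h0 j).symm
    exact Submodule.disjoint_def.1 hS.disjoint l hlS hrot
  obtain ⟨κ, hκ, hκS⟩ := exists_le_neg_on_sphere (S ⊓ gapDifferential.ker)
    (continuous_lagrangian.comp continuous_bodyTuple) hneg
  refine ⟨κ, hκ, fun l hlS hlK => ?_⟩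
  rcases eq_or_ne l 0 with rfl | hl
  · simpa using lagrangian_nonpos hlK
  · have hn : ‖l‖ ≠ 0 := norm_ne_zero_iff.2 hl
    have h2 : bodyTuple l = ‖l‖ • bodyTuple (‖l‖⁻¹ • l : TM6) := by
      rw [← bodyTuple_smul, smul_smul, mul_inv_cancel₀ hn, one_smul]
    rw [h2, lagrangian_smul]
    have h1 : lagrangian (bodyTuple (‖l‖⁻¹ • l : TM6)) ≤ -κ := hκS (‖l‖⁻¹ • l)
      (Submodule.smul_mem _ _ ⟨hlS, mem_ker_gapDifferential.2 hlK⟩)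
      (by rw [norm_smul, norm_inv, norm_norm, inv_mul_cancel₀ hn])
    nlinarith [sq_nonneg ‖l‖]

theorem second_order_decay (S : Submodule ℝ TM6) (hS : IsCompl S rotDirections) :
    ∃ cd cu : ℝ, 0 < cd ∧ cd ≤ cu ∧ ∀ l ∈ S,
      rotDirections.mkQ l ∈ gapDifferential.ker.map rotDirections.mkQ →
      ∀ᶠ t : ℝ in 𝓝 0,
        -cu * ‖l‖ ^ 2 * t ^ 2 ≤ minDist (expMap Cm (t • l)) - minDist Cm ∧
        minDist (expMap Cm (t • l)) - minDist Cm ≤ -cd * ‖l‖ ^ 2 * t ^ 2 := by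
  obtain ⟨κ, hκ, hκS⟩ := exists_lagrangian_bound hS
  obtain ⟨C, hC⟩ := exists_edgeQuad_bound
  have hΛ := mult_total_pos
  have hcd : 0 < κ / (8 * ∑ k : Fin 3, ∑ _i : Fin 6, mult k) := by positivity
  refine ⟨κ / (8 * ∑ k : Fin 3, ∑ _i : Fin 6, mult k),
    max (4 * (C + 1)) (κ / (8 * ∑ k : Fin 3, ∑ _i : Fin 6, mult k)), hcd, le_max_right _ _, ?_⟩
  intro l hlS hl
  rw [mkQ_mem_iff] at hl
  rcases eq_or_ne l 0 with rfl | hl0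
  · refine Eventually.of_forall fun t => ?_
    have : expMap Cm (t • (0 : TM6)) = Cm := by
      rw [expMap_Cm, Cm_eq_lineOf]
      funext i
      simp [rot_zero]
    rw [this]
    simp
  · have hn : 0 < ‖l‖ ^ 2 := by positivity
    filter_upwards [minDist_exp_le_of_lagrangian_le hl (mul_pos hκ hn) (hκS l hlS hl),
      le_minDist_exp_of_abs_edgeQuad_le hl hn (hC l)] with t h1 h2
    rw [minDist_Cm]
    constructor
    · have h3 := mul_le_mul_of_nonneg_right (le_max_left (4 * (C + 1))
        (κ / (8 * ∑ k : Fin 3, ∑ _i : Fin 6, mult k))) (mul_nonneg hn.le (sq_nonneg t))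
      linarith
    · have h4 : κ * ‖l‖ ^ 2 / (8 * ∑ k : Fin 3, ∑ _i : Fin 6, mult k) * t ^ 2 =
          κ / (8 * ∑ k : Fin 3, ∑ _i : Fin 6, mult k) * ‖l‖ ^ 2 * t ^ 2 := by ring
      linarith

/-- By the equilibrium condition, outside of the kernel some contact distance decreases to first
order. -/
theorem first_order_decay (l : TM6)
    (hl : rotDirections.mkQ l ∉ gapDifferential.ker.map rotDirections.mkQ) :
    ∃ cd cu : ℝ, 0 < cd ∧ cd ≤ cu ∧ ∀ᶠ t : ℝ in 𝓝[>] 0,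
      -cu * t ≤ minDist (expMap Cm (t • l)) - minDist Cm ∧
      minDist (expMap Cm (t • l)) - minDist Cm ≤ -cd * t := by
  rw [mkQ_mem_iff] at hl
  obtain ⟨k, i, hki⟩ : ∃ k i, edgeLin (bodyTuple l) k i < 0 := by
    by_contra! hnn
    refine hl fun k i => ?_
    have h5 := sum_mult_edgeLin (bodyTuple l)
    rw [Finset.sum_eq_zero_iff_of_nonneg fun k _ => Finset.sum_nonneg fun i _ =>
      mul_nonneg (mult_pos k).le (hnn k i)] at h5
    have h6 := h5 k (Finset.mem_univ k)
    rw [Finset.sum_eq_zero_iff_of_nonneg fun i _ => mul_nonneg (mult_pos k).le (hnn k i)] at h6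
    exact (mul_eq_zero.1 (h6 i (Finset.mem_univ i))).resolve_left (mult_pos k).ne'
  obtain ⟨C, hC⟩ : ∃ C : ℝ, ∀ k i, |edgeLin (bodyTuple l) k i| ≤ C :=
    ⟨∑ k, ∑ i, |edgeLin (bodyTuple l) k i|, fun k i =>
      (Finset.single_le_sum (f := fun i => |edgeLin (bodyTuple l) k i|)
        (fun _ _ => abs_nonneg _) (Finset.mem_univ i)).trans
      (Finset.single_le_sum (f := fun k => ∑ i, |edgeLin (bodyTuple l) k i|)
        (fun _ _ => Finset.sum_nonneg fun _ _ => abs_nonneg _) (Finset.mem_univ k))⟩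
  refine ⟨-edgeLin (bodyTuple l) k i / 8, max (4 * (C + 1)) (-edgeLin (bodyTuple l) k i / 8),
    by linarith, le_max_right _ _, ?_⟩
  filter_upwards [minDist_exp_le_of_edgeLin_neg hki, le_minDist_exp_of_abs_edgeLin_le hC,
    self_mem_nhdsWithin] with t h1 h2 ht
  rw [mem_Ioi] at ht
  rw [minDist_Cm]
  have h3 := mul_le_mul_of_nonneg_right (le_max_left (4 * (C + 1))
    (-edgeLin (bodyTuple l) k i / 8)) ht.le
  constructor <;> linarith

/-! ### Cylinders and their axes -/

theorem mem_parallelLine_iff {ρ : ℝ} (hρ : ρ ≠ 0) {X : SO3} {p : E3} :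
    p ∈ parallelLine ρ (lineOf X) ↔ ∃ q ∈ lineSet (lineOf X), ρ • q = p := by
  rw [mem_parallelLine_lineOf]
  constructor
  · rintro ⟨s, rfl⟩
    refine ⟨_, mem_lineSet_lineOf.2 ⟨s / ρ, rfl⟩, ?_⟩
    rw [smul_add, smul_smul, mul_div_cancel₀ _ hρ]
  · rintro ⟨q, hq, rfl⟩
    obtain ⟨s, rfl⟩ := mem_lineSet_lineOf.1 hq
    exact ⟨ρ * s, by rw [smul_add, smul_smul]⟩

theorem parallelLine_nonempty (ρ : ℝ) (X : SO3) : (parallelLine ρ (lineOf X)).Nonempty :=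
  ⟨_, mem_parallelLine_lineOf.2 ⟨0, rfl⟩⟩

theorem le_norm_of_mem_parallelLine {ρ : ℝ} {X : SO3} {p : E3}
    (hp : p ∈ parallelLine ρ (lineOf X)) : |ρ| ≤ ‖p‖ := by
  obtain ⟨s, rfl⟩ := mem_parallelLine_lineOf.1 hp
  have h : ρ = inner ℝ (col 0 X) (ρ • col 0 X + s • col 1 X) := by
    rw [inner_add_right, inner_smul_right, inner_smul_right, inner_col, inner_col,
      transpose_mul_self]
    simp
  have h2 := abs_real_inner_le_norm (col 0 X) (ρ • col 0 X + s • col 1 X)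
  rwa [← h, norm_col, one_mul] at h2

theorem rm_pos : 0 < rm := by
  unfold rm
  positivity

theorem one_add_rm_mul_sqrt : (1 + rm) * √(12 / 11) = 2 * rm := by
  have h33 : √33 ^ 2 = (33 : ℝ) := Real.sq_sqrt (by norm_num)
  have h := sq_sqrt_value
  refine (sq_eq_sq₀ (mul_nonneg (by linarith [rm_pos]) (Real.sqrt_nonneg _))
    (by linarith [rm_pos])).1 ?_
  rw [mul_pow, h]
  unfold rm
  linear_combination (-(1 : ℝ) / 22) * h33

theorem mem_cylinder {r : ℝ} {X : SO3} {p : E3} :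
    p ∈ cylinder r (lineOf X) ↔ ∃ a ∈ parallelLine (1 + r) (lineOf X), dist p a < r :=
  Metric.infDist_lt_iff (parallelLine_nonempty _ _)

theorem isOpen_cylinder (r : ℝ) (u : M) : IsOpen (cylinder r u) :=
  isOpen_lt (Metric.continuous_infDist_pt _) continuous_const

theorem dist_smul_smul {ρ : ℝ} (hρ : 0 < ρ) (p q : E3) : dist (ρ • p) (ρ • q) = ρ * dist p q := by
  rw [dist_smul₀, Real.norm_of_nonneg hρ.le]

/-- The axes of two cylinders of radius `r` are at the distance `1 + r` times that of their
generators, so that disjointness means distance at least `2 r` of the axes. -/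
theorem disjoint_cylinder_iff {r : ℝ} (hr : 0 < r) {X Y : SO3} :
    Disjoint (cylinder r (lineOf X)) (cylinder r (lineOf Y)) ↔
      2 * r ≤ (1 + r) * lineDist (lineOf X) (lineOf Y) := by
  have hρ : 0 < 1 + r := by linarith
  constructor
  · intro h
    rw [← div_le_iff₀' hρ]
    refine le_csInf ⟨_, _, mem_lineSet_lineOf.2 ⟨0, rfl⟩, _, mem_lineSet_lineOf.2 ⟨0, rfl⟩, rfl⟩ ?_
    rintro _ ⟨a, ha, b, hb, rfl⟩
    rw [div_le_iff₀' hρ, ← dist_smul_smul hρ]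
    by_contra! hlt
    refine disjoint_left.1 h
      (?_ : midpoint ℝ ((1 + r) • a) ((1 + r) • b) ∈ cylinder r (lineOf X)) ?_
    · refine mem_cylinder.2 ⟨_, (mem_parallelLine_iff hρ.ne').2 ⟨a, ha, rfl⟩, ?_⟩
      rw [dist_midpoint_left, Real.norm_eq_abs, abs_of_pos (by norm_num)]
      linarith
    · refine mem_cylinder.2 ⟨_, (mem_parallelLine_iff hρ.ne').2 ⟨b, hb, rfl⟩, ?_⟩
      rw [dist_midpoint_right, Real.norm_eq_abs, abs_of_pos (by norm_num)]
      linarith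
  · intro h
    refine disjoint_left.2 fun p hp hq => ?_
    obtain ⟨a, ha, hpa⟩ := mem_cylinder.1 hp
    obtain ⟨b, hb, hpb⟩ := mem_cylinder.1 hq
    obtain ⟨a, ha', rfl⟩ := (mem_parallelLine_iff hρ.ne').1 ha
    obtain ⟨b, hb', rfl⟩ := (mem_parallelLine_iff hρ.ne').1 hb
    have h1 := dist_triangle_left ((1 + r) • a) ((1 + r) • b) p
    rw [dist_smul_smul hρ] at h1
    have h2 : lineDist (lineOf X) (lineOf Y) ≤ dist a b := setDist_le_dist ha' hb'
    have h3 := mul_le_mul_of_nonneg_left h2 hρ.le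
    linarith

theorem disjoint_cylinder_rm_iff {X Y : SO3} :
    Disjoint (cylinder rm (lineOf X)) (cylinder rm (lineOf Y)) ↔
      √(12 / 11) ≤ lineDist (lineOf X) (lineOf Y) := by
  rw [disjoint_cylinder_iff rm_pos, ← one_add_rm_mul_sqrt]
  exact mul_le_mul_iff_of_pos_left (by linarith [rm_pos])

theorem cylinder_disjoint_ball {r : ℝ} (hr : 0 < r) (X : SO3) :
    Disjoint (cylinder r (lineOf X)) (Metric.ball 0 1) := by
  refine disjoint_left.2 fun p hp hq => ?_
  obtain ⟨a, ha, hpa⟩ := mem_cylinder.1 hp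
  have h1 := le_norm_of_mem_parallelLine ha
  rw [abs_of_pos (by linarith)] at h1
  have h2 := dist_triangle_left a 0 p
  rw [dist_zero_right] at h2
  rw [Metric.mem_ball] at hq
  linarith

theorem cylinder_touches_ball {r : ℝ} (hr : 0 < r) (X : SO3) :
    (closure (cylinder r (lineOf X)) ∩ Metric.closedBall 0 1).Nonempty := by
  refine ⟨col 0 X, Metric.mem_closure_iff.2 fun ε hε => ?_, by simp [norm_col]⟩
  have hm : 0 < min (ε / 2) r := lt_min (by linarith) hr
  refine ⟨(1 + min (ε / 2) r) • col 0 X, mem_cylinder.2 ⟨(1 + r) • col 0 X,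
    mem_parallelLine_lineOf.2 ⟨0, by simp⟩, ?_⟩, ?_⟩
  · rw [dist_eq_norm, ← sub_smul, norm_smul, norm_col, mul_one, Real.norm_eq_abs, abs_sub_lt_iff]
    have := min_le_right (ε / 2) r
    constructor <;> linarith
  · rw [dist_eq_norm]
    have : col 0 X - (1 + min (ε / 2) r) • col 0 X = (-min (ε / 2) r) • col 0 X := by module
    rw [this, norm_smul, norm_col, mul_one, norm_neg, Real.norm_of_nonneg hm.le]
    have := min_le_left (ε / 2) r
    linarith

theorem cylindersCm_eq (i : Fin 6) : cylindersCm i = cylinder rm (lineOf (frame i)) := by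
  rw [cylindersCm, Cm_eq]

theorem isCollection_cylindersCm : IsCollection cylindersCm := by
  refine ⟨fun j => isOpen_cylinder _ _, fun i j hij => ?_, fun j => ?_⟩
  · rw [cylindersCm_eq, cylindersCm_eq, disjoint_cylinder_rm_iff, ← minDist_Cm, ← Cm_eq, ← Cm_eq]
    exact minDist_le Cm hij
  · rw [cylindersCm_eq]
    exact ⟨cylinder_disjoint_ball rm_pos _, cylinder_touches_ball rm_pos _⟩

/-- If points of the axes are at the distance `2 r`, then the midpoint of the segment between them
lies in both closures. -/
theorem setDist_cylinder_eq_zero {r : ℝ} (hr : 0 < r) {X Y : SO3} {a b : E3}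
    (ha : a ∈ parallelLine (1 + r) (lineOf X)) (hb : b ∈ parallelLine (1 + r) (lineOf Y))
    (hab : dist a b = 2 * r) :
    setDist (cylinder r (lineOf X)) (cylinder r (lineOf Y)) = 0 := by
  refine le_antisymm (le_of_forall_pos_le_add fun ε hε => ?_) (setDist_nonneg _ _)
  have hm : 0 < min (ε / (4 * r)) (1 / 2) := lt_min (by positivity) (by norm_num)
  set c := min (ε / (4 * r)) (1 / 2) with hc
  have hc2 : c ≤ 1 / 2 := min_le_right _ _
  have hc1 : c * (4 * r) ≤ ε := (le_div_iff₀ (by positivity)).1 (min_le_left _ _)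
  have hp : a + (1 / 2 - c) • (b - a) ∈ cylinder r (lineOf X) := by
    refine mem_cylinder.2 ⟨a, ha, ?_⟩
    rw [dist_eq_norm, add_sub_cancel_left, norm_smul, ← dist_eq_norm b a, dist_comm b a, hab,
      Real.norm_of_nonneg (by linarith)]
    nlinarith
  have hq : b + (1 / 2 - c) • (a - b) ∈ cylinder r (lineOf Y) := by
    refine mem_cylinder.2 ⟨b, hb, ?_⟩
    rw [dist_eq_norm, add_sub_cancel_left, norm_smul, ← dist_eq_norm a b, hab,
      Real.norm_of_nonneg (by linarith)]
    nlinarith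
  refine (setDist_le_dist hp hq).trans ?_
  have : a + (1 / 2 - c) • (b - a) - (b + (1 / 2 - c) • (a - b)) = (2 * c) • (a - b) := by module
  rw [dist_eq_norm, this, norm_smul, ← dist_eq_norm a b, hab, Real.norm_of_nonneg (by linarith)]
  linarith

theorem exists_touching_cylindersCm :
    ∃ i j, i ≠ j ∧ setDist (cylindersCm i) (cylindersCm j) = 0 := by
  refine ⟨0, nbr 0 0, (nbr_ne 0 0).symm, ?_⟩
  have hρ : 0 < 1 + rm := by linarith [rm_pos]
  have hM : ((frame 0).1ᵀ * (frame (nbr 0 0)).1) = relMat 0 := (relMat_eq 0 0).symm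
  have hc : ((frame 0).1ᵀ * (frame (nbr 0 0)).1) 1 1 ^ 2 < 1 := by
    rw [hM]
    exact (relMat_direction 0).trans (by norm_num)
  obtain ⟨s, t, h1, -⟩ := exists_closest_points hc
  have h2 := sq_lineDist_lineOf hc
  rw [congrArg gap hM, show gap (relMat 0) = 0 from gap_relMat 0] at h2
  have h3 := (mul_eq_zero.1 h2).resolve_right (by linarith)
  have h4 : lineDist (lineOf (frame 0)) (lineOf (frame (nbr 0 0))) = √(12 / 11) :=
    (sq_eq_sq₀ (lineDist_nonneg _ _) (Real.sqrt_nonneg _)).1 (by rw [sq_sqrt_value]; linarith)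
  rw [cylindersCm_eq, cylindersCm_eq]
  refine setDist_cylinder_eq_zero rm_pos
    ((mem_parallelLine_iff hρ.ne').2 ⟨_, mem_lineSet_lineOf.2 ⟨s, rfl⟩, rfl⟩)
    ((mem_parallelLine_iff hρ.ne').2 ⟨_, mem_lineSet_lineOf.2 ⟨t, rfl⟩, rfl⟩) ?_
  rw [dist_smul_smul hρ, ← h1, h4, one_add_rm_mul_sqrt]

/-! ### Motions of cylinders -/

/-- The foot of the perpendicular from the origin to the line through `p` with the unit
direction `η`. -/
noncomputable def foot (p η : E3) : E3 := p - inner ℝ p η • η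

theorem inner_foot {p η : E3} (hη : ‖η‖ = 1) : inner ℝ (foot p η) η = (0 : ℝ) := by
  rw [foot, inner_sub_left, real_inner_smul_left, real_inner_self_eq_norm_sq, hη]
  ring

theorem range_foot (p η : E3) :
    (range fun s : ℝ => foot p η + s • η) = range fun s : ℝ => p + s • η := by
  ext q
  constructor
  · rintro ⟨s, rfl⟩
    exact ⟨s - inner ℝ p η, by simp only [foot]; module⟩
  · rintro ⟨s, rfl⟩
    exact ⟨s + inner ℝ p η, by simp only [foot]; module⟩

theorem norm_foot_le {p η : E3} (hη : ‖η‖ = 1) (s : ℝ) : ‖foot p η‖ ≤ ‖foot p η + s • η‖ := by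
  refine (abs_le_of_sq_le_sq' ?_ (norm_nonneg _)).2
  rw [norm_add_sq_real, real_inner_smul_right, inner_foot hη]
  nlinarith [sq_nonneg ‖s • η‖]

/-- A solid cylinder of radius `r` touching the unit ball has its axis at the distance `1 + r`
from the origin. -/
theorem norm_foot_eq {p η : E3} (hη : ‖η‖ = 1) {r : ℝ} (hr : 0 < r)
    (hd : Disjoint {q : E3 | Metric.infDist q (range fun s : ℝ => p + s • η) < r}
      (Metric.ball 0 1))
    (ht : (closure {q : E3 | Metric.infDist q (range fun s : ℝ => p + s • η) < r} ∩
      Metric.closedBall 0 1).Nonempty) : ‖foot p η‖ = 1 + r := by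
  rw [← range_foot] at hd ht
  have hρ : 0 < 1 + r := by linarith
  refine le_antisymm ?_ ?_
  · obtain ⟨z, hz, hz1⟩ := ht
    have hz2 : Metric.infDist z (range fun s : ℝ => foot p η + s • η) ≤ r :=
      closure_lt_subset_le (Metric.continuous_infDist_pt _) continuous_const hz
    rw [mem_closedBall_zero_iff] at hz1
    refine le_of_forall_pos_le_add fun ε hε => ?_
    obtain ⟨_, ⟨s, rfl⟩, hs⟩ := (Metric.infDist_lt_iff (range_nonempty _)).1
      (lt_of_le_of_lt hz2 (lt_add_of_pos_right r hε))
    have h1 := norm_foot_le (p := p) hη s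
    have h2 := dist_triangle_left (foot p η + s • η) 0 z
    rw [dist_zero_right, dist_zero_right] at h2
    dsimp only at hs
    linarith
  · by_contra! hlt
    -- the foot scaled down to the norm below `1` is at a distance below `r` from the foot
    refine disjoint_left.1 hd (?_ : (1 + r)⁻¹ • foot p η ∈
      {q : E3 | Metric.infDist q (range fun s : ℝ => foot p η + s • η) < r}) ?_
    · refine lt_of_le_of_lt (Metric.infDist_le_dist_of_mem
        (mem_range_self (f := fun s : ℝ => foot p η + s • η) 0)) ?_
      have : (1 + r)⁻¹ • foot p η - (foot p η + (0 : ℝ) • η) = (-(r / (1 + r))) • foot p η := by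
        rw [show -(r / (1 + r)) = (1 + r)⁻¹ - 1 by field_simp; ring]
        module
      rw [dist_eq_norm, this, norm_smul, norm_neg, Real.norm_of_nonneg (by positivity),
        div_mul_eq_mul_div, div_lt_iff₀ hρ]
      exact mul_lt_mul_of_pos_left hlt hr
    · rw [mem_ball_zero_iff, norm_smul, norm_inv, Real.norm_of_nonneg hρ.le, inv_mul_lt_iff₀ hρ,
        mul_one]
      exact hlt

theorem image_infDist_lt {Φ : E3 → E3} (hΦ : Isometry Φ) (hs : Function.Surjective Φ) (A : Set E3)
    (r : ℝ) : Φ '' {p | Metric.infDist p A < r} = {p | Metric.infDist p (Φ '' A) < r} := by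
  ext p
  obtain ⟨p, rfl⟩ := hs p
  rw [hΦ.injective.mem_set_image, mem_ofPred_eq, mem_ofPred_eq, Metric.infDist_image hΦ]

theorem isometry_rotateVec (R : SO3) : Isometry (rotateVec R) := by
  refine Isometry.of_dist_eq fun v w => ?_
  rw [dist_eq_norm, dist_eq_norm, sub_eq_add_neg, ← rotateVec_neg, ← rotateVec_add,
    ← sub_eq_add_neg, norm_rotateVec]

theorem surjective_rotateVec (R : SO3) : Function.Surjective (rotateVec R) := by
  intro v
  refine ⟨rotateVec R⁻¹ v, ?_⟩
  have h : R.1 * (R⁻¹).1 = 1 := mul_transpose_self R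
  simp only [rotateVec]
  rw [Matrix.mulVec_mulVec, h, Matrix.one_mulVec]

theorem rotateVec_image_cylinder (R X : SO3) (r : ℝ) :
    rotateVec R '' cylinder r (lineOf X) = cylinder r (lineOf (R * X)) := by
  rw [cylinder, cylinder, image_infDist_lt (isometry_rotateVec R) (surjective_rotateVec R)]
  have : rotateVec R '' parallelLine (1 + r) (lineOf X) =
      parallelLine (1 + r) (lineOf (R * X)) := by
    ext p
    simp only [mem_image, mem_parallelLine_lineOf, ← rotateVec_col]
    constructor
    · rintro ⟨_, ⟨s, rfl⟩, rfl⟩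
      exact ⟨s, by rw [rotateVec_add, rotateVec_smul, rotateVec_smul]⟩
    · rintro ⟨s, rfl⟩
      exact ⟨_, ⟨s, rfl⟩, by rw [rotateVec_add, rotateVec_smul, rotateVec_smul]⟩
  rw [this]

theorem setDist_image {Φ : E3 → E3} (hΦ : Isometry Φ) (A B : Set E3) :
    setDist (Φ '' A) (Φ '' B) = setDist A B := by
  simp only [setDist, image2_image_left, image2_image_right, hΦ.dist_eq]

theorem image_cylinder (g : E3 ≃ᵃⁱ[ℝ] E3) (r : ℝ) (X : SO3) :
    g '' cylinder r (lineOf X) = {q : E3 | Metric.infDist q (range fun s : ℝ =>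
      g ((1 + r) • col 0 X) + s • g.linearIsometryEquiv (col 1 X)) < r} := by
  rw [cylinder, image_infDist_lt g.isometry g.surjective]
  have : g '' parallelLine (1 + r) (lineOf X) = range fun s : ℝ =>
      g ((1 + r) • col 0 X) + s • g.linearIsometryEquiv (col 1 X) := by
    ext q
    simp only [mem_image, mem_parallelLine_lineOf, mem_range]
    have h : ∀ s : ℝ, g ((1 + r) • col 0 X + s • col 1 X) =
        g ((1 + r) • col 0 X) + s • g.linearIsometryEquiv (col 1 X) := by
      intro s
      rw [add_comm, ← vadd_eq_add, g.map_vadd, vadd_eq_add, map_smul, add_comm]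
    constructor
    · rintro ⟨_, ⟨s, rfl⟩, rfl⟩
      exact ⟨s, (h s).symm⟩
    · rintro ⟨s, rfl⟩
      exact ⟨_, ⟨s, rfl⟩, h s⟩
  rw [this]

/-- Along a continuous curve of configurations that starts at the record one and along which the
minimal distance does not drop, only a global rotation takes place: the set of the times where
the configuration is a rotated copy of the record one is closed, and open by the strict local
maximality. -/
theorem eq_rotation_of_curve {X : ℝ≥0 → Fin 6 → SO3} (hX : ∀ i, Continuous fun t => X t i)
    (h0 : ∀ i, X 0 i = frame i) (hd : ∀ t, √(12 / 11) ≤ minDist fun i => lineOf (X t i)) (t : ℝ≥0) :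
    ∀ i, X t i = X t 0 * (frame 0)⁻¹ * frame i := by
  set T : Set ℝ≥0 := {t | ∀ i, X t i = X t 0 * (frame 0)⁻¹ * frame i} with hT
  have hclosed : IsClosed T := by
    rw [hT, ofPred_forall]
    exact isClosed_iInter fun i => isClosed_eq (hX i)
      (((hX 0).mul continuous_const).mul continuous_const)
  have hopen : IsOpen T := isOpen_iff_mem_nhds.2 fun t ht =>
    (eventually_eq_of_le_minDist (fun i => (hX i).tendsto t) ht).mono fun s hs => hs (hd s)
  have huniv : T = univ := IsClopen.eq_univ ⟨hclosed, hopen⟩ ⟨0, fun i => by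
    rw [h0, h0]
    group⟩
  exact huniv.ge (mem_univ t)

theorem isRigid_cylindersCm : IsRigid cylindersCm := by
  rintro g ⟨hg, hg0, hcol⟩
  have hρ : 0 < 1 + rm := by linarith [rm_pos]
  -- the moved axes are the lines `p + s η`, at the distance `1 + rm` from the origin
  set p : Fin 6 → ℝ≥0 → E3 := fun j t => g j t ((1 + rm) • col 0 (frame j)) with hp
  set η : Fin 6 → ℝ≥0 → E3 := fun j t => (g j t).linearIsometryEquiv (col 1 (frame j)) with hη
  have hcyl : ∀ t j, g j t '' cylindersCm j =
      {q : E3 | Metric.infDist q (range fun s : ℝ => p j t + s • η j t) < rm} := fun t j => by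
    rw [cylindersCm_eq, image_cylinder]
  have hη1 : ∀ j t, ‖η j t‖ = 1 := fun j t => by
    rw [hη, LinearIsometryEquiv.norm_map, norm_col]
  have hfoot : ∀ j t, ‖foot (p j t) (η j t)‖ = 1 + rm := fun j t => by
    obtain ⟨-, -, h⟩ := hcol t
    have hj : Disjoint (g j t '' cylindersCm j) (Metric.ball 0 1) ∧
        (closure (g j t '' cylindersCm j) ∩ Metric.closedBall 0 1).Nonempty := h j
    rw [hcyl] at hj
    exact norm_foot_eq (hη1 j t) rm_pos hj.1 hj.2
  -- the generators of the moved cylinders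
  let P : Fin 6 → ℝ≥0 → UnitTangent := fun j t =>
    ⟨((1 + rm)⁻¹ • foot (p j t) (η j t), η j t), by
      rw [norm_smul, hfoot, norm_inv, Real.norm_of_nonneg hρ.le, inv_mul_cancel₀ hρ.ne'],
      hη1 j t, by rw [real_inner_smul_left, inner_foot (hη1 j t), mul_zero]⟩
  have hpc : ∀ j, Continuous (p j) := fun j =>
    (hg j).comp (continuous_id.prodMk continuous_const)
  have hηc : ∀ j, Continuous (η j) := fun j => by
    -- a motion determines its linear part continuously: `η = g ξ - g 0`
    have h : η j = fun t => g j t (col 1 (frame j)) - g j t 0 := by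
      funext t
      have := (g j t).map_vadd 0 (col 1 (frame j))
      rw [vadd_eq_add, vadd_eq_add, add_zero] at this
      rw [this, add_sub_cancel_right]
    rw [h]
    exact ((hg j).comp (continuous_id.prodMk continuous_const)).sub
      ((hg j).comp (continuous_id.prodMk continuous_const))
  have hPc : ∀ j, Continuous (P j) := fun j => by
    have h : Continuous fun t => foot (p j t) (η j t) :=
      (hpc j).sub (((hpc j).inner (𝕜 := ℝ) (hηc j)).smul (hηc j))
    exact Continuous.subtype_mk ((h.const_smul (1 + rm)⁻¹).prodMk (hηc j)) _
  have hPcyl : ∀ t j, g j t '' cylindersCm j = cylinder rm (lineOf (frameOf (P j t))) := by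
    intro t j
    rw [hcyl, lineOf_frameOf, ← range_foot]
    have h : parallelLine (1 + rm) (Quotient.mk lineSetoid (P j t)) =
        range fun s : ℝ => foot (p j t) (η j t) + s • η j t := by
      change (range fun s : ℝ => (1 + rm) • (1 + rm)⁻¹ • foot (p j t) (η j t) + s • η j t) = _
      rw [smul_inv_smul₀ hρ.ne']
    rw [cylinder, h]
  have hP0 : ∀ j, P j 0 = tangentOf (frame j) := by
    intro j
    have h1 : p j 0 = (1 + rm) • col 0 (frame j) := by
      rw [hp]
      simp only [hg0]
      rfl
    have h2 : η j 0 = col 1 (frame j) := by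
      rw [hη]
      simp only [hg0]
      rfl
    have h3 : inner ℝ (col 0 (frame j)) (col 1 (frame j)) = (0 : ℝ) := (tangentOf (frame j)).2.2.2
    refine Subtype.ext (Prod.ext ?_ h2)
    change (1 + rm)⁻¹ • foot (p j 0) (η j 0) = col 0 (frame j)
    rw [h1, h2, foot, real_inner_smul_left, h3, mul_zero, zero_smul, sub_zero,
      inv_smul_smul₀ hρ.ne']
  have hXc : ∀ j, Continuous fun t => frameOf (P j t) := fun j => continuous_frameOf.comp (hPc j)
  have hX0 : ∀ j, frameOf (P j 0) = frame j := fun j => by rw [hP0, frameOf_tangentOf]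
  have hdist : ∀ t, √(12 / 11) ≤ minDist fun i => lineOf (frameOf (P i t)) := by
    intro t
    refine le_minDist fun k i => disjoint_cylinder_rm_iff.1 ?_
    rw [← hPcyl, ← hPcyl]
    exact (hcol t).2.1 _ _ (nbr_ne k i).symm
  have hrot := eq_rotation_of_curve (X := fun t j => frameOf (P j t)) hXc hX0 hdist
  refine ⟨fun t => frameOf (P 0 t) * (frame 0)⁻¹, (hXc 0).mul continuous_const, ?_, fun t j => ?_⟩
  · change frameOf (P 0 0) * (frame 0)⁻¹ = 1
    rw [hX0, mul_inv_cancel]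
  · rw [hPcyl, cylindersCm_eq, rotateVec_image_cylinder, ← hrot t j]

theorem not_canBeUnlocked_cylindersCm : ¬ CanBeUnlocked cylindersCm := by
  rintro ⟨g, hg, i, j, -, h0, hpos⟩
  obtain ⟨R, -, -, hR⟩ := isRigid_cylindersCm g hg
  have h := hpos 1 one_pos
  rw [hR, hR, setDist_image (isometry_rotateVec _), h0] at h
  exact lt_irrefl _ h

end SixLines

theorem theorem1 :
    -- the record value
    minDist Cm = √(12 / 11) ∧
    -- sharp local maximum on `M⁶` (modulo rotations, which leave `D` unchanged)
    (∀ᶠ m in 𝓝 Cm, (∀ R : SO3, m ≠ fun i => rotateLine R (Cm i)) → minDist m < √(12 / 11)) ∧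
    -- the six cylinders: some of them touch, they are rigid and cannot be unlocked
    (IsCollection cylindersCm ∧
      (∃ i j, i ≠ j ∧ setDist (cylindersCm i) (cylindersCm j) = 0) ∧
      IsRigid cylindersCm ∧ ¬ CanBeUnlocked cylindersCm) ∧
    -- second order decay along a 4-dimensional subspace of the tangent space modulo rotations,
    -- first order decay along all the other tangent directions
    (∃ L : Submodule ℝ (TM6 ⧸ rotDirections), Module.finrank ℝ L = 4 ∧
      (∀ S : Submodule ℝ TM6, IsCompl S rotDirections →
        ∃ cd cu : ℝ, 0 < cd ∧ cd ≤ cu ∧ ∀ l ∈ S, rotDirections.mkQ l ∈ L →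
          ∀ᶠ t : ℝ in 𝓝 0,
            -cu * ‖l‖ ^ 2 * t ^ 2 ≤ minDist (expMap Cm (t • l)) - minDist Cm ∧
            minDist (expMap Cm (t • l)) - minDist Cm ≤ -cd * ‖l‖ ^ 2 * t ^ 2) ∧
      (∀ l : TM6, rotDirections.mkQ l ∉ L →
        ∃ cd cu : ℝ, 0 < cd ∧ cd ≤ cu ∧ ∀ᶠ t : ℝ in 𝓝[>] 0,
          -cu * t ≤ minDist (expMap Cm (t • l)) - minDist Cm ∧
          minDist (expMap Cm (t • l)) - minDist Cm ≤ -cd * t)) := by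
  exact ⟨minDist_Cm, eventually_minDist_lt,
    ⟨isCollection_cylindersCm, exists_touching_cylindersCm, isRigid_cylindersCm,
      not_canBeUnlocked_cylindersCm⟩,
    ⟨gapDifferential.ker.map rotDirections.mkQ, finrank_decay_space, second_order_decay,
      first_order_decay⟩⟩
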